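/- A time-varying graph (TVG) $\mathcal G$ with lifetime $\mathbb N$ consists of a finite simple undirected underlying graph $G=(V,E)$, $|V|=n$, and, for every time $t\in\mathbb N$, the set of edges of $E$ available at time $t$; crossing an edge that is available at time $t$ takes one time step, from $t$ to $t+1$. $\mathcal G$ belongs to the class $\mathcal R$ if $G$ is connected and for all $e\in E$, $t\in\mathbb N$ there is $t'>t$ such that $e$ is available at time $t'$. A journey from $s$ starting at time $0$ is a walk $s=v_0,v_1,\dots,v_k$ in $G$ with times $0\le t_1<t_2<\dots<t_k$ such that the edge $v_{i-1}v_i$ is available at time $t_i$; its arrival date is $t_k+1$ ($0$ if $k=0$). The dynamic map visitation problem (DMVP) for a single agent asks, given $\mathcal G$ and a starting vertex $s$, for a journey from $s$ starting at time $0$ that visits every vertex of $G$ and has the earliest possible arrival date. The input consists of $n$, $s$ and a finite prefix of $\mathcal G$, given as a nonempty sequence $(G_1,t_1),\dots,(G_q,t_q)$ of static graphs, represented by adjacency matrices, with durations $t_i\ge1$: $G_1$ consists of the edges available during the first $t_1$ time steps, $G_2$ of those available during the next $t_2$ time steps, and so on. Let $T=\sum_{i=1}^q\min(t_i,\max(1,2n-3))$.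 An algorithm solves DMVP if it outputs an optimal solution for $\mathcal G$ whenever the optimal arrival date is at most $\sum_i t_i$, and otherwise reports that no solution arrives by time $\sum_i t_i$. A $c$-almost-tree is a connected graph with $|V|+c-1$ edges; a graph is $m$-leaf if it has exactly $m$ vertices of degree one. **Theorem.** DMVP for a single agent in $\mathcal R$ is fixed-parameter tractable on TVGs whose underlying graph is an $m$-leaf $c$-almost-tree, with parameter $m$ and $c$ constant. Precisely: for every constant $c\ge0$ there are an algorithm (a program for a random access machine with unit-cost instructions, whose arithmetic instructions are addition and truncated subtraction) and a computable function $f:\mathbb N\to\mathbb N$ such that for every $m$ and every TVG in $\mathcal R$ whose underlying graph is an $m$-leaf $c$-almost-tree, and for every starting vertex and every finite prefix as above, the algorithm solves DMVP in at most $f(m)\cdot T\cdot n^{3+c}$ steps. -/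

import Mathlib

/-! ## Random access machine with unit-cost instructions

Programs are structured programs over finitely many named registers and an indirectly
addressable memory, all cells holding natural numbers. The arithmetic instructions are addition
and (truncated) subtraction only, so that the uniform cost measure is a reasonable one. -/

namespace RAM

/-- A machine configuration: registers, memory, and the output written so far. -/
structure State where
  reg : ℕ → ℕ
  mem : ℕ → ℕ
  out : List ℕ

/-- Programs; the arguments `x y z` are names of registers. -/
inductive Prog where
  | skip : Prog
  /-- `x := a`, for a literal `a` -/
  | const (x a : ℕ) : Prog
  /-- `x := y` -/
  | copy (x y : ℕ) : Prog
  /-- `x := y + z` -/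
  | add (x y z : ℕ) : Prog
  /-- `x := y - z` (truncated) -/
  | sub (x y z : ℕ) : Prog
  /-- `x := memory[y]` -/
  | load (x y : ℕ) : Prog
  /-- `memory[x] := y` -/
  | store (x y : ℕ) : Prog
  /-- append the content of `x` to the output -/
  | write (x : ℕ) : Prog
  | seq (p q : Prog) : Prog
  /-- `if x < y then p else q` -/
  | ifLt (x y : ℕ) (p q : Prog) : Prog
  /-- `while x < y do p` -/
  | whileLt (x y : ℕ) (p : Prog) : Prog

/-- Replace the content of register `x` by `a`. -/
def State.setReg (σ : State) (x a : ℕ) : State :=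
  { σ with reg := Function.update σ.reg x a }

/-- `Exec p σ σ' t`: the program `p`, started in `σ`, halts in `σ'` after exactly `t` steps.
Every instruction and every evaluation of a test is one step. -/
inductive Exec : Prog → State → State → ℕ → Prop
  | skip (σ : State) : Exec Prog.skip σ σ 1
  | const (σ : State) (x a : ℕ) : Exec (Prog.const x a) σ (σ.setReg x a) 1
  | copy (σ : State) (x y : ℕ) : Exec (Prog.copy x y) σ (σ.setReg x (σ.reg y)) 1
  | add (σ : State) (x y z : ℕ) :
      Exec (Prog.add x y z) σ (σ.setReg x (σ.reg y + σ.reg z)) 1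
  | sub (σ : State) (x y z : ℕ) :
      Exec (Prog.sub x y z) σ (σ.setReg x (σ.reg y - σ.reg z)) 1
  | load (σ : State) (x y : ℕ) :
      Exec (Prog.load x y) σ (σ.setReg x (σ.mem (σ.reg y))) 1
  | store (σ : State) (x y : ℕ) :
      Exec (Prog.store x y) σ
        { σ with mem := Function.update σ.mem (σ.reg x) (σ.reg y) } 1
  | write (σ : State) (x : ℕ) :
      Exec (Prog.write x) σ { σ with out := σ.out ++ [σ.reg x] } 1
  | seq {p q : Prog} {σ₁ σ₂ σ₃ : State} {t₁ t₂ : ℕ} :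
      Exec p σ₁ σ₂ t₁ → Exec q σ₂ σ₃ t₂ → Exec (Prog.seq p q) σ₁ σ₃ (t₁ + t₂)
  | ifTrue {x y : ℕ} {p q : Prog} {σ σ' : State} {t : ℕ} :
      σ.reg x < σ.reg y → Exec p σ σ' t → Exec (Prog.ifLt x y p q) σ σ' (1 + t)
  | ifFalse {x y : ℕ} {p q : Prog} {σ σ' : State} {t : ℕ} :
      ¬ σ.reg x < σ.reg y → Exec q σ σ' t → Exec (Prog.ifLt x y p q) σ σ' (1 + t)
  | whileTrue {x y : ℕ} {p : Prog} {σ₁ σ₂ σ₃ : State} {t₁ t₂ : ℕ} :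
      σ₁.reg x < σ₁.reg y → Exec p σ₁ σ₂ t₁ → Exec (Prog.whileLt x y p) σ₂ σ₃ t₂ →
      Exec (Prog.whileLt x y p) σ₁ σ₃ (1 + t₁ + t₂)
  | whileFalse {x y : ℕ} {p : Prog} {σ : State} :
      ¬ σ.reg x < σ.reg y → Exec (Prog.whileLt x y p) σ σ 1

/-- The initial configuration: the input in the memory cells `0, 1, 2, …`, everything else `0`,
and no output yet. -/
def init (input : List ℕ) : State where
  reg := fun _ => 0
  mem := fun i => input.getD i 0
  out := []

/-- On the given input, `p` halts after exactly `t` steps with the given output. -/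
def Computes (p : Prog) (input output : List ℕ) (t : ℕ) : Prop :=
  ∃ σ : State, Exec p (init input) σ t ∧ σ.out = output

end RAM

/-! ## Time-varying graphs -/

/-- A time-varying graph with lifetime `ℕ`, undirected edges and unit latency: the underlying
graph, and for each time the graph of the edges that are available at that time. -/
structure TVG (V : Type) where
  graph : SimpleGraph V
  snap : ℕ → SimpleGraph V
  snap_le : ∀ t, snap t ≤ graph

namespace TVG

variable {V : Type}

/-- The class `𝓡` (recurrent edges): the underlying graph is connected, and at every time each of
its edges will be available again later. -/
def Recurrent (𝒢 : TVG V) : Prop :=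
  𝒢.graph.Connected ∧
    ∀ e ∈ 𝒢.graph.edgeSet, ∀ t : ℕ, ∃ t', t < t' ∧ e ∈ (𝒢.snap t').edgeSet

/-- `𝒢.IsJourney u t J`: `J = [(v₁, t₁), …, (vₖ, tₖ)]` is a journey from `u` departing at time `t`
or later; it takes the edge from `vᵢ₋₁` to `vᵢ` (with `v₀ = u`) at time `tᵢ`, when that edge is
available, and is at `vᵢ` at time `tᵢ + 1`. -/
def IsJourney (𝒢 : TVG V) : V → ℕ → List (V × ℕ) → Prop
  | _, _, [] => True
  | u, t, (v, τ) :: J => t ≤ τ ∧ (𝒢.snap τ).Adj u v ∧ IsJourney 𝒢 v (τ + 1) J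

/-- The arrival date of a journey that starts at time `t`; for `t = 0` this is the temporal
length of a journey that starts at time `0`. -/
def arrival : ℕ → List (V × ℕ) → ℕ
  | t, [] => t
  | _, (_, τ) :: J => arrival (τ + 1) J

/-- The feasible solutions of the single-agent problem: journeys that start at `s` at time `0` and
visit every vertex. -/
def IsSolution (𝒢 : TVG V) (s : V) (J : List (V × ℕ)) : Prop :=
  𝒢.IsJourney s 0 J ∧ ∀ v : V, v = s ∨ ∃ τ : ℕ, (v, τ) ∈ J

/-- The solutions of minimum temporal length. -/
def IsOptimal (𝒢 : TVG V) (s : V) (J : List (V × ℕ)) : Prop :=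
  𝒢.IsSolution s J ∧ ∀ J' : List (V × ℕ), 𝒢.IsSolution s J' → arrival 0 J ≤ arrival 0 J'

end TVG

/-- The number of leaves (vertices of degree one). -/
noncomputable def numLeaves {V : Type} (G : SimpleGraph V) : ℕ :=
  {v : V | (G.neighborSet v).ncard = 1}.ncard

/-- A `c`-almost-tree: a connected graph with `|V| + c - 1` edges. -/
def IsAlmostTree {V : Type} (c : ℕ) (G : SimpleGraph V) : Prop :=
  G.Connected ∧ G.edgeSet.ncard + 1 = Nat.card V + c

/-! ## Input and output -/

namespace DMVP

/-- The finite part of a time-varying graph that is given as input: static graphs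
`(G₁, t₁), …, (G_q, t_q)`, each with its duration, the first one from time `0` on. -/
abbrev Snapshots (n : ℕ) : Type := List (SimpleGraph (Fin n) × ℕ)

/-- `T = t₁ + ⋯ + t_q`. -/
def duration {n : ℕ} (L : Snapshots n) : ℕ := (L.map Prod.snd).sum

/-- `T' = min(t₁, 2n-3) + ⋯ + min(t_q, 2n-3)`, the duration after the time steps of each static
graph beyond the first `2n-3` are skipped (for `n = 1`, where `2n-3` is negative, beyond the
first one). -/
def truncDuration {n : ℕ} (L : Snapshots n) : ℕ :=
  (L.map fun x => min x.2 (max 1 (2 * n - 3))).sum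

/-- The static graph present at a given time (edgeless after the end of the list). -/
def snapAt {n : ℕ} : Snapshots n → ℕ → SimpleGraph (Fin n)
  | [], _ => ⊥
  | (G, d) :: L, t => if t < d then G else snapAt L (t - d)

/-- `L` describes `𝒢` during the times `0, …, T - 1`; there is at least one static graph, and all
durations are positive. -/
def Describes {n : ℕ} (L : Snapshots n) (𝒢 : TVG (Fin n)) : Prop :=
  L ≠ [] ∧ (∀ x ∈ L, 1 ≤ x.2) ∧ ∀ t < duration L, 𝒢.snap t = snapAt L t

open Classical in
/-- The adjacency matrix, row by row. -/
noncomputable def encodeGraph {n : ℕ} (G : SimpleGraph (Fin n)) : List ℕ :=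
  (List.finRange n).flatMap fun u => (List.finRange n).map fun v => if G.Adj u v then 1 else 0

/-- The input: `n`, the starting vertex, the number of static graphs, and then for each static
graph its duration followed by its adjacency matrix. -/
noncomputable def encodeInput {n : ℕ} (L : Snapshots n) (s : Fin n) : List ℕ :=
  n :: (s : ℕ) :: L.length :: L.flatMap fun x => x.2 :: encodeGraph x.1

/-- The output for a journey `[(v₁, t₁), …, (vₖ, tₖ)]`: the list `1, k, v₁, t₁, …, vₖ, tₖ`. -/
def encodeJourney {n : ℕ} (J : List (Fin n × ℕ)) : List ℕ :=
  1 :: J.length :: J.flatMap fun x => [(x.1 : ℕ), x.2]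

/-- The correct outputs: an optimal solution if one exists that arrives no later than `T`, and the
list `0` if there is no solution that arrives by then. -/
def IsCorrectOutput {n : ℕ} (𝒢 : TVG (Fin n)) (L : Snapshots n) (s : Fin n)
    (output : List ℕ) : Prop :=
  (∃ J, 𝒢.IsOptimal s J ∧ TVG.arrival 0 J ≤ duration L ∧ output = encodeJourney J) ∨
    ((∀ J, 𝒢.IsSolution s J → duration L < TVG.arrival 0 J) ∧ output = [0])

end DMVP

/-! The algorithm guesses the edges outside a spanning tree and then runs a dynamic program whose
states record only which of a few checkpoints have been visited.

Let `H` be the union of the given static graphs. A solution that arrives within the given prefix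
moves in `H`, and the edges through which it enters its vertices for the first time form a spanning
tree of `H` (`TVG.exists_firstVisits`, `Visit.exists_isParent`). Since `H` is a subgraph of the
underlying almost-tree, at most `c` edges of `H` lie outside that tree (`card_coTree`), so it can be
found by trying all tuples of `c` edges. For a fixed tuple the checkpoints are the vertices of degree
at most one in `H` and the ends of the edges in the tuple. There are at most `m + 1 + 4 * c` of them
(`card_lowVerts_le`, `card_lowVerts_le_numLeaves`): each edge missing from `H` creates at most two
vertices of low degree.

The states of the dynamic program are the pairs of a vertex and a set of visited checkpoints. Edges
outside the tree may be used only if they do not lead to an unvisited checkpoint. This rule is the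
key. On the one hand, the solution the tree comes from obeys it (`reach_of_firstVisits`). On the
other hand, a journey that obeys it visits with every vertex also its parent in the tree, and when
all checkpoints have been visited, a vertex that is still missing and has the largest depth would be
a leaf of the tree without further edges in `H`, hence a checkpoint (`eq_univ_of_parent_closed`,
`Visit.Models.walk_covers`). So the earliest arrival date in a state with all checkpoints visited is
the optimum for the right tuple; for the other tuples, each candidate is tested for coverage.

While the graph does not change, the set of reachable states is stationary after as many steps as
there are states (`Reach.static`). Hence a static graph of duration `d` needs only `min d N` scans
with `N = n * 2 ^ k` states, `k` being the number of checkpoints, which is within a factor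
`2 * 2 ^ k` of `min d (max 1 (2 * n - 3))` (`Visit.min_mul_le`). A scan takes `O(n * N)` steps and
there are at most `(n + c) ^ c` tuples, which gives the time bound.

The program is written in a small language of counted loops whose semantics counts the steps. A
compiler to the random access machine, correct including the step count (`Cmd.exec_comp`), turns it
into the required program. -/

set_option linter.unusedSimpArgs false

/-! ### A language of counted loops over named variables and arrays -/

/-- The variables of the program; each is kept in a register of its own. -/
inductive Var
  | n | s | q | nn | p | D | M | k0 | d | best | inf | blen | k | len | t | cnt | tt | i | j | b | u
  | v | r | nx | g | e | l | cur | ok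
  deriving DecidableEq

/-- The arrays of the program; each is an infinite sequence of natural numbers. `I` holds the input,
`R` the offsets of the rows of a matrix, `H` the union of the given graphs and `EU`, `EV` its edges,
`P` the checkpoints, `od` the chosen edges, `T` the tree that remains, `X` the move table, `vt` the
positions, `arr` and `pre` the arrival dates and predecessors of the states, `vis`, `WV`, `WT` the
journey that is being traced, and `BV`, `BT` the best journey so far. -/
inductive Arr
  | I | R | H | EU | EV | P | od | T | X | vt | arr | pre | vis | WV | WT | BV | BT
  deriving DecidableEq

/-- States of the loop language; `tm` counts the steps the compiled program has made. -/
structure St where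
  var : Var → ℕ
  arr : Arr → ℕ → ℕ
  out : List ℕ
  tm : ℕ

namespace St

/-- Assign `a` to the variable `x`. -/
def setv (σ : St) (x : Var) (a : ℕ) : St := { σ with var := Function.update σ.var x a }

/-- Assign `v` to the cell `i` of the array `a`. -/
def seta (σ : St) (a : Arr) (i v : ℕ) : St :=
  { σ with arr := Function.update σ.arr a (Function.update (σ.arr a) i v) }

/-- Let `t` steps pass. -/
def tick (σ : St) (t : ℕ) : St := { σ with tm := σ.tm + t }

/-- Append `a` to the output. -/
def emit (σ : St) (a : ℕ) : St := { σ with out := σ.out ++ [a] }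

section
variable (σ : St) (x y : Var) (a b : Arr) (i j w : ℕ)

@[simp] theorem setv_var : (σ.setv x w).var y = if y = x then w else σ.var y := by
  simp [setv, Function.update_apply]
@[simp] theorem setv_arr : (σ.setv x w).arr = σ.arr := rfl
@[simp] theorem setv_out : (σ.setv x w).out = σ.out := rfl
@[simp] theorem setv_tm : (σ.setv x w).tm = σ.tm := rfl
@[simp] theorem seta_var : (σ.seta a i w).var = σ.var := rfl
@[simp] theorem seta_arr : (σ.seta a i w).arr b j = if b = a ∧ j = i then w else σ.arr b j := by
  by_cases h : b = a
  · subst h; simp [seta, Function.update_apply]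
  · simp [seta, h]
@[simp] theorem seta_tm : (σ.seta a i w).tm = σ.tm := rfl
@[simp] theorem tick_var : (σ.tick w).var = σ.var := rfl
@[simp] theorem tick_arr : (σ.tick w).arr = σ.arr := rfl
@[simp] theorem tick_out : (σ.tick w).out = σ.out := rfl
@[simp] theorem tick_tm : (σ.tick w).tm = σ.tm + w := rfl
@[simp] theorem emit_var : (σ.emit w).var = σ.var := rfl
@[simp] theorem emit_arr : (σ.emit w).arr = σ.arr := rfl
@[simp] theorem emit_out : (σ.emit w).out = σ.out ++ [w] := rfl
@[simp] theorem emit_tm : (σ.emit w).tm = σ.tm := rfl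
end

end St

/-- Expressions: literals, variables, sums, truncated differences, array reads. -/
inductive Exp
  | lit (a : ℕ)
  | var (x : Var)
  | add (e f : Exp)
  | sub (e f : Exp)
  | rd (a : Arr) (e : Exp)

namespace Exp

/-- The value of an expression. -/
@[simp] def eval (σ : St) : Exp → ℕ
  | lit a => a
  | var x => σ.var x
  | add e f => e.eval σ + f.eval σ
  | sub e f => e.eval σ - f.eval σ
  | rd a e => σ.arr a (e.eval σ)

/-- The number of steps the compiled expression takes. -/
@[simp] def cost : Exp → ℕ
  | lit _ => 1
  | var _ => 1
  | add e f => e.cost + f.cost + 1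
  | sub e f => e.cost + f.cost + 1
  | rd _ e => e.cost + 9

end Exp

instance (a : ℕ) : OfNat Exp a := ⟨Exp.lit a⟩
instance : Add Exp := ⟨Exp.add⟩
instance : Sub Exp := ⟨Exp.sub⟩

section
variable (σ : St) (e f : Exp) (a : ℕ)
@[simp] theorem Exp.eval_add' : (e + f).eval σ = e.eval σ + f.eval σ := rfl
@[simp] theorem Exp.eval_sub' : (e - f).eval σ = e.eval σ - f.eval σ := rfl
@[simp] theorem Exp.eval_ofNat' : (OfNat.ofNat a : Exp).eval σ = a := rfl
@[simp] theorem Exp.cost_add' : (e + f).cost = e.cost + f.cost + 1 := rfl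
@[simp] theorem Exp.cost_sub' : (e - f).cost = e.cost + f.cost + 1 := rfl
@[simp] theorem Exp.cost_ofNat' : (OfNat.ofNat a : Exp).cost = 1 := rfl
end

/-- Commands. `loop x e c` evaluates `e` once, to `N` say, and runs `c` for `x = 0, …, N - 1`. -/
inductive Cmd
  | skip
  | asg (x : Var) (e : Exp)
  | put (a : Arr) (i e : Exp)
  | write (e : Exp)
  | seq (c d : Cmd)
  /-- `if e < f then c else d` -/
  | ifLt (e f : Exp) (c d : Cmd)
  | loop (x : Var) (e : Exp) (c : Cmd)

/-- Run commands one after the other. -/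
def Cmd.block : List Cmd → Cmd
  | [] => skip
  | c :: cs => seq c (block cs)

/-- `iter f i σ` applies `f 0`, …, `f (i - 1)` in this order. -/
def iter {S : Type} (f : ℕ → S → S) : ℕ → S → S
  | 0, σ => σ
  | i + 1, σ => f i (iter f i σ)

namespace Cmd

/-- The effect of a command, including the number of steps of its compiled form. -/
def run : Cmd → St → St
  | skip, σ => σ.tick 1
  | asg x e, σ => (σ.setv x (e.eval σ)).tick (e.cost + 1)
  | put a i e, σ => (σ.seta a (i.eval σ) (e.eval σ)).tick (i.cost + e.cost + 9)
  | write e, σ => (σ.emit (e.eval σ)).tick (e.cost + 1)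
  | seq c d, σ => d.run (c.run σ)
  | ifLt e f c d, σ =>
      if e.eval σ < f.eval σ then c.run (σ.tick (e.cost + f.cost + 1))
      else d.run (σ.tick (e.cost + f.cost + 1))
  | loop x e c, σ =>
      iter (fun i τ => c.run ((τ.setv x i).tick 3)) (e.eval σ) (σ.tick (e.cost + 3))

/-- Whether the command may change the variable `y`. -/
def modv (y : Var) : Cmd → Bool
  | asg x _ => y = x
  | seq c d => c.modv y || d.modv y
  | ifLt _ _ c d => c.modv y || d.modv y
  | loop x _ c => decide (y = x) || c.modv y
  | _ => false

/-- Whether the command may change the array `b`. -/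
def moda (b : Arr) : Cmd → Bool
  | put a _ _ => b = a
  | seq c d => c.moda b || d.moda b
  | ifLt _ _ c d => c.moda b || d.moda b
  | loop _ _ c => c.moda b
  | _ => false

/-- Whether the command may produce output. -/
def writes : Cmd → Bool
  | write _ => true
  | seq c d => c.writes || d.writes
  | ifLt _ _ c d => c.writes || d.writes
  | loop _ _ c => c.writes
  | _ => false

/-- `τ` differs from `σ` at most in what `c` may change. -/
structure Frame (c : Cmd) (σ τ : St) : Prop where
  var : ∀ y, c.modv y = false → τ.var y = σ.var y
  arr : ∀ a, c.moda a = false → τ.arr a = σ.arr a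
  out : c.writes = false → τ.out = σ.out

theorem Frame.trans {c : Cmd} {σ τ υ : St} (h : Frame c σ τ) (h' : Frame c τ υ) : Frame c σ υ :=
  ⟨fun y hy => (h'.var y hy).trans (h.var y hy), fun y hy => (h'.arr y hy).trans (h.arr y hy),
    fun hy => (h'.out hy).trans (h.out hy)⟩

theorem run_frame (c : Cmd) : ∀ σ, Frame c σ (c.run σ) := by
  induction c with
  | skip => intro σ; exact ⟨fun _ _ => rfl, fun _ _ => rfl, fun _ => rfl⟩
  | asg x e =>
    intro σ
    refine ⟨fun y hy => ?_, fun _ _ => rfl, fun _ => rfl⟩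
    simp only [modv, decide_eq_false_iff_not] at hy
    simp [run, hy]
  | put a i e =>
    intro σ
    refine ⟨fun _ _ => rfl, fun b hb => ?_, fun _ => rfl⟩
    simp only [moda, decide_eq_false_iff_not] at hb
    funext j
    simp [run, hb]
  | write e =>
    intro σ
    exact ⟨fun _ _ => rfl, fun _ _ => rfl, fun h => by simp [writes] at h⟩
  | seq c d hc hd =>
    intro σ
    refine ⟨fun y hy => ?_, fun y hy => ?_, fun hy => ?_⟩
    · simp only [modv, Bool.or_eq_false_iff] at hy
      exact ((hd _).var y hy.2).trans ((hc σ).var y hy.1)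
    · simp only [moda, Bool.or_eq_false_iff] at hy
      exact ((hd _).arr y hy.2).trans ((hc σ).arr y hy.1)
    · simp only [writes, Bool.or_eq_false_iff] at hy
      exact ((hd _).out hy.2).trans ((hc σ).out hy.1)
  | ifLt e f c d hc hd =>
    intro σ
    by_cases h : e.eval σ < f.eval σ
    · refine ⟨fun y hy => ?_, fun y hy => ?_, fun hy => ?_⟩ <;>
        simp only [run, h, if_true]
      · simp only [modv, Bool.or_eq_false_iff] at hy
        exact (hc _).var y hy.1
      · simp only [moda, Bool.or_eq_false_iff] at hy
        exact (hc _).arr y hy.1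
      · simp only [writes, Bool.or_eq_false_iff] at hy
        exact (hc _).out hy.1
    · refine ⟨fun y hy => ?_, fun y hy => ?_, fun hy => ?_⟩ <;>
        simp only [run, h, if_false]
      · simp only [modv, Bool.or_eq_false_iff] at hy
        exact (hd _).var y hy.2
      · simp only [moda, Bool.or_eq_false_iff] at hy
        exact (hd _).arr y hy.2
      · simp only [writes, Bool.or_eq_false_iff] at hy
        exact (hd _).out hy.2
  | loop x e c hc =>
    intro σ
    simp only [run]
    generalize e.eval σ = N
    induction N with
    | zero => exact ⟨fun _ _ => rfl, fun _ _ => rfl, fun _ => rfl⟩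
    | succ N ih =>
      refine ih.trans ?_
      refine ⟨fun y hy => ?_, fun y hy => ?_, fun hy => ?_⟩
      · simp only [modv, Bool.or_eq_false_iff, decide_eq_false_iff_not] at hy
        rw [iter, (hc _).var y hy.2]
        simp [hy.1]
      · simp only [moda] at hy
        rw [iter, (hc _).arr y hy]
        simp
      · simp only [writes] at hy
        rw [iter, (hc _).out hy]
        simp

/-- The invariant rule for loops: `I i` holds when `i` iterations are done, and no iteration takes
more than `B` steps. -/
theorem run_loop {x : Var} {e : Exp} {c : Cmd} {σ : St} (I : ℕ → St → Prop) (N B : ℕ)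
    (hN : e.eval σ = N) (h0 : I 0 (σ.tick (e.cost + 3)))
    (hs : ∀ i < N, ∀ τ, Frame (loop x e c) σ τ → I i τ →
      I (i + 1) (c.run ((τ.setv x i).tick 3)) ∧
      (c.run ((τ.setv x i).tick 3)).tm ≤ τ.tm + B) :
    I N ((loop x e c).run σ) ∧ ((loop x e c).run σ).tm ≤ σ.tm + (e.cost + 3) + N * B ∧
      Frame (loop x e c) σ ((loop x e c).run σ) := by
  subst hN
  refine ⟨?_, ?_, run_frame _ _⟩
  all_goals
    have key : ∀ i ≤ e.eval σ,
        I i (iter (fun i τ => c.run ((τ.setv x i).tick 3)) i (σ.tick (e.cost + 3))) ∧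
        (iter (fun i τ => c.run ((τ.setv x i).tick 3)) i (σ.tick (e.cost + 3))).tm
          ≤ σ.tm + (e.cost + 3) + i * B ∧
        Frame (loop x e c) σ
          (iter (fun i τ => c.run ((τ.setv x i).tick 3)) i (σ.tick (e.cost + 3))) := by
      intro i
      induction i with
      | zero => exact fun _ => ⟨h0, by simp [iter],
          ⟨fun _ _ => rfl, fun _ _ => rfl, fun _ => rfl⟩⟩
      | succ i ih =>
        intro hi
        obtain ⟨h1, h2, h3⟩ := ih (by omega)
        obtain ⟨h4, h5⟩ := hs i (by omega) _ h3 h1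
        refine ⟨h4, ?_, h3.trans ?_⟩
        · rw [iter, Nat.succ_mul]
          omega
        · refine ⟨fun y hy => ?_, fun y hy => ?_, fun hy => ?_⟩
          · simp only [modv, Bool.or_eq_false_iff, decide_eq_false_iff_not] at hy
            rw [iter, (run_frame c _).var y hy.2]
            simp [hy.1]
          · simp only [moda] at hy
            rw [iter, (run_frame c _).arr y hy]
            simp
          · simp only [writes] at hy
            rw [iter, (run_frame c _).out hy]
            simp
    have := key _ le_rfl
    simp only [run]
    tauto

section
variable (σ : St) (x : Var) (a : Arr) (i e f : Exp) (c d : Cmd)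
@[simp] theorem run_skip : run skip σ = σ.tick 1 := rfl
@[simp] theorem run_asg : run (asg x e) σ = (σ.setv x (e.eval σ)).tick (e.cost + 1) := rfl
@[simp] theorem run_put :
    run (put a i e) σ = (σ.seta a (i.eval σ) (e.eval σ)).tick (i.cost + e.cost + 9) := rfl
@[simp] theorem run_write : run (write e) σ = (σ.emit (e.eval σ)).tick (e.cost + 1) := rfl
@[simp] theorem run_block_nil : run (block []) σ = σ.tick 1 := rfl
@[simp] theorem run_block_cons (cs : List Cmd) :
    run (block (c :: cs)) σ = (block cs).run (c.run σ) := rfl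
@[simp] theorem run_seq : run (seq c d) σ = d.run (c.run σ) := rfl
theorem run_ifLt : run (ifLt e f c d) σ =
    if e.eval σ < f.eval σ then c.run (σ.tick (e.cost + f.cost + 1))
      else d.run (σ.tick (e.cost + f.cost + 1)) := rfl
end

end Cmd

/-! ### Compilation to the random access machine -/

namespace RAM

theorem exec_while_aux {x y : ℕ} {p : Prog} (N : ℕ) (I : ℕ → ℕ → State → Prop)
    (hr : ∀ i a γ, I i a γ → γ.reg x = i ∧ γ.reg y = N)
    (hs : ∀ i < N, ∀ a γ, I i a γ → ∃ γ' t, Exec p γ γ' t ∧ I (i + 1) (a + 1 + t) γ') :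
    ∀ r i a γ, i + r = N → I i a γ →
      ∃ γ' t, Exec (Prog.whileLt x y p) γ γ' (t + 1) ∧ I N (a + t) γ' := by
  intro r
  induction r with
  | zero =>
    intro i a γ hi h
    obtain rfl : i = N := by omega
    obtain ⟨h1, h2⟩ := hr _ _ _ h
    exact ⟨γ, 0, Exec.whileFalse (by omega), h⟩
  | succ r ih =>
    intro i a γ hi h
    obtain ⟨h1, h2⟩ := hr _ _ _ h
    obtain ⟨γ1, t1, e1, h3⟩ := hs i (by omega) _ _ h
    obtain ⟨γ2, t2, e2, h4⟩ := ih (i + 1) _ _ (by omega) h3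
    refine ⟨γ2, 1 + t1 + t2, ?_, ?_⟩
    · have := Exec.whileTrue (by omega) e1 e2
      rwa [← add_assoc] at this
    · convert h4 using 1
      omega

/-- The invariant rule for a `while` loop that counts up to `N`; `I i a γ` says that `γ` is reached
after `i` iterations and `a` steps. -/
theorem exec_while {x y : ℕ} {p : Prog} (N : ℕ) (I : ℕ → ℕ → State → Prop)
    (hr : ∀ i a γ, I i a γ → γ.reg x = i ∧ γ.reg y = N)
    (hs : ∀ i < N, ∀ a γ, I i a γ → ∃ γ' t, Exec p γ γ' t ∧ I (i + 1) (a + 1 + t) γ')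
    {γ : State} (h0 : I 0 0 γ) :
    ∃ γ' t, Exec (Prog.whileLt x y p) γ γ' (t + 1) ∧ I N t γ' := by
  simpa using exec_while_aux N I hr hs N 0 0 γ (by omega) h0

@[simp] theorem State.setReg_reg (γ : State) (x a y : ℕ) :
    (γ.setReg x a).reg y = if y = x then a else γ.reg y := by
  simp [State.setReg, Function.update_apply]
@[simp] theorem State.setReg_mem (γ : State) (x a : ℕ) : (γ.setReg x a).mem = γ.mem := rfl
@[simp] theorem State.setReg_out (γ : State) (x a : ℕ) : (γ.setReg x a).out = γ.out := rfl

end RAM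

open RAM in
/-- Multiply the temporary register `d` by 32, and add the base address and the offset `a`. -/
def addrProg (a d : ℕ) : RAM.Prog :=
  .seq (.add (65 + d) (65 + d) (65 + d)) <| .seq (.add (65 + d) (65 + d) (65 + d)) <|
  .seq (.add (65 + d) (65 + d) (65 + d)) <| .seq (.add (65 + d) (65 + d) (65 + d)) <|
  .seq (.add (65 + d) (65 + d) (65 + d)) <| .seq (.add (65 + d) (65 + d) 64) <|
  .seq (.const (65 + (d + 1)) a) (.add (65 + d) (65 + d) (65 + (d + 1)))

/-- Compilation of expressions. The variables are kept in the registers below 64, register 64 is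
the base address of the arrays, and the registers `65 + d`, `65 + d + 1`, … are free for use. The
value is left in register `65 + d`. -/
def Exp.comp : Exp → ℕ → RAM.Prog
  | lit a, d => .const (65 + d) a
  | var x, d => .copy (65 + d) x.ctorIdx
  | add e f, d => .seq (e.comp d) (.seq (f.comp (d + 1)) (.add (65 + d) (65 + d) (65 + (d + 1))))
  | sub e f, d => .seq (e.comp d) (.seq (f.comp (d + 1)) (.sub (65 + d) (65 + d) (65 + (d + 1))))
  | rd a e, d => .seq (e.comp d) (.seq (addrProg a.ctorIdx d) (.load (65 + d) (65 + d)))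

/-- Compilation of commands; the registers from `65 + d` on are free for use. -/
def Cmd.comp : Cmd → ℕ → RAM.Prog
  | skip, _ => .skip
  | asg x e, d => .seq (e.comp d) (.copy x.ctorIdx (65 + d))
  | put a i e, d => .seq (i.comp d) (.seq (addrProg a.ctorIdx d) (.seq (e.comp (d + 1))
      (.store (65 + d) (65 + (d + 1)))))
  | write e, d => .seq (e.comp d) (.write (65 + d))
  | seq c c', d => .seq (c.comp d) (c'.comp d)
  | ifLt e f c c', d => .seq (e.comp d) (.seq (f.comp (d + 1))
      (.ifLt (65 + d) (65 + (d + 1)) (c.comp d) (c'.comp d)))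
  | loop x e c, d => .seq (e.comp d) (.seq (.const (65 + (d + 1)) 0) (.seq (.const (65 + (d + 2)) 1)
      (.whileLt (65 + (d + 1)) (65 + d) (.seq (.copy x.ctorIdx (65 + (d + 1)))
        (.seq (c.comp (d + 3)) (.add (65 + (d + 1)) (65 + (d + 1)) (65 + (d + 2))))))))

/-- `γ` represents `σ`, with base address `β`: the cell `i` of the array number `a` is at the
address `β + 32 * i + a`. -/
structure Simulates (β : ℕ) (σ : St) (γ : RAM.State) : Prop where
  var : ∀ x : Var, γ.reg x.ctorIdx = σ.var x
  base : γ.reg 64 = β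
  arr : ∀ (a : Arr) (i : ℕ), γ.mem (β + 32 * i + a.ctorIdx) = σ.arr a i
  out : γ.out = σ.out

theorem Var.ctorIdx_lt (x : Var) : x.ctorIdx < 64 := by cases x <;> decide

theorem Arr.ctorIdx_lt (a : Arr) : a.ctorIdx < 32 := by cases a <;> decide

theorem Var.ctorIdx_inj {x z : Var} (h : x.ctorIdx = z.ctorIdx) : x = z := by
  rw [← Var.ofNat_ctorIdx x, h, Var.ofNat_ctorIdx]

theorem Arr.ctorIdx_inj {x z : Arr} (h : x.ctorIdx = z.ctorIdx) : x = z := by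
  rw [← Arr.ofNat_ctorIdx x, h, Arr.ofNat_ctorIdx]

theorem Simulates.congr {β : ℕ} {σ : St} {γ γ' : RAM.State} (h : Simulates β σ γ)
    (hr : ∀ r < 65, γ'.reg r = γ.reg r) (hm : γ'.mem = γ.mem) (ho : γ'.out = γ.out) :
    Simulates β σ γ' :=
  ⟨fun x => by rw [hr _ (by have := x.ctorIdx_lt; omega), h.var],
    by rw [hr _ (by omega), h.base], fun a i => by rw [hm, h.arr], by rw [ho, h.out]⟩

theorem Simulates.tick {β : ℕ} {σ : St} {γ : RAM.State} (h : Simulates β σ γ) (t : ℕ) :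
    Simulates β (σ.tick t) γ := ⟨h.var, h.base, h.arr, h.out⟩

open RAM

/-- The address of a cell is computed without multiplication, by five doublings. -/
theorem exec_addrProg (a d : ℕ) (γ : State) :
    ∃ γ', Exec (addrProg a d) γ γ' 8 ∧
      γ'.reg (65 + d) = γ.reg 64 + 32 * γ.reg (65 + d) + a ∧
      (∀ r < 65 + d, γ'.reg r = γ.reg r) ∧ γ'.mem = γ.mem ∧ γ'.out = γ.out := by
  refine ⟨_, Exec.seq (Exec.add ..) (Exec.seq (Exec.add ..) (Exec.seq (Exec.add ..)
    (Exec.seq (Exec.add ..) (Exec.seq (Exec.add ..) (Exec.seq (Exec.add ..)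
    (Exec.seq (Exec.const ..) (Exec.add ..))))))), ?_, ?_, ?_, ?_⟩
  · have : (64 : ℕ) ≠ 65 + d := by omega
    simp [this]
    ring
  · intro r hr
    have h1 : r ≠ 65 + d := by omega
    have h2 : r ≠ 65 + (d + 1) := by omega
    simp [h1, h2]
  · simp
  · simp

/-- The compiled expression leaves its value in register `65 + d` and keeps the lower registers. -/
theorem Exp.exec_comp {β : ℕ} {σ : St} (e : Exp) : ∀ (d : ℕ) (γ : State), Simulates β σ γ →
    ∃ γ', Exec (e.comp d) γ γ' e.cost ∧ γ'.reg (65 + d) = e.eval σ ∧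
      (∀ r < 65 + d, γ'.reg r = γ.reg r) ∧ γ'.mem = γ.mem ∧ γ'.out = γ.out := by
  induction e with
  | lit a =>
    intro d γ h
    refine ⟨_, Exec.const .., by simp, fun r hr => ?_, by simp, by simp⟩
    have : r ≠ 65 + d := by omega
    simp [this]
  | var x =>
    intro d γ h
    refine ⟨_, Exec.copy .., by simp [h.var], fun r hr => ?_, by simp, by simp⟩
    have : r ≠ 65 + d := by omega
    simp [this]
  | add e f he hf =>
    intro d γ h
    obtain ⟨γ1, x1, v1, r1, m1, o1⟩ := he d γ h
    obtain ⟨γ2, x2, v2, r2, m2, o2⟩ := hf (d + 1) γ1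
      (h.congr (fun r hr => r1 r (by omega)) m1 o1)
    have x3 := Exec.seq x1 (Exec.seq x2 (Exec.add γ2 (65 + d) (65 + d) (65 + (d + 1))))
    rw [← add_assoc e.cost] at x3
    refine ⟨_, x3, ?_, fun r hr => ?_, ?_, ?_⟩
    · simp [v2, r2 _ (show 65 + d < 65 + (d + 1) by omega), v1]
    · have : r ≠ 65 + d := by omega
      simp [this, r2 r (by omega), r1 r hr]
    · simp [m1, m2]
    · simp [o1, o2]
  | sub e f he hf =>
    intro d γ h
    obtain ⟨γ1, x1, v1, r1, m1, o1⟩ := he d γ h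
    obtain ⟨γ2, x2, v2, r2, m2, o2⟩ := hf (d + 1) γ1
      (h.congr (fun r hr => r1 r (by omega)) m1 o1)
    have x3 := Exec.seq x1 (Exec.seq x2 (Exec.sub γ2 (65 + d) (65 + d) (65 + (d + 1))))
    rw [← add_assoc e.cost] at x3
    refine ⟨_, x3, ?_, fun r hr => ?_, ?_, ?_⟩
    · simp [v2, r2 _ (show 65 + d < 65 + (d + 1) by omega), v1]
    · have : r ≠ 65 + d := by omega
      simp [this, r2 r (by omega), r1 r hr]
    · simp [m1, m2]
    · simp [o1, o2]
  | rd a e he =>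
    intro d γ h
    obtain ⟨γ1, x1, v1, r1, m1, o1⟩ := he d γ h
    obtain ⟨γ2, x2, v2, r2, m2, o2⟩ := exec_addrProg a.ctorIdx d γ1
    refine ⟨_, Exec.seq x1 (Exec.seq x2 (Exec.load ..)), ?_, fun r hr => ?_, ?_, ?_⟩
    · simp [v2, m2, m1, r1 64 (by omega), h.base, v1, h.arr]
    · have : r ≠ 65 + d := by omega
      simp [this, r2 r (by omega), r1 r hr]
    · simp [m1, m2]
    · simp [o1, o2]

/-- The compiled program simulates the command, in as many steps as `tm` says. -/
theorem Cmd.exec_comp {β : ℕ} (c : Cmd) : ∀ (d : ℕ) (σ : St) (γ : State), Simulates β σ γ →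
    ∃ γ' t, Exec (c.comp d) γ γ' t ∧ Simulates β (c.run σ) γ' ∧ (c.run σ).tm = σ.tm + t ∧
      (∀ r, 65 ≤ r → r < 65 + d → γ'.reg r = γ.reg r) := by
  induction c with
  | skip =>
    intro d σ γ h
    exact ⟨γ, 1, Exec.skip _, h.tick 1, rfl, fun _ _ _ => rfl⟩
  | asg x e =>
    intro d σ γ h
    obtain ⟨γ1, x1, v1, r1, m1, o1⟩ := e.exec_comp d γ h
    refine ⟨_, _, Exec.seq x1 (Exec.copy ..), ?_, rfl, fun r h1 h2 => ?_⟩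
    · have h' := h.congr (fun r hr => r1 r (by omega)) m1 o1
      refine Simulates.tick ⟨fun z => ?_, ?_, fun a i => ?_, ?_⟩ _
      · by_cases hz : z = x
        · simp [hz, v1]
        · have : z.ctorIdx ≠ x.ctorIdx := fun h => hz (Var.ctorIdx_inj h)
          simp [hz, this, h'.var]
      · have : 64 ≠ x.ctorIdx := by have := x.ctorIdx_lt; omega
        simp [this, h'.base]
      · simp [h'.arr]
      · simp [h'.out]
    · have : r ≠ x.ctorIdx := by have := x.ctorIdx_lt; omega
      simp [this, r1 r h2]
  | put a i e =>
    intro d σ γ h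
    obtain ⟨γ1, x1, v1, r1, m1, o1⟩ := i.exec_comp d γ h
    obtain ⟨γ2, x2, v2, r2, m2, o2⟩ := exec_addrProg a.ctorIdx d γ1
    have h2 : Simulates β σ γ2 := (h.congr (fun r hr => r1 r (by omega)) m1 o1).congr
      (fun r hr => r2 r (by omega)) m2 o2
    obtain ⟨γ3, x3, v3, r3, m3, o3⟩ := e.exec_comp (d + 1) γ2 h2
    have h3 := h2.congr (fun r hr => r3 r (by omega)) m3 o3
    refine ⟨_, _, Exec.seq x1 (Exec.seq x2 (Exec.seq x3 (Exec.store ..))), ?_, ?_,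
      fun r h1 h2 => ?_⟩
    · apply Simulates.tick (σ := σ.seta a (i.eval σ) (e.eval σ))
      refine ⟨h3.var, h3.base, fun b j => ?_, h3.out⟩
      have e1 : γ3.reg (65 + d) = β + 32 * i.eval σ + a.ctorIdx := by
        rw [r3 _ (by omega), v2, r1 64 (by omega), h.base, v1]
      have ha := a.ctorIdx_lt
      have hb := b.ctorIdx_lt
      simp only [e1, v3, Function.update_apply, St.seta_arr, h3.arr]
      by_cases hab : b = a ∧ j = i.eval σ
      · simp [hab]
      · rw [if_neg hab, if_neg]
        intro he
        apply hab
        exact ⟨Arr.ctorIdx_inj (by omega), by omega⟩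
    · simp [run]
      ring
    · change γ3.reg r = _
      rw [r3 r (by omega), r2 r h2, r1 r h2]
  | write e =>
    intro d σ γ h
    obtain ⟨γ1, x1, v1, r1, m1, o1⟩ := e.exec_comp d γ h
    have h' := h.congr (fun r hr => r1 r (by omega)) m1 o1
    refine ⟨_, _, Exec.seq x1 (Exec.write ..), ?_, rfl, fun r h1 h2 => r1 r h2⟩
    apply Simulates.tick (σ := σ.emit (e.eval σ))
    exact ⟨h'.var, h'.base, h'.arr, by simp [h'.out, v1]⟩
  | seq c c' hc hc' =>
    intro d σ γ h
    obtain ⟨γ1, t1, x1, h1, e1, r1⟩ := hc d σ γ h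
    obtain ⟨γ2, t2, x2, h2, e2, r2⟩ := hc' d _ γ1 h1
    refine ⟨γ2, _, Exec.seq x1 x2, h2, ?_, fun r h1 h2 => (r2 r h1 h2).trans (r1 r h1 h2)⟩
    rw [run, e2, e1, add_assoc]
  | ifLt e f c c' hc hc' =>
    intro d σ γ h
    obtain ⟨γ1, x1, v1, r1, m1, o1⟩ := e.exec_comp d γ h
    obtain ⟨γ2, x2, v2, r2, m2, o2⟩ := f.exec_comp (d + 1) γ1
      (h.congr (fun r hr => r1 r (by omega)) m1 o1)
    have h2 : Simulates β σ γ2 := (h.congr (fun r hr => r1 r (by omega)) m1 o1).congr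
      (fun r hr => r2 r (by omega)) m2 o2
    have e1 : γ2.reg (65 + d) = e.eval σ := by rw [r2 _ (by omega), v1]
    by_cases hlt : e.eval σ < f.eval σ
    · obtain ⟨γ3, t3, x3, h3, e3, r3⟩ := hc d _ γ2 (h2.tick (e.cost + f.cost + 1))
      refine ⟨γ3, _, Exec.seq x1 (Exec.seq x2 (Exec.ifTrue (by rwa [e1, v2]) x3)), ?_, ?_, ?_⟩
      · rw [run_ifLt, if_pos hlt]; exact h3
      · rw [run_ifLt, if_pos hlt, e3]; simp; ring
      · intro r ha hb
        rw [r3 r ha hb, r2 r (by omega), r1 r hb]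
    · obtain ⟨γ3, t3, x3, h3, e3, r3⟩ := hc' d _ γ2 (h2.tick (e.cost + f.cost + 1))
      refine ⟨γ3, _, Exec.seq x1 (Exec.seq x2 (Exec.ifFalse (by rwa [e1, v2]) x3)), ?_, ?_, ?_⟩
      · rw [run_ifLt, if_neg hlt]; exact h3
      · rw [run_ifLt, if_neg hlt, e3]; simp; ring
      · intro r ha hb
        rw [r3 r ha hb, r2 r (by omega), r1 r hb]
  | loop x e c hc =>
    intro d σ γ h
    obtain ⟨γ1, x1, v1, r1, m1, o1⟩ := e.exec_comp d γ h
    have hx := x.ctorIdx_lt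
    let step := fun (i : ℕ) (τ : St) => c.run ((τ.setv x i).tick 3)
    let σ0 := σ.tick (e.cost + 3)
    let γ2 := (γ1.setReg (65 + (d + 1)) 0).setReg (65 + (d + 2)) 1
    obtain ⟨γ3, t3, x3, g1, g2, g3, g4, g5, g6⟩ := exec_while (x := 65 + (d + 1)) (y := 65 + d)
      (p := .seq (.copy x.ctorIdx (65 + (d + 1)))
        (.seq (c.comp (d + 3)) (.add (65 + (d + 1)) (65 + (d + 1)) (65 + (d + 2)))))
      (γ := γ2) (e.eval σ)
      (fun i a γ' => γ'.reg (65 + (d + 1)) = i ∧ γ'.reg (65 + d) = e.eval σ ∧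
        γ'.reg (65 + (d + 2)) = 1 ∧ Simulates β (iter step i σ0) γ' ∧
        (iter step i σ0).tm = σ0.tm + a ∧ (∀ r, 65 ≤ r → r < 65 + d → γ'.reg r = γ.reg r))
      (fun i a γ' hI => ⟨hI.1, hI.2.1⟩)
      (by
        rintro i hi a γ' ⟨i1, i2, i3, i4, i5, i6⟩
        have hrep : Simulates β (((iter step i σ0).setv x i).tick 3) (γ'.setReg x.ctorIdx i) := by
          refine Simulates.tick ⟨fun z => ?_, ?_, fun b j => ?_, ?_⟩ _
          · by_cases hz : z = x
            · simp [hz]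
            · have : z.ctorIdx ≠ x.ctorIdx := fun h => hz (Var.ctorIdx_inj h)
              simp [hz, this, i4.var]
          · have : 64 ≠ x.ctorIdx := by omega
            simp [this, i4.base]
          · simp [i4.arr]
          · simp [i4.out]
        obtain ⟨γ4, t4, x4, h4, e4, r4⟩ := hc (d + 3) _ _ hrep
        refine ⟨_, _, Exec.seq (Exec.copy ..) (Exec.seq (by rw [i1]; exact x4) (Exec.add ..)),
          ?_, ?_, ?_, ?_, ?_, ?_⟩
        · rw [State.setReg_reg, if_pos rfl, r4 _ (by omega) (by omega),
            r4 _ (by omega) (by omega), State.setReg_reg, if_neg (by omega), State.setReg_reg,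
            if_neg (by omega), i1, i3]
        · rw [State.setReg_reg, if_neg (by omega), r4 _ (by omega) (by omega), State.setReg_reg,
            if_neg (by omega), i2]
        · rw [State.setReg_reg, if_neg (by omega), r4 _ (by omega) (by omega), State.setReg_reg,
            if_neg (by omega), i3]
        · refine h4.congr (fun r hr => ?_) rfl rfl
          rw [State.setReg_reg, if_neg (by omega)]
        · rw [iter]
          change (c.run _).tm = _
          rw [e4, St.tick_tm, St.setv_tm, i5]
          omega
        · intro r h1 h2
          rw [State.setReg_reg, if_neg (by omega), r4 _ (by omega) (by omega), State.setReg_reg,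
            if_neg (by omega), i6 r h1 h2])
      (by
        have hr : ∀ r < 65 + (d + 1), γ2.reg r = γ1.reg r := by
          intro r hr
          rw [State.setReg_reg, if_neg (by omega), State.setReg_reg, if_neg (by omega)]
        refine ⟨?_, ?_, ?_, ?_, rfl, ?_⟩
        · simp [γ2]
        · rw [hr _ (by omega), v1]
        · simp [γ2]
        · exact ((h.congr (fun r hr => r1 r (by omega)) m1 o1).congr
            (fun r h => hr r (by omega)) rfl rfl).tick _
        · intro r h1 h2
          rw [hr _ (by omega), r1 _ h2])
    refine ⟨γ3, _, Exec.seq x1 (Exec.seq (Exec.const ..) (Exec.seq (Exec.const ..) x3)), g4, ?_,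
      g6⟩
    change (iter step (e.eval σ) σ0).tm = _
    rw [g5]
    change σ.tm + (e.cost + 3) + t3 = _
    omega

/-! ### Loading the input -/

/-- Compute the length `3 + q * (1 + n * n)` of the input, make it the base address of the arrays,
and copy the input into the array `I`. -/
def copyInput : Prog :=
  .seq (.const 65 0) <| .seq (.load 66 65) <| .seq (.const 67 2) <| .seq (.load 68 67) <|
  .seq (.const 69 1) <| .seq (.const 70 1) <| .seq (.const 71 0) <|
  .seq (.whileLt 71 66 (.seq (.add 70 70 66) (.add 71 71 69))) <|
  .seq (.const 64 3) <| .seq (.const 71 0) <|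
  .seq (.whileLt 71 68 (.seq (.add 64 64 70) (.add 71 71 69))) <|
  .seq (.const 71 0) <| .seq (.copy 73 64) <| .seq (.const 72 32) <|
  .whileLt 71 64 (.seq (.load 74 71) (.seq (.store 73 74) (.seq (.add 73 73 72) (.add 71 71 69))))

/-- The state with the given content of the array `I` and zeros everywhere else. -/
def St.start (input : List ℕ) : St where
  var := fun _ => 0
  arr := fun a i => if a = Arr.I then input.getD i 0 else 0
  out := []
  tm := 0

/-- After `copyInput` the machine represents the initial state of the loop language. The arrays lie
behind the input, so copying does not overwrite it. -/
theorem exec_copyInput (input : List ℕ) (n q : ℕ) (hn : input.getD 0 0 = n)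
    (hq : input.getD 2 0 = q) (hlen : input.length = 3 + q * (1 + n * n)) :
    ∃ γ t, Exec copyInput (init input) γ t ∧ Simulates input.length (St.start input) γ ∧
      t ≤ 16 + 3 * n + 3 * q + 5 * input.length := by
  let γ0 : State := (((((((init input).setReg 65 0).setReg 66 n).setReg 67 2).setReg 68 q).setReg
    69 1).setReg 70 1).setReg 71 0
  obtain ⟨γ1, t1, x1, a1, a2, a3, a4, a5, a6, a7, a8, a9⟩ := exec_while (x := 71) (y := 66)
    (p := .seq (.add 70 70 66) (.add 71 71 69)) (γ := γ0) n
    (fun i a γ => γ.reg 71 = i ∧ γ.reg 66 = n ∧ γ.reg 68 = q ∧ γ.reg 69 = 1 ∧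
      γ.reg 70 = 1 + i * n ∧ (∀ r < 65, γ.reg r = 0) ∧ γ.mem = (init input).mem ∧ γ.out = [] ∧
      a = 3 * i)
    (fun i a γ h => ⟨h.1, h.2.1⟩)
    (by
      rintro i hi a γ ⟨h1, h2, h3, h4, h5, h6, h7, h8, h9⟩
      refine ⟨_, _, Exec.seq (Exec.add ..) (Exec.add ..), ?_, ?_, ?_, ?_, ?_, ?_, ?_, ?_, ?_⟩
      · simp [h1, h4]
      · simp [h2]
      · simp [h3]
      · simp [h4]
      · simp [h5, h2]; ring
      · intro r hr
        have e1 : r ≠ 70 := by omega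
        have e2 : r ≠ 71 := by omega
        simp [e1, e2, h6 r hr]
      · simp [h7]
      · simp [h8]
      · omega)
    ⟨by simp [γ0], by simp [γ0], by simp [γ0], by simp [γ0], by simp [γ0],
      fun r hr => by
        have e1 : r ≠ 65 := by omega
        have e2 : r ≠ 66 := by omega
        have e3 : r ≠ 67 := by omega
        have e4 : r ≠ 68 := by omega
        have e5 : r ≠ 69 := by omega
        have e6 : r ≠ 70 := by omega
        have e7 : r ≠ 71 := by omega
        simp [γ0, init, e1, e2, e3, e4, e5, e6, e7],
      by simp [γ0], by simp [γ0, init], rfl⟩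
  let γ2 : State := (γ1.setReg 64 3).setReg 71 0
  obtain ⟨γ3, t3, x3, c1, c2, c3, c4, c5, c6, c7, c8, c9⟩ := exec_while (x := 71) (y := 68)
    (p := .seq (.add 64 64 70) (.add 71 71 69)) (γ := γ2) q
    (fun i a γ => γ.reg 71 = i ∧ γ.reg 68 = q ∧ γ.reg 69 = 1 ∧ γ.reg 70 = 1 + n * n ∧
      γ.reg 64 = 3 + i * (1 + n * n) ∧
      (∀ r < 64, γ.reg r = 0) ∧ γ.mem = (init input).mem ∧ γ.out = [] ∧ a = 3 * i)
    (fun i a γ h => ⟨h.1, h.2.1⟩)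
    (by
      rintro i hi a γ ⟨h1, h2, h3, h4, h5, h6, h7, h8, h9⟩
      refine ⟨_, _, Exec.seq (Exec.add ..) (Exec.add ..), ?_, ?_, ?_, ?_, ?_, ?_, ?_, ?_, ?_⟩
      · simp [h1, h3]
      · simp [h2]
      · simp [h3]
      · simp [h4]
      · simp [h5, h4]; ring
      · intro r hr
        have e1 : r ≠ 64 := by omega
        have e2 : r ≠ 71 := by omega
        simp [e1, e2, h6 r hr]
      · simp [h7]
      · simp [h8]
      · omega)
    ⟨by simp [γ2], by simp [γ2, a3], by simp [γ2, a4], by simp [γ2, a5], by simp [γ2],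
      fun r hr => by
        have e1 : r ≠ 64 := by omega
        have e7 : r ≠ 71 := by omega
        simp [γ2, e1, e7, a6 r (by omega)],
      by simp [γ2, a7], by simp [γ2, a8], rfl⟩
  set β := input.length with hβ
  let γ4 : State := ((γ3.setReg 71 0).setReg 73 β).setReg 72 32
  obtain ⟨γ5, t5, x5, d1, d2, d3, d4, d5, d6, d7, d8, d9, d10⟩ := exec_while (x := 71) (y := 64)
    (p := .seq (.load 74 71) (.seq (.store 73 74) (.seq (.add 73 73 72) (.add 71 71 69))))
    (γ := γ4) β
    (fun i a γ => γ.reg 71 = i ∧ γ.reg 64 = β ∧ γ.reg 69 = 1 ∧ γ.reg 72 = 32 ∧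
      γ.reg 73 = β + 32 * i ∧ (∀ r < 64, γ.reg r = 0) ∧
      (∀ j < β, γ.mem j = input.getD j 0) ∧
      (∀ j z, z < 32 → γ.mem (β + 32 * j + z) = if j < i ∧ z = 0 then input.getD j 0 else 0) ∧
      γ.out = [] ∧ a = 5 * i)
    (fun i a γ h => ⟨h.1, h.2.1⟩)
    (by
      rintro i hi a γ ⟨h1, h2, h3, h4, h5, h6, h7, h8, h9, h10⟩
      refine ⟨_, _, Exec.seq (Exec.load ..) (Exec.seq (Exec.store ..) (Exec.seq (Exec.add ..)
        (Exec.add ..))), ?_, ?_, ?_, ?_, ?_, ?_, ?_, ?_, ?_, ?_⟩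
      · simp [h1, h3]
      · simp [h2]
      · simp [h3]
      · simp [h4]
      · simp [h5, h4]; ring
      · intro r hr
        have e1 : r ≠ 71 := by omega
        have e2 : r ≠ 73 := by omega
        have e3 : r ≠ 74 := by omega
        simp [e1, e2, e3, h6 r hr]
      · intro j hj
        have : j ≠ β + 32 * i := by omega
        simp [h5, this, h7 j hj]
      · intro j z hz
        simp only [State.setReg_reg, State.setReg_mem, Function.update_apply, h5, h8 j z hz]
        by_cases hji : j = i ∧ z = 0
        · obtain ⟨rfl, rfl⟩ := hji
          simp [h1, h7 j hi]
        · have : β + 32 * j + z ≠ β + 32 * i := by omega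
          have e : (j < i + 1 ∧ z = 0) ↔ (j < i ∧ z = 0) := by omega
          rw [if_congr e rfl rfl]
          simp [this]
      · simp [h9]
      · omega)
    ⟨by simp [γ4], by simp [γ4, c5, hlen], by simp [γ4, c3], by simp [γ4], by simp [γ4],
      fun r hr => by
        have e1 : r ≠ 71 := by omega
        have e2 : r ≠ 72 := by omega
        have e3 : r ≠ 73 := by omega
        simp [γ4, e1, e2, e3, c6 r hr],
      fun j hj => by simp [γ4, c7, init],
      fun j z hz => by
        have : input.length ≤ β + 32 * j + z := by omega
        simp [γ4, c7, init, List.getElem?_eq_none this], by simp [γ4, c8], rfl⟩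
  have x1' : Exec (Prog.whileLt 71 66 (.seq (.add 70 70 66) (.add 71 71 69)))
    (((((((init input).setReg 65 0).setReg 66 (input.getD 0 0)).setReg 67 2).setReg 68
      (input.getD 2 0)).setReg 69 1).setReg 70 1 |>.setReg 71 0) γ1 (t1 + 1) := by
    rw [hn, hq]; exact x1
  have x5' : Exec (.whileLt 71 64 (.seq (.load 74 71) (.seq (.store 73 74)
      (.seq (.add 73 73 72) (.add 71 71 69))))) (((γ3.setReg 71 0).setReg 73
        ((γ3.setReg 71 0).reg 64)).setReg 72 32) γ5 (t5 + 1) := by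
    have : (γ3.setReg 71 0).reg 64 = β := by simp [c5, hlen]
    rw [this]; exact x5
  refine ⟨γ5, _, Exec.seq (Exec.const ..) (Exec.seq (Exec.load ..) (Exec.seq (Exec.const ..)
    (Exec.seq (Exec.load ..) (Exec.seq (Exec.const ..) (Exec.seq (Exec.const ..)
    (Exec.seq (Exec.const ..) (Exec.seq x1' (Exec.seq (Exec.const ..) (Exec.seq (Exec.const ..)
    (Exec.seq x3 (Exec.seq (Exec.const ..) (Exec.seq (Exec.copy ..) (Exec.seq (Exec.const ..)
    x5'))))))))))))), ?_, ?_⟩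
  · refine ⟨fun x => ?_, d2, fun a j => ?_, ?_⟩
    · exact d6 _ x.ctorIdx_lt
    · rw [d8 _ _ a.ctorIdx_lt]
      by_cases ha : a = Arr.I
      · subst ha
        by_cases hj : j < β
        · simp [St.start, hj, Arr.ctorIdx]
        · have : input.length ≤ j := by omega
          simp [St.start, hj, List.getElem?_eq_none this]
      · have : a.ctorIdx ≠ 0 := fun h => ha (Arr.ctorIdx_inj h)
        simp [St.start, ha, this]
    · simp [St.start, d9]
  · omega

/-! ### Journeys and their first-visit trees -/

namespace TVG

variable {V : Type}

/-- The vertex at which a journey from the given vertex ends. -/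
def dest : V → List (V × ℕ) → V
  | u, [] => u
  | _, (v, _) :: J => dest v J

/-- The vertices that a journey from `s` visits. -/
def visited (s : V) (J : List (V × ℕ)) : Set V := {v | v = s ∨ ∃ τ : ℕ, (v, τ) ∈ J}

theorem isJourney_concat {𝒢 : TVG V} {u v : V} {t τ : ℕ} {J : List (V × ℕ)} :
    𝒢.IsJourney u t (J ++ [(v, τ)]) ↔
      𝒢.IsJourney u t J ∧ arrival t J ≤ τ ∧ (𝒢.snap τ).Adj (dest u J) v := by
  induction J generalizing u t with
  | nil => simp [IsJourney, arrival, dest]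
  | cons x J ih =>
    obtain ⟨w, r⟩ := x
    simp only [List.cons_append, IsJourney, arrival, dest, ih]
    tauto

theorem arrival_concat {v : V} {t τ : ℕ} {J : List (V × ℕ)} :
    arrival t (J ++ [(v, τ)]) = τ + 1 := by
  induction J generalizing t with
  | nil => rfl
  | cons x J ih => obtain ⟨w, r⟩ := x; simp [arrival, ih]

theorem dest_concat {u v : V} {τ : ℕ} {J : List (V × ℕ)} : dest u (J ++ [(v, τ)]) = v := by
  induction J generalizing u with
  | nil => rfl
  | cons x J ih => obtain ⟨w, r⟩ := x; simp [dest, ih]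

theorem visited_nil {s : V} : visited s [] = {s} := by
  ext; simp [visited]

theorem visited_concat {s v : V} {τ : ℕ} {J : List (V × ℕ)} :
    visited s (J ++ [(v, τ)]) = insert v (visited s J) := by
  ext x
  simp only [visited, List.mem_append, List.mem_singleton, Prod.mk.injEq, Set.mem_ofPred_eq,
    Set.mem_insert_iff]
  constructor
  · rintro (h | ⟨t, h | h⟩)
    · exact Or.inr (Or.inl h)
    · exact Or.inr (Or.inr ⟨t, h⟩)
    · exact Or.inl h.1
  · rintro (h | h | ⟨t, h⟩)
    · exact Or.inr ⟨τ, Or.inr ⟨h, rfl⟩⟩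
    · exact Or.inl h
    · exact Or.inr ⟨t, Or.inl h⟩

theorem start_mem_visited (s : V) (J : List (V × ℕ)) : s ∈ visited s J := Or.inl rfl

theorem dest_mem_visited (s : V) (J : List (V × ℕ)) : dest s J ∈ visited s J := by
  induction J using List.reverseRecOn with
  | nil => simp [visited_nil, dest]
  | append_singleton J x ih =>
    obtain ⟨v, τ⟩ := x
    rw [dest_concat, visited_concat]
    exact Set.mem_insert _ _

/-- Whenever the journey enters a vertex for the first time, it comes from the vertex that `par`
assigns to it. -/
def FirstVisits (par : V → V) (s : V) (J : List (V × ℕ)) : Prop :=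
  ∀ J' v τ, J' ++ [(v, τ)] <+: J → v ∈ visited s J' ∨ par v = dest s J'

/-- The first-visit tree of a journey, as a parent function and a rank that increases from the
parent to the child. -/
theorem exists_firstVisits [DecidableEq V] {𝒢 : TVG V} {s : V} {D : ℕ} {H : SimpleGraph V}
    (hH : ∀ τ < D, 𝒢.snap τ ≤ H) (J : List (V × ℕ)) (hJ : 𝒢.IsJourney s 0 J)
    (hD : arrival 0 J ≤ D) :
    ∃ (par : V → V) (rank : V → ℕ), FirstVisits par s J ∧
      ∀ v ∈ visited s J, rank v ≤ J.length ∧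
        (v ≠ s → par v ∈ visited s J ∧ H.Adj (par v) v ∧ rank (par v) < rank v) := by
  induction J using List.reverseRecOn with
  | nil =>
    refine ⟨id, fun _ => 0, fun J' v τ h => by simp at h, fun v hv => ⟨by simp, fun h => ?_⟩⟩
    rw [visited_nil] at hv
    exact absurd hv h
  | append_singleton J x ih =>
    obtain ⟨w, r⟩ := x
    rw [isJourney_concat] at hJ
    rw [arrival_concat] at hD
    obtain ⟨h1, h2, h3⟩ := hJ
    obtain ⟨par, rank, hf, hp⟩ := ih h1 (by omega)
    by_cases hw : w ∈ visited s J
    · refine ⟨par, rank, fun J' v τ h => ?_, fun v hv => ?_⟩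
      · rcases List.prefix_concat_iff.1 h with h | h
        · have := List.append_inj' h rfl
          simp only [List.cons.injEq, Prod.mk.injEq, and_true] at this
          rw [this.1, this.2.1]
          exact Or.inl hw
        · exact hf _ _ _ h
      · rw [visited_concat, Set.insert_eq_of_mem hw] at *
        obtain ⟨h4, h5⟩ := hp v hv
        exact ⟨by simp; omega, h5⟩
    · refine ⟨Function.update par w (dest s J), Function.update rank w (J.length + 1),
        fun J' v τ h => ?_, fun v hv => ?_⟩
      · rcases List.prefix_concat_iff.1 h with h | h
        · have := List.append_inj' h rfl
          simp only [List.cons.injEq, Prod.mk.injEq, and_true] at this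
          rw [this.1, this.2.1]
          exact Or.inr (by simp)
        · have hv : v ∈ visited s J := by
            obtain ⟨K, rfl⟩ := h
            exact Or.inr ⟨τ, by simp⟩
          have : v ≠ w := fun h => hw (h ▸ hv)
          simpa [this] using hf _ _ _ h
      · rw [visited_concat] at hv ⊢
        have hd := dest_mem_visited s J
        have hdw : dest s J ≠ w := fun h => hw (h ▸ hd)
        by_cases hvw : v = w
        · subst hvw
          refine ⟨by simp, fun _ => ⟨?_, ?_, ?_⟩⟩
          · simp [hd]
          · simpa using hH _ (by omega) h3
          · have := (hp _ hd).1
            simp [hdw]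
            omega
        · have hv' : v ∈ visited s J := by simpa [hvw] using hv
          obtain ⟨h4, h5⟩ := hp v hv'
          refine ⟨by simp [hvw]; omega, fun hvs => ?_⟩
          obtain ⟨h6, h7, h8⟩ := h5 hvs
          have : par v ≠ w := fun h => hw (h ▸ h6)
          simp [hvw, this, h6, h7, h8]

end TVG

/-! ### Counting edges and vertices of low degree -/

section
open Classical

variable {n : ℕ}

/-- The edges of a graph, each as the pair of its larger and its smaller end. -/
noncomputable def edgePairs (G : SimpleGraph (Fin n)) : Finset (Fin n × Fin n) :=
  Finset.univ.filter fun p => p.2 < p.1 ∧ G.Adj p.1 p.2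

theorem mem_edgePairs {G : SimpleGraph (Fin n)} {p : Fin n × Fin n} :
    p ∈ edgePairs G ↔ p.2 < p.1 ∧ G.Adj p.1 p.2 := by simp [edgePairs]

theorem card_edgePairs (G : SimpleGraph (Fin n)) : (edgePairs G).card = G.edgeSet.ncard := by
  rw [← Set.ncard_coe_finset]
  refine Set.ncard_congr (fun p _ => s(p.1, p.2)) ?_ ?_ ?_
  · rintro ⟨u, v⟩ h
    exact (mem_edgePairs.1 h).2
  · rintro ⟨u, v⟩ ⟨u', v'⟩ h h' he
    have h1 := (mem_edgePairs.1 h).1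
    have h2 := (mem_edgePairs.1 h').1
    simp only [Sym2.eq_iff] at he
    rcases he with ⟨rfl, rfl⟩ | ⟨rfl, rfl⟩
    · rfl
    · exact absurd h1 (not_lt.2 h2.le)
  · intro e
    induction e with
    | h u v =>
      intro h
      rcases lt_or_gt_of_ne (G.ne_of_adj h) with hlt | hlt
      · exact ⟨(v, u), mem_edgePairs.2 ⟨hlt, h.symm⟩, Sym2.eq_swap⟩
      · exact ⟨(u, v), mem_edgePairs.2 ⟨hlt, h⟩, rfl⟩

/-- The vertices of degree at most one. -/
noncomputable def lowVerts (G : SimpleGraph (Fin n)) : Finset (Fin n) :=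
  Finset.univ.filter fun v => (Finset.univ.filter fun w => G.Adj v w).card < 2

/-- The only connected graph with a vertex of degree zero has a single vertex, which accounts for the
additional `1`. -/
theorem card_lowVerts_le_numLeaves {G : SimpleGraph (Fin n)} (hG : G.Connected) :
    (lowVerts G).card ≤ numLeaves G + 1 := by
  by_cases hn : Nontrivial (Fin n)
  · refine le_trans ?_ (Nat.le_succ _)
    rw [numLeaves, ← Set.ncard_coe_finset]
    refine Set.ncard_le_ncard (fun v hv => ?_) (Set.toFinite _)
    have h1 : (Finset.univ.filter fun w => G.Adj v w).card < 2 := by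
      simpa [lowVerts] using hv
    have h2 : (G.neighborSet v).ncard = (Finset.univ.filter fun w => G.Adj v w).card := by
      rw [← Set.ncard_coe_finset]
      congr 1
      ext; simp
    have h3 : 0 < G.degree v := hG.preconnected.degree_pos_of_nontrivial v
    have h4 : 0 < (Finset.univ.filter fun w => G.Adj v w).card := by
      rw [G.degree_pos_iff_exists_adj] at h3
      obtain ⟨w, hw⟩ := h3
      exact Finset.card_pos.2 ⟨w, by simpa using hw⟩
    change _ = _
    omega
  · have : Subsingleton (Fin n) := not_nontrivial_iff_subsingleton.1 hn
    have := Finset.card_le_one_of_subsingleton (lowVerts G)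
    omega

/-- Deleting an edge lowers the degrees of its two ends only. -/
theorem card_lowVerts_le {G H : SimpleGraph (Fin n)} (h : H ≤ G) :
    (lowVerts H).card + 2 * (edgePairs H).card ≤ (lowVerts G).card + 2 * (edgePairs G).card := by
  have hsub : edgePairs H ⊆ edgePairs G := fun p hp =>
    mem_edgePairs.2 ⟨(mem_edgePairs.1 hp).1, h (mem_edgePairs.1 hp).2⟩
  set F := edgePairs G \ edgePairs H with hF
  have hc : F.card + (edgePairs H).card = (edgePairs G).card :=
    Finset.card_sdiff_add_card_eq_card hsub
  have hl : lowVerts H ⊆ lowVerts G ∪ (F.image Prod.fst ∪ F.image Prod.snd) := by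
    intro v hv
    by_contra hcon
    simp only [Finset.mem_union, not_or, Finset.mem_image, not_exists, not_and] at hcon
    obtain ⟨h1, h2, h3⟩ := hcon
    apply h1
    simp only [lowVerts, Finset.mem_filter, Finset.mem_univ, true_and] at hv ⊢
    refine lt_of_le_of_lt (Finset.card_le_card fun w hw => ?_) hv
    simp only [Finset.mem_filter, Finset.mem_univ, true_and] at hw ⊢
    by_contra hno
    rcases lt_or_gt_of_ne (G.ne_of_adj hw) with hlt | hlt
    · exact h3 (w, v) (Finset.mem_sdiff.2 ⟨mem_edgePairs.2 ⟨hlt, hw.symm⟩,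
        fun hh => hno (mem_edgePairs.1 hh).2.symm⟩) rfl
    · exact h2 (v, w) (Finset.mem_sdiff.2 ⟨mem_edgePairs.2 ⟨hlt, hw⟩,
        fun hh => hno (mem_edgePairs.1 hh).2⟩) rfl
  have h1 := Finset.card_le_card hl
  have h2 := Finset.card_union_le (lowVerts G) (F.image Prod.fst ∪ F.image Prod.snd)
  have h3 := Finset.card_union_le (F.image Prod.fst) (F.image Prod.snd)
  have h4 := Finset.card_image_le (s := F) (f := Prod.fst)
  have h5 := Finset.card_image_le (s := F) (f := Prod.snd)
  omega

/-! ### Spanning trees given by parents -/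

/-- `par` is the parent function of a spanning tree of `H` with root `s`; the rank shows that there
is no cycle. -/
structure IsParent (H : SimpleGraph (Fin n)) (s : Fin n) (par : Fin n → Fin n)
    (rank : Fin n → ℕ) : Prop where
  adj : ∀ v, v ≠ s → H.Adj (par v) v
  lt : ∀ v, v ≠ s → rank (par v) < rank v

/-- The edge `uv` belongs to the tree given by `par`. -/
def IsTreeEdge (s : Fin n) (par : Fin n → Fin n) (u v : Fin n) : Prop :=
  (v ≠ s ∧ par v = u) ∨ (u ≠ s ∧ par u = v)

/-- The edges outside the tree. -/
noncomputable def coTree (H : SimpleGraph (Fin n)) (s : Fin n) (par : Fin n → Fin n) :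
    Finset (Fin n × Fin n) :=
  (edgePairs H).filter fun p => ¬ IsTreeEdge s par p.1 p.2

theorem mem_coTree {H : SimpleGraph (Fin n)} {s : Fin n} {par : Fin n → Fin n} {p : Fin n × Fin n} :
    p ∈ coTree H s par ↔ p ∈ edgePairs H ∧ ¬ IsTreeEdge s par p.1 p.2 := Finset.mem_filter

/-- The tree has `n - 1` edges: every vertex except the root has an edge to its parent. -/
theorem card_coTree {H : SimpleGraph (Fin n)} {s : Fin n} {par : Fin n → Fin n}
    {rank : Fin n → ℕ} (h : IsParent H s par rank) :
    (coTree H s par).card + n = (edgePairs H).card + 1 := by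
  have h1 := Finset.card_filter_add_card_filter_not (s := edgePairs H)
    (fun p => IsTreeEdge s par p.1 p.2)
  have h2 : ((edgePairs H).filter fun p => IsTreeEdge s par p.1 p.2).card =
      (Finset.univ.erase s).card := by
    symm
    refine Finset.card_bij (fun v _ => (max v (par v), min v (par v))) ?_ ?_ ?_
    · intro v hv
      have hv : v ≠ s := by simpa using hv
      have ha := h.adj v hv
      rcases lt_or_gt_of_ne (H.ne_of_adj ha) with hlt | hlt
      · simp only [max_eq_left hlt.le, min_eq_right hlt.le]
        exact Finset.mem_filter.2 ⟨mem_edgePairs.2 ⟨hlt, ha.symm⟩, Or.inr ⟨hv, rfl⟩⟩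
      · simp only [max_eq_right hlt.le, min_eq_left hlt.le]
        exact Finset.mem_filter.2 ⟨mem_edgePairs.2 ⟨hlt, ha⟩, Or.inl ⟨hv, rfl⟩⟩
    · intro v hv w hw he
      have hv : v ≠ s := by simpa using hv
      have hw : w ≠ s := by simpa using hw
      have l1 := h.lt v hv
      have l2 := h.lt w hw
      by_contra hne
      simp only [Prod.mk.injEq] at he
      have : par v = w ∧ par w = v := by
        rcases le_total v (par v) with a | a <;> rcases le_total w (par w) with b | b <;>
          simp only [a, b, max_eq_left, max_eq_right, min_eq_left, min_eq_right] at he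
        · exact absurd he.2 hne
        · exact ⟨he.1, he.2.symm⟩
        · exact ⟨he.2, he.1.symm⟩
        · exact absurd he.1 hne
      rw [this.1] at l1
      rw [this.2] at l2
      omega
    · rintro ⟨u, v⟩ hp
      simp only [Finset.mem_filter, mem_edgePairs] at hp
      obtain ⟨⟨hlt, ha⟩, ⟨hs, hpar⟩ | ⟨hs, hpar⟩⟩ := hp
      · refine ⟨v, by simpa using hs, ?_⟩
        simp [hpar, max_eq_right hlt.le, min_eq_left hlt.le]
      · refine ⟨u, by simpa using hs, ?_⟩
        simp [hpar, max_eq_left hlt.le, min_eq_right hlt.le]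
  have h3 : (Finset.univ.erase s).card + 1 = n := by
    rw [Finset.card_erase_add_one (Finset.mem_univ s), Finset.card_univ, Fintype.card_fin]
  rw [coTree]
  omega

/-- A set of vertices that contains the parents of its members, the vertices of low degree and the
ends of the edges outside the tree contains every vertex: a missing vertex of maximal rank would be
a leaf of the tree. -/
theorem eq_univ_of_parent_closed {H : SimpleGraph (Fin n)} {s : Fin n} {par : Fin n → Fin n}
    {rank : Fin n → ℕ} (h : IsParent H s par rank) {W : Set (Fin n)} (hs : s ∈ W)
    (hpar : ∀ v ∈ W, v ≠ s → par v ∈ W) (hlow : ∀ v ∈ lowVerts H, v ∈ W)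
    (hco : ∀ p ∈ coTree H s par, p.1 ∈ W ∧ p.2 ∈ W) : W = Set.univ := by
  by_contra hne
  obtain ⟨x0, hx0⟩ := (Set.ne_univ_iff_exists_notMem W).1 hne
  obtain ⟨x, hx, hmax⟩ := Finset.exists_max_image (Finset.univ.filter fun v => v ∉ W) rank
    ⟨x0, by simpa using hx0⟩
  simp only [Finset.mem_filter, Finset.mem_univ, true_and] at hx hmax
  have hxs : x ≠ s := fun e => hx (e ▸ hs)
  have hdeg : 1 < (Finset.univ.filter fun w => H.Adj x w).card := by
    by_contra hcon
    exact hx (hlow x (by simp [lowVerts]; omega))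
  obtain ⟨z, hz, hzp⟩ := Finset.exists_mem_ne hdeg (par x)
  have hz : H.Adj x z := by simpa using hz
  have key : IsTreeEdge s par x z := by
    by_contra hcon
    have hcon' : ¬ IsTreeEdge s par z x := fun hh => hcon (hh.symm)
    rcases lt_or_gt_of_ne (H.ne_of_adj hz) with hlt | hlt
    · exact hx (hco (z, x) (by simp [coTree, mem_edgePairs, hlt, hz.symm, hcon'])).2
    · exact hx (hco (x, z) (by simp [coTree, mem_edgePairs, hlt, hz, hcon])).1
  rcases key with ⟨hzs, he⟩ | ⟨-, he⟩
  · have hlt := h.lt z hzs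
    rw [he] at hlt
    have hzW : z ∈ W := by
      by_contra hzW
      have := hmax z hzW
      omega
    have := hpar z hzW hzs
    rw [he] at this
    exact hx this
  · exact hzp he.symm

end

/-! ### Earliest arrival in a time-dependent transition system -/

/-- `Reach S a t j`: the state `j` can be reached from the state `a` by time `t`, where `S t i j` is
a transition from `i` to `j` that takes the time step from `t` to `t + 1`. Waiting is allowed. -/
def Reach (S : ℕ → ℕ → ℕ → Prop) (a : ℕ) : ℕ → ℕ → Prop
  | 0, j => j = a
  | t + 1, j => Reach S a t j ∨ ∃ i, Reach S a t i ∧ S t i j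

section
variable {S : ℕ → ℕ → ℕ → Prop} {a N : ℕ}

theorem Reach.mono {t t' j : ℕ} (h : Reach S a t j) (ht : t ≤ t') : Reach S a t' j := by
  induction ht with
  | refl => exact h
  | step _ ih => exact Or.inl ih

theorem Reach.lt (ha : a < N) (hS : ∀ t i j, i < N → S t i j → j < N) {t j : ℕ}
    (h : Reach S a t j) : j < N := by
  induction t generalizing j with
  | zero => exact h ▸ ha
  | succ t ih =>
    rcases h with h | ⟨i, hi, hs⟩
    · exact ih h
    · exact hS _ _ _ (ih hi) hs

/-- While the transitions do not change, no new state is reached after `N` steps, `N` being the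
number of states. -/
theorem Reach.static (ha : a < N) (hS : ∀ t i j, i < N → S t i j → j < N) {t₀ d : ℕ}
    (hst : ∀ t < d, S (t₀ + t) = S t₀) {t j : ℕ} (hNt : N ≤ t) (htd : t ≤ d) :
    Reach S a (t₀ + t) j ↔ Reach S a (t₀ + N) j := by
  classical
  let R : ℕ → Finset ℕ := fun t => (Finset.range N).filter fun j => Reach S a (t₀ + t) j
  have hR : ∀ t j, j ∈ R t ↔ Reach S a (t₀ + t) j := fun t j => by
    simp only [R, Finset.mem_filter, Finset.mem_range, and_iff_right_iff_imp]
    exact fun h => h.lt ha hS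
  have hmono : ∀ t, R t ⊆ R (t + 1) := fun t j h => (hR _ _).2 (((hR _ _).1 h).mono (by omega))
  -- once a step adds nothing, no later step does
  have hstep : ∀ t t', t + 1 ≤ t' → t' ≤ d → R t = R (t + 1) → R t' = R t := by
    intro t t' h1
    induction h1 with
    | refl => exact fun _ h => h.symm
    | @step t' h1 ih =>
      intro h2 h3
      have h1 : t + 1 ≤ t' := h1
      have h4 := ih (by omega) h3
      refine Finset.Subset.antisymm (fun j hj => ?_) (h4 ▸ hmono t')
      rcases (hR _ _).1 hj with h | ⟨i, hi, hs⟩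
      · exact h4 ▸ (hR _ _).2 h
      · have hi' : i ∈ R t := h4 ▸ (hR _ _).2 hi
        rw [h3]
        refine (hR _ _).2 (Or.inr ⟨i, (hR _ _).1 hi', ?_⟩)
        change S (t₀ + t') i j at hs
        rw [hst t' (by omega)] at hs
        change S (t₀ + t) i j
        rw [hst t (by omega)]
        exact hs
  have hex : ∃ t ≤ N, R t = R (t + 1) := by
    by_contra hcon
    push Not at hcon
    have hcard : ∀ t ≤ N + 1, t ≤ (R t).card := by
      intro t
      induction t with
      | zero => simp
      | succ t ih =>
        intro h
        have h1 := ih (by omega)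
        have h2 := Finset.card_lt_card
          ((hmono t).ssubset_of_ne (hcon t (by omega)))
        omega
    have h1 := hcard (N + 1) le_rfl
    have h2 : (R (N + 1)).card ≤ N := by
      simpa using Finset.card_filter_le (Finset.range N) _
    omega
  obtain ⟨t1, h1, h2⟩ := hex
  have key : ∀ t', t1 ≤ t' → t' ≤ d → R t' = R t1 := by
    intro t' h3 h4
    rcases Nat.eq_or_lt_of_le h3 with rfl | h3
    · rfl
    · exact hstep _ _ h3 h4 h2
  rw [← hR, ← hR, key t (by omega) htd, key N h1 (by omega)]

/-- `arr` is the table of the earliest arrival dates up to `t`, with the value `inf` for the states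
not reached by then, and `pre` gives the last but one state of a fastest way to each state. -/
structure IsTable (S : ℕ → ℕ → ℕ → Prop) (a N inf t : ℕ) (arr pre : ℕ → ℕ) : Prop where
  reach : ∀ j < N, ∀ t' ≤ t, arr j ≤ t' ↔ Reach S a t' j
  or_inf : ∀ j < N, arr j ≤ t ∨ arr j = inf
  pre : ∀ j < N, 0 < arr j → arr j ≤ t →
    pre j < N ∧ arr (pre j) < arr j ∧ S (arr j - 1) (pre j) j

theorem IsTable.init {inf : ℕ} (hinf : 0 < inf) {arr pre : ℕ → ℕ}
    (harr : ∀ j < N, arr j = if j = a then 0 else inf) : IsTable S a N inf 0 arr pre where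
  reach := by
    intro j hj t' ht'
    obtain rfl : t' = 0 := by omega
    rw [harr j hj, Reach]
    split_ifs with h
    · simp [h]
    · simp only [h, iff_false]; omega
  or_inf := by
    intro j hj
    rw [harr j hj]
    split_ifs <;> simp
  pre := by omega

/-- One relaxation of every transition at time `t`; the tables `arr₀`, `pre₀` become `arr`, `pre`. -/
structure IsPass (S : ℕ → ℕ → ℕ → Prop) (N inf t : ℕ) (arr₀ pre₀ arr pre : ℕ → ℕ) : Prop where
  old : ∀ j < N, arr₀ j ≤ t → arr j = arr₀ j ∧ pre j = pre₀ j
  new : ∀ j < N, ¬ arr₀ j ≤ t →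
    arr j = inf ∨ (arr j = t + 1 ∧ pre j < N ∧ arr₀ (pre j) ≤ t ∧ S t (pre j) j)
  all : ∀ i < N, arr₀ i ≤ t → ∀ j < N, S t i j → arr j ≤ t + 1

theorem IsTable.succ {inf t : ℕ} {arr₀ pre₀ arr pre : ℕ → ℕ}
    (h : IsTable S a N inf t arr₀ pre₀) (hp : IsPass S N inf t arr₀ pre₀ arr pre)
    (hinf : t + 1 < inf) (ha : a < N) (hS : ∀ t i j, i < N → S t i j → j < N) :
    IsTable S a N inf (t + 1) arr pre := by
  have hle : ∀ j < N, arr j ≤ t ↔ arr₀ j ≤ t := by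
    intro j hj
    by_cases h1 : arr₀ j ≤ t
    · rw [(hp.old j hj h1).1]
    · rcases hp.new j hj h1 with h2 | h2 <;> simp only [h1, iff_false] <;> omega
  refine ⟨fun j hj t' ht' => ?_, fun j hj => ?_, fun j hj h1 h2 => ?_⟩
  · rcases Nat.lt_or_ge t t' with hlt | hge
    · obtain rfl : t' = t + 1 := by omega
      constructor
      · intro h1
        by_cases h2 : arr₀ j ≤ t
        · exact Or.inl ((h.reach j hj t le_rfl).1 h2)
        · rcases hp.new j hj h2 with h3 | ⟨-, h3, h4, h5⟩
          · omega
          · exact Or.inr ⟨_, (h.reach _ h3 t le_rfl).1 h4, h5⟩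
      · rintro (h1 | ⟨i, h1, h2⟩)
        · have := (h.reach j hj t le_rfl).2 h1
          rw [(hp.old j hj this).1]
          omega
        · have hi := h1.lt ha hS
          exact hp.all i hi ((h.reach i hi t le_rfl).2 h1) j hj h2
    · rw [← h.reach j hj t' hge]
      by_cases h1 : arr₀ j ≤ t
      · rw [(hp.old j hj h1).1]
      · have := hle j hj
        omega
  · by_cases h1 : arr₀ j ≤ t
    · rw [(hp.old j hj h1).1]; omega
    · rcases hp.new j hj h1 with h2 | h2 <;> omega
  · by_cases h3 : arr₀ j ≤ t
    · obtain ⟨e1, e2⟩ := hp.old j hj h3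
      rw [e1] at h1 h2 ⊢
      rw [e2]
      obtain ⟨h4, h5, h6⟩ := h.pre j hj h1 h3
      refine ⟨h4, ?_, h6⟩
      rw [(hp.old _ h4 (by omega)).1]
      exact h5
    · rcases hp.new j hj h3 with h4 | ⟨h4, h5, h6, h7⟩
      · omega
      · refine ⟨h5, ?_, ?_⟩
        · rw [(hp.old _ h5 h6).1]; omega
        · rw [h4]; exact h7

/-- While the transitions do not change, `N` passes are enough; the table is then also the table for
the end of that period. -/
theorem IsTable.static {inf t₀ d : ℕ} {arr pre : ℕ → ℕ}
    (h : IsTable S a N inf (t₀ + min d N) arr pre) (hinf : t₀ + d < inf) (ha : a < N)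
    (hS : ∀ t i j, i < N → S t i j → j < N) (hst : ∀ t < d, S (t₀ + t) = S t₀) :
    IsTable S a N inf (t₀ + d) arr pre := by
  rcases Nat.le_total d N with hd | hd
  · rwa [min_eq_left hd] at h
  rw [min_eq_right hd] at h
  refine ⟨fun j hj t' ht' => ?_, fun j hj => ?_, fun j hj h1 h2 => ?_⟩
  · rcases Nat.le_total t' (t₀ + N) with hle | hle
    · exact h.reach j hj t' hle
    · have h1 := Reach.static (t := t' - t₀) (j := j) ha hS hst (by omega) (by omega)
      rw [show t₀ + (t' - t₀) = t' by omega] at h1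
      rw [h1, ← h.reach j hj _ le_rfl]
      have := h.or_inf j hj
      omega
  · have := h.or_inf j hj
    omega
  · refine h.pre j hj h1 ?_
    have := h.or_inf j hj
    omega

end

/-! ### States: a vertex and the set of visited checkpoints -/

section
variable {n : ℕ}

/-- The number `i` encodes the state of an agent at `u` that has visited the vertices in `W`. The
checkpoints are the vertices `P 0, …, P (k - 1)`; the bit `b` of `i / n` tells whether `P b` has
been visited, and `i % n` is the position. -/
structure Codes (k : ℕ) (P : ℕ → ℕ) (i : ℕ) (W : Set (Fin n)) (u : Fin n) : Prop where
  lt : i < n * 2 ^ k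
  mod : i % n = u
  bit : ∀ b < k, (i / n).testBit b = true ↔ ∃ v ∈ W, (v : ℕ) = P b

/-- The move table: `X (n * B + v)` is `n` times the bit pattern that results from `B` when `v` is
visited. -/
def IsMoveTable (n k : ℕ) (P X : ℕ → ℕ) : Prop :=
  ∀ j < n * 2 ^ k, ∃ B < 2 ^ k, X j = n * B ∧
    ∀ b < k, B.testBit b = true ↔ ((j / n).testBit b = true ∨ P b = j % n)

/-- The transitions at time `t`: the agent may cross an edge that is available (`A`) if it belongs
to the tree (`T`) or if no checkpoint is visited for the first time. -/
def Step (n : ℕ) (A : ℕ → ℕ → ℕ → Prop) (T : ℕ → ℕ → Prop) (X : ℕ → ℕ) (t i j : ℕ) : Prop :=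
  ∃ v < n, A t (i % n) v ∧ (T (i % n) v ∨ X (i - i % n + v) = i - i % n) ∧
    j = X (i - i % n + v) + v

variable {k : ℕ} {P X : ℕ → ℕ} {i : ℕ} {W : Set (Fin n)} {u : Fin n}

theorem index_lt {k j v : ℕ} (hj : j < n * 2 ^ k) (hv : v < n) : j - j % n + v < n * 2 ^ k := by
  have h1 := Nat.div_add_mod j n
  have h2 : j / n < 2 ^ k := Nat.div_lt_of_lt_mul hj
  have h3 : n * (j / n + 1) ≤ n * 2 ^ k := Nat.mul_le_mul_left n h2
  rw [Nat.mul_add] at h3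
  omega

theorem IsMoveTable.next_lt (hX : IsMoveTable n k P X) {j v : ℕ} (hj : j < n * 2 ^ k) (hv : v < n) :
    X j + v < n * 2 ^ k := by
  obtain ⟨B, hB, h1, -⟩ := hX j hj
  have h3 : n * (B + 1) ≤ n * 2 ^ k := Nat.mul_le_mul_left n hB
  rw [Nat.mul_add] at h3
  omega

theorem index_div {j v : ℕ} (hv : v < n) : (j - j % n + v) / n = j / n := by
  have h1 := Nat.div_add_mod j n
  rw [show j - j % n + v = v + n * (j / n) by omega, Nat.add_mul_div_left _ _ (by omega),
    Nat.div_eq_of_lt hv, zero_add]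

theorem index_mod {j v : ℕ} (hv : v < n) : (j - j % n + v) % n = v := by
  have h1 := Nat.div_add_mod j n
  rw [show j - j % n + v = v + n * (j / n) by omega, Nat.add_mul_mod_self_left,
    Nat.mod_eq_of_lt hv]

/-- Moving to `v` records `v` if it is a checkpoint. -/
theorem Codes.move (h : Codes k P i W u) (hX : IsMoveTable n k P X) (v : Fin n) :
    Codes k P (X (i - i % n + v) + v) (insert v W) v := by
  obtain ⟨B, hB, h1, h2⟩ := hX _ (index_lt h.lt v.2)
  refine ⟨hX.next_lt (index_lt h.lt v.2) v.2, ?_, fun b hb => ?_⟩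
  · rw [h1, add_comm, Nat.add_mul_mod_self_left, Nat.mod_eq_of_lt v.2]
  · rw [h1, add_comm, Nat.add_mul_div_left _ _ (by have := v.2; omega), Nat.div_eq_of_lt v.2,
      zero_add, h2 b hb, index_div v.2, index_mod v.2, h.bit b hb]
    constructor
    · rintro (⟨w, hw, e⟩ | e)
      · exact ⟨w, Set.mem_insert_of_mem _ hw, e⟩
      · exact ⟨v, Set.mem_insert _ _, e.symm⟩
    · rintro ⟨w, rfl | hw, e⟩
      · exact Or.inr e.symm
      · exact Or.inl ⟨w, hw, e⟩

/-- The bit pattern does not change on a move to a visited vertex. -/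
theorem Codes.move_eq (h : Codes k P i W u) (hX : IsMoveTable n k P X) {v : Fin n} (hv : v ∈ W) :
    X (i - i % n + v) = i - i % n := by
  obtain ⟨B, hB, h1, h2⟩ := hX _ (index_lt h.lt v.2)
  have h3 := Nat.div_add_mod i n
  rw [h1, show i - i % n = n * (i / n) by omega]
  congr 1
  refine Nat.eq_of_testBit_eq fun b => ?_
  rcases Nat.lt_or_ge b k with hb | hb
  · rw [Bool.eq_iff_iff, h2 b hb, index_div v.2, index_mod v.2]
    refine or_iff_left_of_imp fun e => (h.bit b hb).2 ⟨v, hv, e.symm⟩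
  · have hp : 2 ^ k ≤ 2 ^ b := Nat.pow_le_pow_right (by omega) hb
    rw [Nat.testBit_lt_two_pow (by omega), Nat.testBit_lt_two_pow]
    exact lt_of_lt_of_le (Nat.div_lt_of_lt_mul h.lt) hp

/-- If the bit pattern does not change on a move to a checkpoint, that checkpoint has been visited. -/
theorem Codes.mem_of_move_eq (h : Codes k P i W u) (hX : IsMoveTable n k P X) {v : Fin n}
    (he : X (i - i % n + v) = i - i % n) {b : ℕ} (hb : b < k) (hbv : P b = v) : v ∈ W := by
  obtain ⟨B, hB, h1, h2⟩ := hX _ (index_lt h.lt v.2)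
  have h3 := Nat.div_add_mod i n
  rw [h1, show i - i % n = n * (i / n) by omega] at he
  have h4 := Nat.eq_of_mul_eq_mul_left (by have := v.2; omega) he
  have h5 := (h2 b hb).2 (Or.inr (by rw [index_mod v.2, hbv]))
  rw [h4, h.bit b hb] at h5
  obtain ⟨w, hw, e⟩ := h5
  rwa [← Fin.ext (e.trans hbv)]

theorem Codes.start (hX : IsMoveTable n k P X) (s : Fin n) : Codes k P (X s + s) {s} s := by
  have h : Codes k P (s : ℕ) (∅ : Set (Fin n)) s :=
    ⟨lt_of_lt_of_le s.2 (Nat.le_mul_of_pos_right _ (by positivity)), Nat.mod_eq_of_lt s.2,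
      fun b hb => by simp [Nat.div_eq_of_lt s.2]⟩
  have := h.move hX s
  rwa [Nat.mod_eq_of_lt s.2, Nat.sub_self, zero_add, insert_empty_eq] at this

/-- The last `n` states are those in which all checkpoints have been visited. -/
theorem Codes.eq_last (h : Codes k P i Set.univ u) (hP : ∀ b < k, P b < n) :
    i = n * 2 ^ k - n + u := by
  have h1 : i / n = 2 ^ k - 1 := by
    refine Nat.eq_of_testBit_eq fun b => ?_
    rw [Nat.testBit_two_pow_sub_one]
    rcases Nat.lt_or_ge b k with hb | hb
    · rw [(h.bit b hb).2 ⟨⟨P b, hP b hb⟩, trivial, rfl⟩]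
      simp [hb]
    · have hp : 2 ^ k ≤ 2 ^ b := Nat.pow_le_pow_right (by omega) hb
      rw [Nat.testBit_lt_two_pow (lt_of_lt_of_le (Nat.div_lt_of_lt_mul h.lt) hp)]
      simp
      omega
  have h2 := Nat.div_add_mod i n
  rw [h1, h.mod, Nat.mul_sub, Nat.mul_one] at h2
  exact h2.symm

theorem Codes.mem_of_last (h : Codes k P (n * 2 ^ k - n + u) W u) {b : ℕ} (hb : b < k)
    {v : Fin n} (hv : P b = v) : v ∈ W := by
  have h1 : (n * 2 ^ k - n + u) / n = 2 ^ k - 1 := by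
    rw [show n * 2 ^ k - n = n * (2 ^ k - 1) by rw [Nat.mul_sub, Nat.mul_one], add_comm,
      Nat.add_mul_div_left _ _ (by have := v.2; omega), Nat.div_eq_of_lt u.2, zero_add]
  have h2 := (h.bit b hb).1 (by rw [h1, Nat.testBit_two_pow_sub_one]; simp [hb])
  obtain ⟨w, hw, e⟩ := h2
  rwa [← Fin.ext (e.trans hv)]

/-! ### Journeys and walks through the states -/

open TVG

/-- Going back from the state `i` to the start by means of `pre` yields the journey `J`. -/
inductive Walk (n : ℕ) (arr pre : ℕ → ℕ) : ℕ → List (Fin n × ℕ) → Prop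
  | start {j : ℕ} : arr j = 0 → Walk n arr pre j []
  | step {j : ℕ} {v : Fin n} {J : List (Fin n × ℕ)} : 0 < arr j → j % n = (v : ℕ) →
      Walk n arr pre (pre j) J → Walk n arr pre j (J ++ [(v, arr j - 1)])

variable {A : ℕ → ℕ → ℕ → Prop} {T : ℕ → ℕ → Prop} {inf t : ℕ} {arr pre : ℕ → ℕ} {s : Fin n}

theorem Step.lt (hX : IsMoveTable n k P X) {t i j : ℕ} (hi : i < n * 2 ^ k)
    (h : Step n A T X t i j) : j < n * 2 ^ k := by
  obtain ⟨v, hv, -, -, rfl⟩ := h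
  exact hX.next_lt (index_lt hi hv) hv

/-- Every state with an arrival date has a walk back to the start; its length is bounded since the
arrival dates decrease strictly along it. -/
theorem IsTable.exists_walk (h : IsTable (Step n A T X) (X s + s) (n * 2 ^ k) inf t arr pre)
    {j : ℕ} (hj : j < n * 2 ^ k) (hjt : arr j ≤ t) :
    ∃ J, Walk n arr pre j J ∧ J.length ≤ n * 2 ^ k := by
  have key : ∀ m j, arr j = m → j < n * 2 ^ k → arr j ≤ t → ∃ J, Walk n arr pre j J ∧
      J.length ≤ ((Finset.range (n * 2 ^ k)).filter fun i => arr i < arr j).card := by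
    intro m
    induction m using Nat.strong_induction_on with
    | _ m ih =>
      intro j hm hj hjt
      rcases Nat.eq_zero_or_pos (arr j) with h0 | h0
      · exact ⟨[], Walk.start h0, by simp⟩
      · obtain ⟨h1, h2, h3⟩ := h.pre j hj h0 hjt
        obtain ⟨J, hJ, hl⟩ := ih _ (by omega) _ rfl h1 (by omega)
        refine ⟨J ++ [(⟨j % n, Nat.mod_lt _ s.pos⟩, arr j - 1)], Walk.step h0 rfl hJ, ?_⟩
        have := Finset.card_lt_card (s := (Finset.range (n * 2 ^ k)).filter
          fun i => arr i < arr (pre j)) (t := (Finset.range (n * 2 ^ k)).filter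
          fun i => arr i < arr j) (by
            refine Finset.ssubset_iff_subset_ne.2 ⟨fun x hx => ?_, fun e => ?_⟩
            · simp only [Finset.mem_filter, Finset.mem_range] at hx ⊢
              exact ⟨hx.1, hx.2.trans h2⟩
            · have : pre j ∈ (Finset.range (n * 2 ^ k)).filter fun i => arr i < arr (pre j) := by
                rw [e]; simp [h1, h2]
              simp at this)
        simp
        omega
  obtain ⟨J, h1, h2⟩ := key _ j rfl hj hjt
  refine ⟨J, h1, h2.trans ?_⟩
  simpa using Finset.card_filter_le (Finset.range (n * 2 ^ k)) fun i => arr i < arr j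

/-- What a walk back through the table means. `C` is any property of the set of visited vertices
that is preserved by the permitted moves. -/
theorem IsTable.walk_spec {𝒢 : TVG (Fin n)} {C : Set (Fin n) → Prop}
    (hX : IsMoveTable n k P X)
    (h : IsTable (Step n A T X) (X s + s) (n * 2 ^ k) inf t arr pre)
    (hA : ∀ τ < t, ∀ u v : Fin n, A τ u v → (𝒢.snap τ).Adj u v)
    (hC0 : C {s})
    (hC : ∀ τ < t, ∀ (W : Set (Fin n)) (u v : Fin n), C W → u ∈ W → (𝒢.snap τ).Adj u v →
      (T u v ∨ ∀ b < k, P b = v → v ∈ W) → C (insert v W))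
    {j : ℕ} {J : List (Fin n × ℕ)} (hJ : Walk n arr pre j J) (hj : j < n * 2 ^ k)
    (hjt : arr j ≤ t) :
    𝒢.IsJourney s 0 J ∧ arrival 0 J = arr j ∧ Codes k P j (visited s J) (dest s J) ∧
      C (visited s J) := by
  induction hJ with
  | @start j h0 =>
    have : j = X s + s := (h.reach j hj 0 (by omega)).1 (by omega)
    subst this
    refine ⟨trivial, ?_, ?_, ?_⟩
    · rw [h0]; rfl
    · rw [visited_nil]; exact Codes.start hX s
    · rw [visited_nil]; exact hC0
  | @step j v J h0 hv hJ ih =>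
    obtain ⟨h1, h2, v', hv', h4, h5, h6⟩ := h.pre j hj h0 hjt
    obtain ⟨i1, i2, i3, i4⟩ := ih h1 (by omega)
    have hcode := i3.move hX ⟨v', hv'⟩
    rw [← h6] at hcode
    obtain rfl : (⟨v', hv'⟩ : Fin n) = v := Fin.ext (hcode.mod.symm.trans hv)
    have hadj : (𝒢.snap (arr j - 1)).Adj (dest s J) ⟨v', hv'⟩ := by
      refine hA _ (by omega) _ _ ?_
      rw [← i3.mod]
      exact h4
    refine ⟨isJourney_concat.2 ⟨i1, by omega, hadj⟩, ?_, ?_, ?_⟩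
    · rw [arrival_concat]; omega
    · rw [visited_concat, dest_concat]; exact hcode
    · rw [visited_concat]
      refine hC _ (by omega) _ _ _ i4 (dest_mem_visited _ _) hadj ?_
      rw [← i3.mod]
      exact h5.imp_right fun he b hb hbv => i3.mem_of_move_eq hX he hb hbv

/-- A journey that enters vertices for the first time through tree edges only is simulated by
permitted moves. -/
theorem reach_of_firstVisits {𝒢 : TVG (Fin n)} {H : SimpleGraph (Fin n)} {D : ℕ}
    {par : Fin n → Fin n} (hX : IsMoveTable n k P X)
    (hA : ∀ τ < D, ∀ u v : Fin n, (𝒢.snap τ).Adj u v → A τ u v)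
    (hH : ∀ τ < D, 𝒢.snap τ ≤ H)
    (hT : ∀ u v : Fin n, H.Adj u v → v ≠ s → par v = u → T u v) (J : List (Fin n × ℕ))
    (hJ : 𝒢.IsJourney s 0 J) (hD : arrival 0 J ≤ D) (hf : FirstVisits par s J) :
    ∃ i, Codes k P i (visited s J) (dest s J) ∧ Reach (Step n A T X) (X s + s) (arrival 0 J) i := by
  induction J using List.reverseRecOn with
  | nil =>
    refine ⟨X s + s, ?_, rfl⟩
    rw [visited_nil]
    exact Codes.start hX s
  | append_singleton J x ih =>
    obtain ⟨v, τ⟩ := x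
    rw [isJourney_concat] at hJ
    rw [arrival_concat] at hD
    obtain ⟨h1, h2, h3⟩ := hJ
    obtain ⟨i, hc, hr⟩ := ih h1 (by omega)
      fun J' w r h => hf J' w r (h.trans (List.prefix_append _ _))
    refine ⟨_, by rw [visited_concat, dest_concat]; exact hc.move hX v, ?_⟩
    rw [arrival_concat]
    refine Or.inr ⟨i, hr.mono h2, v, v.2, ?_, ?_, rfl⟩
    · rw [hc.mod]
      exact hA τ (by omega) _ _ h3
    · rcases hf J v τ (List.prefix_refl _) with hv | hv
      · exact Or.inr (hc.move_eq hX hv)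
      · by_cases hvs : v = s
        · subst hvs
          exact Or.inr (hc.move_eq hX (start_mem_visited _ _))
        · rw [hc.mod]
          exact Or.inl (hT _ _ (hH τ (by omega) h3) hvs hv)

end

/-! ### The program -/

namespace Visit
open Cmd Exp

/-- The absolute difference. -/
def diff (e f : Exp) : Exp := (e - f) + (f - e)

/-- `R[u] = u * n` for all `u`, and `nn = n * n`. -/
def rows : Cmd :=
  loop .u (var .n) (block [put .R (var .u) (var .nn), asg .nn (var .nn + var .n)])

/-- `H` is the adjacency matrix of the union of the given graphs, `D` the total duration. -/
def union : Cmd :=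
  loop .b (var .q) (block [
    asg .D (var .D + rd .I (var .p)),
    asg .p (var .p + 1),
    loop .j (var .nn) (ifLt 0 (rd .I (var .p + var .j)) (put .H (var .j) 1) skip),
    asg .p (var .p + var .nn)])

/-- Compute the degree `d` of `u`, and list the edges from `u` to smaller vertices. -/
def row : Cmd :=
  loop .v (var .n) (ifLt 0 (rd .H (rd .R (var .u) + var .v))
    (block [
      asg .d (var .d + 1),
      ifLt (var .v) (var .u)
        (block [put .EU (var .M) (var .u), put .EV (var .M) (var .v), asg .M (var .M + 1)])
        skip])
    skip)

/-- List the edges `EU[e] EV[e]` of `H` for `1 ≤ e < M`, and the `k0` vertices of degree at most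
one in `P`. -/
def edges : Cmd :=
  loop .u (var .n) (block [
    asg .d 0,
    row,
    ifLt (var .d) 2 (block [put .P (var .k0) (var .u), asg .k0 (var .k0 + 1)]) skip])

/-- `T` becomes the adjacency matrix `H`. -/
def copyTree : Cmd := loop .j (var .nn) (put .T (var .j) (rd .H (var .j)))

/-- Delete the `c` edges given by `od` from `T`, and append their ends to the checkpoints. -/
def cut (c : ℕ) : Cmd :=
  loop .j (lit c) (block [
    asg .u (rd .EU (rd .od (var .j))),
    asg .v (rd .EV (rd .od (var .j))),
    put .T (rd .R (var .u) + var .v) 0,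
    put .T (rd .R (var .v) + var .u) 0,
    put .P (var .k) (var .u),
    put .P (var .k + 1) (var .v),
    asg .k (var .k + 2)])

/-- The move table for no checkpoints. -/
def baseTable : Cmd := loop .v (var .n) (block [put .X (var .v) 0, put .vt (var .v) (var .v)])

/-- Extend the move table `X`, and the table `vt` of the positions, by one checkpoint. -/
def extendTable : Cmd :=
  loop .j (var .len) (block [
    asg .nx (rd .X (var .j)),
    put .X (var .len + var .j) (var .nx + var .len),
    put .vt (var .len + var .j) (rd .vt (var .j)),
    ifLt (diff (rd .vt (var .j)) (rd .P (var .i))) 1 (put .X (var .j) (var .nx + var .len)) skip])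

/-- Build the move table. -/
def moveTable : Cmd :=
  loop .i (var .k) (block [extendTable, asg .len (var .len + var .len)])

/-- Initialize the table of the arrival dates. -/
def initTable : Cmd :=
  block [loop .j (var .len) (put .arr (var .j) (var .inf)), put .arr (rd .X (var .s) + var .s) 0]

/-- Relax the transitions from the state `i` at time `tt - 1`; the matrix of the available edges
starts at `I[p + 1]`. -/
def relax : Cmd :=
  loop .v (var .n) (ifLt 0 (rd .I (var .p + 1 + rd .R (var .u) + var .v))
    (block [
      asg .nx (rd .X (var .r + var .v)),
      ifLt 0 (rd .T (rd .R (var .u) + var .v) + (1 - diff (var .nx) (var .r)))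
        (ifLt (var .tt) (rd .arr (var .nx + var .v))
          (block [put .arr (var .nx + var .v) (var .tt), put .pre (var .nx + var .v) (var .i)])
          skip)
        skip])
    skip)

/-- Relax all transitions at time `tt - 1`. -/
def pass : Cmd :=
  loop .i (var .len) (ifLt (rd .arr (var .i)) (var .tt)
    (block [asg .u (rd .vt (var .i)), asg .r (var .i - var .u), relax]) skip)

/-- Compute the table of the earliest arrival dates. -/
def scan : Cmd :=
  loop .b (var .q) (block [
    asg .cnt (rd .I (var .p)),
    ifLt (var .len) (var .cnt) (asg .cnt (var .len)) skip,
    loop .j (var .cnt) (block [asg .tt (var .t + var .j + 1), pass]),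
    asg .t (var .t + rd .I (var .p)),
    asg .p (var .p + 1 + var .nn)])

/-- Follow the table back from the state `cur`, mark the vertices of the journey in `vis`, and
record the journey backwards in `WV` and `WT`. -/
def trace : Cmd :=
  loop .i (var .len) (ifLt 0 (rd .arr (var .cur))
    (block [
      asg .v (rd .vt (var .cur)),
      put .vis (var .v) 1,
      put .WV (var .l) (var .v),
      put .WT (var .l) (rd .arr (var .cur) - 1),
      asg .l (var .l + 1),
      asg .cur (rd .pre (var .cur))])
    skip)

/-- Trace the journey to the state `e`, and test whether it visits every vertex. -/
def tryState : Cmd :=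
  block [
    loop .v (var .n) (put .vis (var .v) 0),
    put .vis (var .s) 1,
    asg .l 0,
    asg .cur (var .e),
    trace,
    asg .ok 1,
    loop .v (var .n) (ifLt (rd .vis (var .v)) 1 (asg .ok 0) skip)]

/-- Keep the traced journey as the best one. -/
def save : Cmd :=
  block [
    asg .best (rd .arr (var .e)),
    asg .blen (var .l),
    loop .i (var .l) (block [
      put .BV (var .i) (rd .WV (var .i)), put .BT (var .i) (rd .WT (var .i))])]

/-- Try all states in which every checkpoint has been visited. -/
def finish : Cmd :=
  loop .u (var .n) (block [
    asg .e (var .len - var .n + var .u),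
    ifLt (rd .arr (var .e)) (var .best) (block [tryState, ifLt 0 (var .ok) save skip]) skip])

/-- The search for the choice `od` of the edges outside the tree. -/
def body (c : ℕ) : Cmd :=
  block [
    copyTree, asg .k (var .k0), cut c,
    baseTable, asg .len (var .n), moveTable,
    initTable, asg .t 0, asg .p 3, scan,
    finish]

/-- Run `body` for all values of `od[0]`, …, `od[c - 1]` below `M`. -/
def nest (body : Cmd) : ℕ → Cmd
  | 0 => body
  | c + 1 => loop .g (var .M) (block [put .od (lit c) (var .g), nest body c])

/-- Write the result. -/
def output : Cmd :=
  ifLt (var .best) (var .inf)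
    (block [
      write 1,
      write (var .blen),
      loop .i (var .blen) (block [
        write (rd .BV (var .blen - 1 - var .i)), write (rd .BT (var .blen - 1 - var .i))])])
    (write 0)

/-- Read the parameters and analyse the union of the given graphs. The edge number `0` is a loop at
`s`; it stands for no edge. -/
def prepare : Cmd :=
  block [
    asg .n (rd .I 0), asg .s (rd .I 1), asg .q (rd .I 2),
    rows, asg .p 3, union,
    asg .M 1, put .EU 0 (var .s), put .EV 0 (var .s), edges]

/-- The whole program; a union with too few edges is not connected. -/
def main (c : ℕ) : Cmd :=
  block [
    prepare,
    ifLt (var .M) (var .n) (write 0)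
      (block [asg .inf (var .D + 1), asg .best (var .inf), nest (body c) c, output])]

end Visit

/-! ### Correctness of the search for a fixed choice of edges -/

namespace Visit
open Cmd Exp

/-- The data of an instance that the search works with: the number `n` of vertices, the start `s`,
the number `q` of given graphs with durations `dur` and adjacencies `adj`, the union `h`, its edges
`eu e`, `ev e` for `e < M`, its `k0` vertices `low b` of low degree, and the value `inf` for
unreached states. -/
structure Inst where
  (n s q M k0 inf : ℕ)
  (dur : ℕ → ℕ)
  (adj : ℕ → ℕ → ℕ → Prop)
  (h : ℕ → ℕ → Prop)
  (eu ev low : ℕ → ℕ)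

/-- All vertices in the lists are vertices. -/
structure Inst.WF (D : Inst) : Prop where
  s : D.s < D.n
  eu : ∀ e < D.M, D.eu e < D.n
  ev : ∀ e < D.M, D.ev e < D.n
  low : ∀ b < D.k0, D.low b < D.n

/-- The state holds the data of the instance. -/
structure Prep (D : Inst) (σ : St) : Prop where
  n : σ.var .n = D.n
  s : σ.var .s = D.s
  q : σ.var .q = D.q
  nn : σ.var .nn = D.n * D.n
  M : σ.var .M = D.M
  k0 : σ.var .k0 = D.k0
  inf : σ.var .inf = D.inf
  R : ∀ u < D.n, σ.arr .R u = u * D.n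
  dur : ∀ b < D.q, σ.arr .I (3 + b * (1 + D.n * D.n)) = D.dur b
  adj : ∀ b < D.q, ∀ u < D.n, ∀ v < D.n,
    0 < σ.arr .I (3 + b * (1 + D.n * D.n) + 1 + u * D.n + v) ↔ D.adj b u v
  H : ∀ u < D.n, ∀ v < D.n, 0 < σ.arr .H (u * D.n + v) ↔ D.h u v
  EU : ∀ e < D.M, σ.arr .EU e = D.eu e
  EV : ∀ e < D.M, σ.arr .EV e = D.ev e
  P : ∀ b < D.k0, σ.arr .P b = D.low b

/-- The command does not change the data of the instance, except for the checkpoints. -/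
def keeps (c : Cmd) : Bool :=
  [Var.n, .s, .q, .nn, .M, .k0, .inf].all (fun x => !c.modv x) &&
    [Arr.R, .I, .H, .EU, .EV].all fun a => !c.moda a

theorem Prep.frame {D : Inst} {σ τ : St} {c : Cmd} (h : Prep D σ) (hF : Frame c σ τ)
    (hc : keeps c = true) (hP : ∀ b < D.k0, τ.arr .P b = σ.arr .P b) : Prep D τ := by
  simp only [keeps, List.all_cons, List.all_nil, Bool.and_true, Bool.and_eq_true,
    Bool.not_eq_true'] at hc
  obtain ⟨⟨h1, h2, h3, h4, h5, h6, h7⟩, h8, h9, h10, h11, h12⟩ := hc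
  constructor
  · rw [hF.var _ h1, h.n]
  · rw [hF.var _ h2, h.s]
  · rw [hF.var _ h3, h.q]
  · rw [hF.var _ h4, h.nn]
  · rw [hF.var _ h5, h.M]
  · rw [hF.var _ h6, h.k0]
  · rw [hF.var _ h7, h.inf]
  · rw [hF.arr _ h8]; exact h.R
  · rw [hF.arr _ h9]; exact h.dur
  · rw [hF.arr _ h9]; exact h.adj
  · rw [hF.arr _ h10]; exact h.H
  · rw [hF.arr _ h11]; exact h.EU
  · rw [hF.arr _ h12]; exact h.EV
  · intro b hb; rw [hP b hb, h.P b hb]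

theorem Prep.frame' {D : Inst} {σ τ : St} {c : Cmd} (h : Prep D σ) (hF : Frame c σ τ)
    (hc : keeps c = true) (hP : c.moda .P = false) : Prep D τ :=
  h.frame hF hc fun b _ => by rw [hF.arr _ hP]

theorem mul_add_inj {n u v u' v' : ℕ} (hv : v < n) (hv' : v' < n)
    (h : u * n + v = u' * n + v') : u = u' ∧ v = v' := by
  have h1 : (u * n + v) / n = u := by
    rw [mul_comm, Nat.mul_add_div (by omega), Nat.div_eq_of_lt hv, add_zero]
  have h2 : (u' * n + v') / n = u' := by
    rw [mul_comm, Nat.mul_add_div (by omega), Nat.div_eq_of_lt hv', add_zero]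
  have : u = u' := by rw [← h1, h, h2]
  subst this
  exact ⟨rfl, by omega⟩

theorem mul_add_lt {n u v : ℕ} (hu : u < n) (hv : v < n) : u * n + v < n * n := by
  have : (u + 1) * n ≤ n * n := Nat.mul_le_mul_right n hu
  rw [Nat.add_mul] at this
  omega

variable {D : Inst} {σ : St}

theorem copyTree_spec (hP : Prep D σ) :
    (∀ j < D.n * D.n, (copyTree.run σ).arr .T j = σ.arr .H j) ∧
      (copyTree.run σ).tm ≤ σ.tm + 4 + D.n * D.n * 30 := by
  have key : _ ∧ (copyTree.run σ).tm ≤ _ ∧ _ :=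
    run_loop (fun i τ => ∀ j < i, τ.arr .T j = σ.arr .H j) (D.n * D.n) 30
      (by simp [hP.nn]) (by simp) (by
        intro i hi τ hF hI
        refine ⟨fun j hj => ?_, by simp⟩
        by_cases hji : j = i
        · simp [hji, hF.arr .H rfl]
        · simp [hji, hI j (by omega)])
  obtain ⟨h1, h2, -⟩ := key
  refine ⟨h1, h2.trans (by simp)⟩

/-- The tree edges that remain when the edges chosen by `od` are deleted. -/
def Inst.tree (D : Inst) (c : ℕ) (od : ℕ → ℕ) (u v : ℕ) : Prop :=
  D.h u v ∧ ∀ j < c, ¬ (D.eu (od j) = u ∧ D.ev (od j) = v) ∧ ¬ (D.eu (od j) = v ∧ D.ev (od j) = u)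

theorem cut_spec (hP : Prep D σ) (hD : D.WF) {c : ℕ} (hod : ∀ j < c, σ.arr .od j < D.M)
    (hk : σ.var .k = D.k0) (hT : ∀ j < D.n * D.n, σ.arr .T j = σ.arr .H j) :
    (∀ u < D.n, ∀ v < D.n,
      0 < ((cut c).run σ).arr .T (u * D.n + v) ↔ D.tree c (σ.arr .od) u v) ∧
    (∀ b < D.k0, ((cut c).run σ).arr .P b = σ.arr .P b) ∧
    (∀ j < c, ((cut c).run σ).arr .P (D.k0 + 2 * j) = D.eu (σ.arr .od j) ∧
      ((cut c).run σ).arr .P (D.k0 + 2 * j + 1) = D.ev (σ.arr .od j)) ∧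
    ((cut c).run σ).var .k = D.k0 + 2 * c ∧
    ((cut c).run σ).tm ≤ σ.tm + 4 + c * 200 := by
  have key : _ ∧ ((cut c).run σ).tm ≤ _ ∧ _ :=
    run_loop (fun i τ => (∀ u < D.n, ∀ v < D.n,
        0 < τ.arr .T (u * D.n + v) ↔ D.tree i (σ.arr .od) u v) ∧
      (∀ b < D.k0, τ.arr .P b = σ.arr .P b) ∧
      (∀ j < i, τ.arr .P (D.k0 + 2 * j) = D.eu (σ.arr .od j) ∧
        τ.arr .P (D.k0 + 2 * j + 1) = D.ev (σ.arr .od j)) ∧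
      τ.var .k = D.k0 + 2 * i) c 200
      (by simp) (by
        refine ⟨fun u hu v hv => ?_, by simp, by simp, by simp [hk]⟩
        simp only [St.tick_arr, hT _ (mul_add_lt hu hv), hP.H u hu v hv, Inst.tree]
        simp) (by
        intro i hi τ hF ⟨h1, h2, h3, h4⟩
        have hP' : Prep D τ := hP.frame hF rfl h2
        have hoi := hod i hi
        have hod' : τ.arr .od = σ.arr .od := hF.arr _ rfl
        have e1 : τ.arr .EU (τ.arr .od i) = D.eu (σ.arr .od i) := by
          rw [hod', hP'.EU _ hoi]
        have e2 : τ.arr .EV (τ.arr .od i) = D.ev (σ.arr .od i) := by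
          rw [hod', hP'.EV _ hoi]
        have l1 := hD.eu _ hoi
        have l2 := hD.ev _ hoi
        refine ⟨⟨fun u hu v hv => ?_, fun b hb => ?_, fun j hj => ?_, ?_⟩, ?_⟩
        · have h5 := h1 u hu v hv
          simp only [run_block_cons, run_block_nil, run_asg, run_put, St.tick_arr, St.seta_arr,
            St.setv_arr, St.tick_var, St.setv_var, St.seta_var, eval, reduceCtorEq,
            if_true, if_false, e1, e2, hP'.R _ l1, hP'.R _ l2, false_and, true_and]
          have a1 : u * D.n + v = D.eu (σ.arr .od i) * D.n + D.ev (σ.arr .od i) ↔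
              (D.eu (σ.arr .od i) = u ∧ D.ev (σ.arr .od i) = v) :=
            ⟨fun e => let e' := mul_add_inj hv l2 e; ⟨e'.1.symm, e'.2.symm⟩,
              fun e => by rw [e.1, e.2]⟩
          have a2 : u * D.n + v = D.ev (σ.arr .od i) * D.n + D.eu (σ.arr .od i) ↔
              (D.eu (σ.arr .od i) = v ∧ D.ev (σ.arr .od i) = u) :=
            ⟨fun e => let e' := mul_add_inj hv l1 e; ⟨e'.2.symm, e'.1.symm⟩,
              fun e => by rw [e.1, e.2]⟩
          rw [if_congr a2 rfl rfl, if_congr a1 rfl rfl]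
          have a3 : D.tree (i + 1) (σ.arr .od) u v ↔ D.tree i (σ.arr .od) u v ∧
              ¬ (D.eu (σ.arr .od i) = u ∧ D.ev (σ.arr .od i) = v) ∧
              ¬ (D.eu (σ.arr .od i) = v ∧ D.ev (σ.arr .od i) = u) := by
            simp only [Inst.tree, Nat.forall_lt_succ_right, and_assoc]
          rw [a3, ← h5]
          split_ifs <;> simp_all
        · have b1 : b ≠ D.k0 + 2 * i + 1 := by omega
          have b2 : b ≠ D.k0 + 2 * i := by omega
          simp [h4, b1, b2, h2 b hb]
        · rcases Nat.lt_succ_iff_lt_or_eq.1 hj with hj | rfl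
          · have b1 : D.k0 + 2 * j ≠ D.k0 + 2 * i + 1 := by omega
            have b2 : j ≠ i := by omega
            have b3 : D.k0 + 2 * j + 1 ≠ D.k0 + 2 * i := by omega
            simp [h4, b1, b2, b3, h3 j hj]
          · simp [h4, e1, e2]
        · simp [h4]; ring
        · simp)
  obtain ⟨⟨h1, h2, h3, h4⟩, h5, -⟩ := key
  exact ⟨h1, h2, h3, h4, h5.trans (by simp)⟩

end Visit

namespace Visit
open Cmd Exp

/-! ### The move table -/

theorem isMoveTable_zero {n : ℕ} {P X : ℕ → ℕ} (h : ∀ j < n, X j = 0) : IsMoveTable n 0 P X := by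
  intro j hj
  exact ⟨0, by simp, by simp [h j (by simpa using hj)], by omega⟩

/-- A further checkpoint doubles the number of states: the new bit is set in the second half of the
table and, where the position is the new checkpoint, in the first half as well. -/
theorem isMoveTable_succ {n k : ℕ} {P X X' : ℕ → ℕ} (h : IsMoveTable n k P X)
    (h1 : ∀ j < n * 2 ^ k, X' j = X j + if j % n = P k then n * 2 ^ k else 0)
    (h2 : ∀ j < n * 2 ^ k, X' (n * 2 ^ k + j) = X j + n * 2 ^ k) :
    IsMoveTable n (k + 1) P X' := by
  intro j hj
  have hn : 0 < n := by
    rcases Nat.eq_zero_or_pos n with rfl | h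
    · simp at hj
    · exact h
  have hadd : ∀ B < 2 ^ k, ∀ b < k + 1,
      (2 ^ k + B).testBit b = true ↔ (b = k ∨ (b < k ∧ B.testBit b = true)) := by
    intro B hB b hb
    rcases Nat.lt_succ_iff_lt_or_eq.1 hb with hb | rfl
    · rw [Nat.testBit_two_pow_add_gt hb]
      simp [hb, hb.ne]
    · rw [Nat.testBit_two_pow_add_eq, Nat.testBit_lt_two_pow hB]
      simp
  rw [pow_succ, ← mul_assoc] at hj
  rw [pow_succ]
  rcases Nat.lt_or_ge j (n * 2 ^ k) with hlt | hge
  · obtain ⟨B, hB, e, hb⟩ := h j hlt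
    have hdiv : j / n < 2 ^ k := Nat.div_lt_of_lt_mul hlt
    have hjk : (j / n).testBit k = false := Nat.testBit_lt_two_pow hdiv
    rw [h1 j hlt]
    by_cases hp : j % n = P k
    · refine ⟨2 ^ k + B, by omega, by simp [hp, e]; ring, fun b hbk => ?_⟩
      rw [hadd B hB b hbk]
      rcases Nat.lt_succ_iff_lt_or_eq.1 hbk with hbk | rfl
      · simp [hbk, hbk.ne, hb b hbk]
      · simp [hp]
    · refine ⟨B, by omega, by simp [hp, e], fun b hbk => ?_⟩
      rcases Nat.lt_succ_iff_lt_or_eq.1 hbk with hbk | rfl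
      · exact hb b hbk
      · rw [Nat.testBit_lt_two_pow hB, hjk]
        simp [Ne.symm hp]
  · obtain ⟨j, rfl⟩ := Nat.exists_eq_add_of_le hge
    have hlt : j < n * 2 ^ k := by omega
    obtain ⟨B, hB, e, hb⟩ := h j hlt
    have hdiv : j / n < 2 ^ k := Nat.div_lt_of_lt_mul hlt
    refine ⟨2 ^ k + B, by omega, by rw [h2 j hlt, e]; ring, fun b hbk => ?_⟩
    rw [hadd B hB b hbk, Nat.mul_add_div hn, hadd _ hdiv b hbk, Nat.mul_add_mod]
    rcases Nat.lt_succ_iff_lt_or_eq.1 hbk with hbk | rfl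
    · simp [hbk, hbk.ne, hb b hbk]
    · simp

variable {D : Inst} {σ : St}

theorem extendTable_spec :
    (∀ j < σ.var .len, (extendTable.run σ).arr .X j = σ.arr .X j +
      if σ.arr .vt j = σ.arr .P (σ.var .i) then σ.var .len else 0) ∧
    (∀ j < σ.var .len, (extendTable.run σ).arr .X (σ.var .len + j) = σ.arr .X j + σ.var .len) ∧
    (∀ j < σ.var .len, (extendTable.run σ).arr .vt j = σ.arr .vt j) ∧
    (∀ j < σ.var .len, (extendTable.run σ).arr .vt (σ.var .len + j) = σ.arr .vt j) ∧
    (extendTable.run σ).tm ≤ σ.tm + 4 + σ.var .len * 150 := by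
  have key : _ ∧ (extendTable.run σ).tm ≤ _ ∧ _ :=
    run_loop (fun m τ =>
      (∀ j < σ.var .len, τ.arr .X j = σ.arr .X j +
        if j < m ∧ σ.arr .vt j = σ.arr .P (σ.var .i) then σ.var .len else 0) ∧
      (∀ j < m, τ.arr .X (σ.var .len + j) = σ.arr .X j + σ.var .len) ∧
      (∀ j < σ.var .len, τ.arr .vt j = σ.arr .vt j) ∧
      (∀ j < m, τ.arr .vt (σ.var .len + j) = σ.arr .vt j)) (σ.var .len) 150
      (by simp) (by simp) (by
        intro m hm τ hF ⟨h1, h2, h3, h4⟩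
        have e1 : τ.var .len = σ.var .len := hF.var _ rfl
        have e2 : τ.var .i = σ.var .i := hF.var _ rfl
        have e3 : τ.arr .P = σ.arr .P := hF.arr _ rfl
        have e4 : τ.arr .X m = σ.arr .X m := by simp [h1 m hm]
        have e5 : τ.arr .vt m = σ.arr .vt m := h3 m hm
        have e6 : m ≠ σ.var .len + m := by omega
        have e7 : diff (rd .vt (var .j)) (rd .P (var .i)) =
          (rd .vt (var .j) - rd .P (var .i)) + (rd .P (var .i) - rd .vt (var .j)) := rfl
        simp only [run_block_cons, run_block_nil, run_asg, run_put, run_ifLt, e7]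
        have hcond : (σ.arr .vt m - σ.arr .P (σ.var .i) + (σ.arr .P (σ.var .i) - σ.arr .vt m) < 1) ↔
          σ.arr .vt m = σ.arr .P (σ.var .i) := by omega
        have e8 : ∀ j < σ.var .len, j ≠ σ.var .len + m := fun j hj => by omega
        by_cases hc : σ.arr .vt m = σ.arr .P (σ.var .i)
        · simp [e1, e2, e3, e4, e5, hc]
          refine ⟨?_, ?_, ?_, ?_⟩
          · intro j hj
            by_cases hjm : j = m
            · simp [hjm, hc]
            · have : j ≤ m ↔ j < m := by omega
              simp [hjm, e8 j hj, h1 j hj, this]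
          · intro j hj
            have : σ.var .len + j ≠ m := by omega
            by_cases hjm : j = m
            · simp [this, hjm, e6.symm]
            · simp [this, hjm, h2 j (by omega)]
          · intro j hj; simp [e8 j hj, h3 j hj]
          · intro j hj
            by_cases hjm : j = m
            · simp [hjm, hc]
            · simp [hjm, h4 j (by omega)]
        · have hc' := mt hcond.1 hc
          simp [e1, e2, e3, e4, e5, e6, hc, hc']
          refine ⟨?_, ?_, ?_, ?_⟩
          · intro j hj
            by_cases hjm : j = m
            · simp [hjm, hc, e6, e4]
            · have : j ≤ m ↔ j < m := by omega
              simp [e8 j hj, h1 j hj, this]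
          · intro j hj
            by_cases hjm : j = m
            · simp [hjm]
            · simp [hjm, h2 j (by omega)]
          · intro j hj; simp [e8 j hj, h3 j hj]
          · intro j hj
            by_cases hjm : j = m
            · simp [hjm]
            · simp [hjm, h4 j (by omega)])
  obtain ⟨⟨h1, h2, h3, h4⟩, h5, -⟩ := key
  exact ⟨fun j hj => (h1 j hj).trans (by simp [hj]), h2, h3, h4, h5.trans (by simp)⟩

theorem moveTable_spec {n k : ℕ} (hk : σ.var .k = k) (hn : 0 < n)
    (hlen : σ.var .len = n) (hX : ∀ j < n, σ.arr .X j = 0)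
    (hvt : ∀ j < n, σ.arr .vt j = j) :
    IsMoveTable n k (σ.arr .P) ((moveTable.run σ).arr .X) ∧
    (∀ j < n * 2 ^ k, (moveTable.run σ).arr .vt j = j % n) ∧
    (moveTable.run σ).var .len = n * 2 ^ k ∧
    (moveTable.run σ).tm ≤ σ.tm + 4 + k * (n * 2 ^ k * 200) := by
  have key : _ ∧ (moveTable.run σ).tm ≤ _ ∧ _ :=
    run_loop (fun m τ => IsMoveTable n m (σ.arr .P) (τ.arr .X) ∧
      (∀ j < n * 2 ^ m, τ.arr .vt j = j % n) ∧ τ.var .len = n * 2 ^ m) k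
      (n * 2 ^ k * 200)
      (by simp [hk])
      ⟨isMoveTable_zero (by simpa using hX), by
        intro j hj
        have hj : j < n := by simpa using hj
        simp [hvt j hj, Nat.mod_eq_of_lt hj], by simp [hlen]⟩
      (by
        intro m hm τ hF ⟨h1, h2, h3⟩
        have e3 : τ.arr .P = σ.arr .P := hF.arr _ rfl
        obtain ⟨s1, s2, s3, s4, s5⟩ := extendTable_spec (σ := (τ.setv .i m).tick 3)
        have hl : (extendTable.run ((τ.setv .i m).tick 3)).var .len = n * 2 ^ m := by
          rw [(run_frame extendTable _).var .len rfl]; simp [h3]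
        simp only [St.tick_var, St.setv_var, St.tick_arr, St.setv_arr, reduceCtorEq, if_true,
          if_false, h3, e3, St.tick_tm, St.setv_tm] at s1 s2 s3 s4 s5
        simp only [run_block_cons, run_block_nil, run_asg, St.tick_arr, St.setv_arr, St.tick_var,
          St.setv_var, if_true, St.tick_tm, St.setv_tm, eval_add', eval, hl, cost_add', cost]
        refine ⟨⟨isMoveTable_succ h1 (fun j hj => ?_) s2, fun j hj => ?_, by ring⟩, ?_⟩
        · rw [s1 j hj, h2 j hj]
        · rcases Nat.lt_or_ge j (n * 2 ^ m) with hlt | hge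
          · rw [s3 j hlt, h2 j hlt]
          · obtain ⟨j, rfl⟩ := Nat.exists_eq_add_of_le hge
            have hlt : j < n * 2 ^ m := by rw [pow_succ, ← mul_assoc] at hj; omega
            rw [s4 j hlt, h2 j hlt, mul_comm, Nat.mul_comm, Nat.mul_add_mod]
        · have h5 : n * 2 ^ m ≤ n * 2 ^ k :=
            Nat.mul_le_mul_left _ (Nat.pow_le_pow_right (by omega) (by omega))
          have h6 : 1 ≤ n * 2 ^ k := Nat.mul_pos hn (by positivity)
          omega)
  obtain ⟨⟨h1, h2, h3⟩, h5, -⟩ := key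
  exact ⟨h1, h2, h3, h5.trans (by simp)⟩

theorem baseTable_spec (hP : Prep D σ) :
    (∀ j < D.n, (baseTable.run σ).arr .X j = 0) ∧
    (∀ j < D.n, (baseTable.run σ).arr .vt j = j) ∧
    (baseTable.run σ).tm ≤ σ.tm + 4 + D.n * 40 := by
  have key : _ ∧ (baseTable.run σ).tm ≤ _ ∧ _ :=
    run_loop (fun m τ => (∀ j < m, τ.arr .X j = 0) ∧ (∀ j < m, τ.arr .vt j = j)) D.n 40
      (by simp [hP.n]) (by simp) (by
        intro m hm τ hF ⟨h1, h2⟩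
        refine ⟨⟨fun j hj => ?_, fun j hj => ?_⟩, by simp⟩
        · by_cases hjm : j = m
          · simp [hjm]
          · simp [hjm, h1 j (by omega)]
        · by_cases hjm : j = m
          · simp [hjm]
          · simp [hjm, h2 j (by omega)])
  obtain ⟨⟨h1, h2⟩, h5, -⟩ := key
  exact ⟨h1, h2, h5.trans (by simp)⟩

theorem initTable_spec (hP : Prep D σ) {N : ℕ} (hlen : σ.var .len = N) :
    (∀ j < N, (initTable.run σ).arr .arr j = if j = σ.arr .X D.s + D.s then 0 else D.inf) ∧
    (initTable.run σ).tm ≤ σ.tm + 50 + N * 30 := by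
  have key :=
    run_loop (x := .j) (e := var .len) (c := put .arr (var .j) (var .inf)) (σ := σ)
      (fun m τ => ∀ j < m, τ.arr .arr j = D.inf) N 30
      (by simp [hlen]) (by simp) (by
        intro m hm τ hF h1
        have e1 : τ.var .inf = D.inf := (hF.var _ rfl).trans hP.inf
        refine ⟨fun j hj => ?_, by simp⟩
        by_cases hjm : j = m
        · simp [hjm, e1]
        · simp [hjm, h1 j (by omega)])
  obtain ⟨h1, h2, hF⟩ := key
  have e1 : ((loop .j (var .len) (put .arr (var .j) (var .inf))).run σ).arr .X = σ.arr .X :=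
    hF.arr _ rfl
  have e2 : ((loop .j (var .len) (put .arr (var .j) (var .inf))).run σ).var .s = D.s :=
    (hF.var _ rfl).trans hP.s
  refine ⟨fun j hj => ?_, ?_⟩
  · simp only [initTable, run_block_cons, run_block_nil, run_put, St.tick_arr, St.seta_arr,
      true_and, eval_add', eval, e1, e2, h1 j hj, eval_ofNat']
  · simp only [initTable, run_block_cons, run_block_nil, run_put, St.tick_tm, St.seta_tm,
      cost_add', cost, cost_ofNat'] at h2 ⊢
    omega

end Visit

namespace Visit
open Cmd Exp

/-! ### The table of the earliest arrival dates -/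

/-- The state during the relaxation of the transitions at time `t`, when those from `i` by a move
to `v` are done for all `i`, `v` with `Q i v`. -/
structure PassInv (n N inf t : ℕ) (A : ℕ → ℕ → ℕ → Prop) (T : ℕ → ℕ → Prop) (X : ℕ → ℕ)
    (arr₀ pre₀ : ℕ → ℕ) (Q : ℕ → ℕ → Prop) (arr pre : ℕ → ℕ) : Prop where
  old : ∀ j < N, arr₀ j ≤ t → arr j = arr₀ j ∧ pre j = pre₀ j
  new : ∀ j < N, ¬ arr₀ j ≤ t →
    arr j = inf ∨ (arr j = t + 1 ∧ pre j < N ∧ arr₀ (pre j) ≤ t ∧ Step n A T X t (pre j) j)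
  all : ∀ i < N, ∀ v < n, Q i v → arr₀ i ≤ t → A t (i % n) v →
    (T (i % n) v ∨ X (i - i % n + v) = i - i % n) → arr (X (i - i % n + v) + v) ≤ t + 1

section
variable {n N inf t : ℕ} {A : ℕ → ℕ → ℕ → Prop} {T : ℕ → ℕ → Prop} {X : ℕ → ℕ}
  {arr₀ pre₀ arr pre : ℕ → ℕ} {Q Q' : ℕ → ℕ → Prop}

theorem PassInv.init (h : ∀ j < N, arr₀ j ≤ t ∨ arr₀ j = inf) :
    PassInv n N inf t A T X arr₀ pre₀ (fun _ _ => False) arr₀ pre₀ where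
  old _ _ _ := ⟨rfl, rfl⟩
  new j hj h1 := Or.inl ((h j hj).resolve_left h1)
  all _ _ _ _ h1 := h1.elim

theorem PassInv.isPass (h : PassInv n N inf t A T X arr₀ pre₀ Q arr pre)
    (hQ : ∀ i < N, ∀ v < n, Q i v) : IsPass (Step n A T X) N inf t arr₀ pre₀ arr pre where
  old := h.old
  new := h.new
  all := by
    rintro i hi h1 j hj ⟨v, hv, h2, h3, rfl⟩
    exact h.all i hi v hv (hQ i hi v hv) h1 h2 h3

theorem PassInv.mono (h : PassInv n N inf t A T X arr₀ pre₀ Q arr pre)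
    (hQ : ∀ i < N, ∀ v < n, Q' i v → arr₀ i ≤ t → A t (i % n) v →
      (T (i % n) v ∨ X (i - i % n + v) = i - i % n) → Q i v) :
    PassInv n N inf t A T X arr₀ pre₀ Q' arr pre where
  old := h.old
  new := h.new
  all i hi v hv h1 h2 h3 h4 := h.all i hi v hv (hQ i hi v hv h1 h2 h3 h4) h2 h3 h4

theorem PassInv.update (h : PassInv n N inf t A T X arr₀ pre₀ Q arr pre) {i v : ℕ} (hi : i < N)
    (hi0 : arr₀ i ≤ t) (hv : v < n) (hA : A t (i % n) v)
    (hT : T (i % n) v ∨ X (i - i % n + v) = i - i % n)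
    (hlt : t + 1 < arr (X (i - i % n + v) + v)) :
    PassInv n N inf t A T X arr₀ pre₀ (fun i' v' => Q i' v' ∨ (i' = i ∧ v' = v))
      (fun j => if j = X (i - i % n + v) + v then t + 1 else arr j)
      (fun j => if j = X (i - i % n + v) + v then i else pre j) where
  old j hj h1 := by
    have h2 := h.old j hj h1
    have : j ≠ X (i - i % n + v) + v := by
      rintro rfl
      omega
    simp [this, h2]
  new j hj h1 := by
    by_cases hjd : j = X (i - i % n + v) + v
    · simp only [hjd, if_true]
      exact Or.inr ⟨trivial, hi, hi0, v, hv, hA, hT, rfl⟩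
    · simp only [hjd, if_false]
      exact h.new j hj h1
  all i' hi' v' hv' hQ h1 h2 h3 := by
    by_cases hjd : X (i' - i' % n + v') + v' = X (i - i % n + v) + v
    · simp [hjd]
    · simp only [hjd, if_false]
      rcases hQ with hQ | ⟨rfl, rfl⟩
      · exact h.all i' hi' v' hv' hQ h1 h2 h3
      · exact absurd rfl hjd

theorem PassInv.skip (h : PassInv n N inf t A T X arr₀ pre₀ Q arr pre) {i v : ℕ}
    (hle : arr (X (i - i % n + v) + v) ≤ t + 1) :
    PassInv n N inf t A T X arr₀ pre₀ (fun i' v' => Q i' v' ∨ (i' = i ∧ v' = v)) arr pre where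
  old := h.old
  new := h.new
  all i' hi' v' hv' hQ h1 h2 h3 := by
    rcases hQ with hQ | ⟨rfl, rfl⟩
    · exact h.all i' hi' v' hv' hQ h1 h2 h3
    · exact hle

end

variable {D : Inst} {σ : St}

/-- The transitions read off from the arrays `X` and `T`. -/
structure HasTables (D : Inst) (T : ℕ → ℕ → Prop) (X : ℕ → ℕ) (N : ℕ) (σ : St) : Prop where
  X : ∀ j < N, σ.arr .X j = X j
  vt : ∀ j < N, σ.arr .vt j = j % D.n
  T : ∀ u < D.n, ∀ v < D.n, 0 < σ.arr .T (u * D.n + v) ↔ T u v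
  len : σ.var .len = N

theorem HasTables.frame {T : ℕ → ℕ → Prop} {X : ℕ → ℕ} {N : ℕ} {τ : St} {c : Cmd}
    (h : HasTables D T X N σ) (hF : Frame c σ τ) (h1 : c.moda .X = false)
    (h2 : c.moda .vt = false) (h3 : c.moda .T = false) (h4 : c.modv .len = false) :
    HasTables D T X N τ := by
  constructor
  · rw [hF.arr _ h1]; exact h.X
  · rw [hF.arr _ h2]; exact h.vt
  · rw [hF.arr _ h3]; exact h.T
  · rw [hF.var _ h4, h.len]

section
variable {T : ℕ → ℕ → Prop} {X : ℕ → ℕ} {A : ℕ → ℕ → ℕ → Prop} {arr₀ pre₀ : ℕ → ℕ} {b k t : ℕ}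

/-- The program relaxes the moves from the state `i` to all neighbours of its position. -/
theorem relax_spec (hP : Prep D σ) (hS : HasTables D T X (D.n * 2 ^ k) σ)
    (hb : b < D.q) (hp : σ.var .p = 3 + b * (1 + D.n * D.n))
    (hA : ∀ u < D.n, ∀ v < D.n, A t u v ↔ D.adj b u v) {i : ℕ} (hi : i < D.n * 2 ^ k)
    (hvi : σ.var .i = i) (hvu : σ.var .u = i % D.n) (hvr : σ.var .r = i - i % D.n)
    (htt : σ.var .tt = t + 1) (hi0 : arr₀ i ≤ t)
    (hI : PassInv D.n (D.n * 2 ^ k) D.inf t A T X arr₀ pre₀ (fun i' _ => i' < i)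
      (σ.arr .arr) (σ.arr .pre)) :
    PassInv D.n (D.n * 2 ^ k) D.inf t A T X arr₀ pre₀ (fun i' _ => i' < i + 1)
      ((relax.run σ).arr .arr) ((relax.run σ).arr .pre) ∧
    (relax.run σ).tm ≤ σ.tm + 4 + D.n * 200 := by
  have hn : 0 < D.n := by
    rcases Nat.eq_zero_or_pos D.n with h | h
    · rw [h] at hi; simp at hi
    · exact h
  have key : _ ∧ (relax.run σ).tm ≤ _ ∧ _ :=
    run_loop (fun m τ => PassInv D.n (D.n * 2 ^ k) D.inf t A T X arr₀ pre₀
      (fun i' v' => i' < i ∨ (i' = i ∧ v' < m)) (τ.arr .arr) (τ.arr .pre)) D.n 200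
      (by simp [hP.n])
      (hI.mono fun i' _ v _ h _ _ _ => by omega) (by
        intro v hv τ hF h1
        have hP' : Prep D τ := hP.frame' hF rfl rfl
        have hS' := hS.frame hF rfl rfl rfl rfl
        have hmod : i % D.n < D.n := Nat.mod_lt _ hn
        have e1 : τ.var .p = 3 + b * (1 + D.n * D.n) := (hF.var _ rfl).trans hp
        have e2 : τ.var .i = i := (hF.var _ rfl).trans hvi
        have e3 : τ.var .u = i % D.n := (hF.var _ rfl).trans hvu
        have e4 : τ.var .r = i - i % D.n := (hF.var _ rfl).trans hvr
        have e5 : τ.var .tt = t + 1 := (hF.var _ rfl).trans htt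
        have e6 : τ.arr .X (i - i % D.n + v) = X (i - i % D.n + v) :=
          hS'.X _ (index_lt hi hv)
        have e7 : diff (var .nx) (var .r) = (var .nx - var .r) + (var .r - var .nx) := rfl
        -- which moves to `v` have to be considered when the conditions hold
        have hext : ∀ {arr pre : ℕ → ℕ},
            PassInv D.n (D.n * 2 ^ k) D.inf t A T X arr₀ pre₀
              (fun i' v' => (i' < i ∨ (i' = i ∧ v' < v)) ∨ (i' = i ∧ v' = v)) arr pre →
            PassInv D.n (D.n * 2 ^ k) D.inf t A T X arr₀ pre₀
              (fun i' v' => i' < i ∨ (i' = i ∧ v' < v + 1)) arr pre :=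
          fun h => h.mono fun i' _ v' _ h _ _ _ => by omega
        have hadj := hP'.adj b hb _ hmod v hv
        have hTuv := hS'.T _ hmod v hv
        rw [← hA _ hmod v hv] at hadj
        rw [run_ifLt]
        simp only [eval, eval_add', eval_ofNat', St.tick_var, St.setv_var, reduceCtorEq, if_true,
          if_false, St.tick_arr, St.setv_arr, e1, e3, hP'.R _ hmod]
        split_ifs with c1
        · simp only [run_block_cons, run_block_nil, run_asg]
          rw [run_ifLt]
          simp only [eval, eval_add', eval_sub', eval_ofNat', St.tick_var, St.setv_var, reduceCtorEq,
            if_true, if_false, St.tick_arr, St.setv_arr, e3, e4, e6, e7, hP'.R _ hmod]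
          have hc2 : 0 < τ.arr .T (i % D.n * D.n + v) + (1 - (X (i - i % D.n + v) - (i - i % D.n) +
              (i - i % D.n - X (i - i % D.n + v)))) ↔
              (T (i % D.n) v ∨ X (i - i % D.n + v) = i - i % D.n) := by
            rw [← hTuv]
            omega
          split_ifs with c2
          · rw [run_ifLt]
            simp only [eval, eval_add', eval_sub', eval_ofNat', St.tick_var, St.setv_var,
              reduceCtorEq, if_true, if_false, St.tick_arr, St.setv_arr, e5]
            split_ifs with c3
            · refine ⟨hext ?_, by simp⟩
              convert h1.update hi hi0 hv (hadj.1 c1) (hc2.1 c2) c3 using 1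
              · funext j; simp [e5]
              · funext j; simp [e2]
            · refine ⟨hext ?_, by simp⟩
              exact h1.skip (by omega)
          · refine ⟨h1.mono ?_, by simp⟩
            intro i' _ v' _ h _ _ h4
            by_cases h5 : i' = i ∧ v' = v
            · rw [h5.1, h5.2] at h4
              exact absurd (hc2.2 h4) c2
            · omega
        · refine ⟨h1.mono ?_, by simp⟩
          intro i' _ v' _ h _ h3 _
          by_cases h5 : i' = i ∧ v' = v
          · rw [h5.1, h5.2] at h3
            exact absurd (hadj.2 h3) c1
          · omega)
  obtain ⟨h1, h2, -⟩ := key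
  exact ⟨h1.mono fun i' _ v' hv' h _ _ _ => by omega, h2.trans (by simp)⟩

theorem pass_spec (hP : Prep D σ) (hS : HasTables D T X (D.n * 2 ^ k) σ)
    (hb : b < D.q) (hp : σ.var .p = 3 + b * (1 + D.n * D.n))
    (hA : ∀ u < D.n, ∀ v < D.n, A t u v ↔ D.adj b u v) (htt : σ.var .tt = t + 1)
    (hinf : t + 1 < D.inf) (h0 : ∀ j < D.n * 2 ^ k, σ.arr .arr j ≤ t ∨ σ.arr .arr j = D.inf) :
    IsPass (Step D.n A T X) (D.n * 2 ^ k) D.inf t (σ.arr .arr) (σ.arr .pre)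
      ((pass.run σ).arr .arr) ((pass.run σ).arr .pre) ∧
    (pass.run σ).tm ≤ σ.tm + 4 + D.n * 2 ^ k * (D.n * 200 + 100) := by
  have key : _ ∧ (pass.run σ).tm ≤ _ ∧ _ :=
    run_loop (fun m τ => PassInv D.n (D.n * 2 ^ k) D.inf t A T X (σ.arr .arr) (σ.arr .pre)
      (fun i' _ => i' < m) (τ.arr .arr) (τ.arr .pre)) (D.n * 2 ^ k) (D.n * 200 + 100)
      (by simp [hS.len])
      ((PassInv.init h0).mono fun i' _ v _ h _ _ _ => by omega) (by
        intro i hi τ hF h1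
        have hP' : Prep D τ := hP.frame' hF rfl rfl
        have hS' := hS.frame hF rfl rfl rfl rfl
        have e5 : τ.var .tt = t + 1 := (hF.var _ rfl).trans htt
        have e1 : τ.var .p = 3 + b * (1 + D.n * D.n) := (hF.var _ rfl).trans hp
        have hc : τ.arr .arr i < t + 1 ↔ σ.arr .arr i ≤ t := by
          by_cases h2 : σ.arr .arr i ≤ t
          · rw [(h1.old i hi h2).1]; omega
          · rcases h1.new i hi h2 with h3 | h3 <;> simp only [h2, iff_false] <;> omega
        rw [run_ifLt]
        simp only [eval, St.tick_var, St.setv_var, reduceCtorEq, if_true, if_false, St.tick_arr,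
          St.setv_arr, e5]
        split_ifs with c1
        · simp only [run_block_cons, run_block_nil, run_asg]
          obtain ⟨r1, r2⟩ := relax_spec (D := D) (T := T) (X := X) (A := A)
            (arr₀ := σ.arr .arr) (pre₀ := σ.arr .pre) (b := b) (k := k) (t := t) (i := i)
            (σ := ((((((τ.setv .i i).tick 3).tick ((rd Arr.arr (var .i)).cost + (var .tt).cost + 1)
              ).setv .u (i % D.n)).tick ((rd Arr.vt (var .i)).cost + 1)).setv .r
                (i - i % D.n)).tick ((var .i - var .u).cost + 1))
            (by constructor <;> simp [hP'.n, hP'.s, hP'.q, hP'.nn, hP'.M, hP'.k0, hP'.inf]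
                · exact hP'.R
                · exact hP'.dur
                · exact hP'.adj
                · exact hP'.H
                · exact hP'.EU
                · exact hP'.EV
                · exact hP'.P)
            (by constructor <;> simp [hS'.len]
                · exact hS'.X
                · exact hS'.vt
                · exact hS'.T)
            hb (by simp [e1]) hA hi (by simp) (by simp) (by simp) (by simp [e5]) (hc.1 c1)
            (by simpa using h1)
          have e6 : τ.arr .vt i = i % D.n := hS'.vt i hi
          simp only [eval, eval_sub', St.tick_var, St.setv_var, reduceCtorEq, if_true, if_false,
            St.tick_arr, St.setv_arr, e6]
          refine ⟨r1, ?_⟩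
          simp only [St.tick_tm, St.setv_tm, cost, cost_sub'] at r2 ⊢
          omega
        · refine ⟨h1.mono ?_, by simp; omega⟩
          intro i' _ v' _ h h2 _ _
          by_cases h5 : i' = i
          · rw [h5] at h2
            exact absurd (hc.2 h2) c1
          · omega)
  obtain ⟨h1, h2, -⟩ := key
  exact ⟨h1.isPass fun i hi v _ => hi, h2.trans (by simp)⟩

/-- The scan of all static graphs computes the table for the total duration. Of each static graph only
`min d N` time steps are processed, by `IsTable.static`. -/
theorem scan_spec (hP : Prep D σ) (hD : D.WF) (hX : IsMoveTable D.n k (σ.arr .P) X)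
    (hS : HasTables D T X (D.n * 2 ^ k) σ) (hp : σ.var .p = 3) (ht : σ.var .t = 0)
    (hA : ∀ b < D.q, ∀ t < D.dur b, ∀ u < D.n, ∀ v < D.n,
      A ((∑ x ∈ Finset.range b, D.dur x) + t) u v ↔ D.adj b u v)
    (hinf : ∑ x ∈ Finset.range D.q, D.dur x < D.inf)
    (h0 : IsTable (Step D.n A T X) (X D.s + D.s) (D.n * 2 ^ k) D.inf 0 (σ.arr .arr) (σ.arr .pre)) :
    IsTable (Step D.n A T X) (X D.s + D.s) (D.n * 2 ^ k) D.inf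
      (∑ x ∈ Finset.range D.q, D.dur x) ((scan.run σ).arr .arr) ((scan.run σ).arr .pre) ∧
    (scan.run σ).tm ≤ σ.tm + 4 + ∑ x ∈ Finset.range D.q,
      (200 + min (D.dur x) (D.n * 2 ^ k) * (D.n * 2 ^ k * (D.n * 200 + 100) + 100)) := by
  have ha : X D.s + D.s < D.n * 2 ^ k :=
    hX.next_lt (lt_of_lt_of_le hD.s (Nat.le_mul_of_pos_right _ (by positivity))) hD.s
  have hcl : ∀ t i j, i < D.n * 2 ^ k → Step D.n A T X t i j → j < D.n * 2 ^ k :=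
    fun t i j hi h => h.lt hX hi
  have key : _ ∧ (scan.run σ).tm ≤ _ ∧ _ :=
    run_loop (fun m τ => IsTable (Step D.n A T X) (X D.s + D.s) (D.n * 2 ^ k) D.inf
        (∑ x ∈ Finset.range m, D.dur x) (τ.arr .arr) (τ.arr .pre) ∧
      τ.var .p = 3 + m * (1 + D.n * D.n) ∧ τ.var .t = ∑ x ∈ Finset.range m, D.dur x ∧
      τ.tm ≤ σ.tm + 4 + ∑ x ∈ Finset.range m,
        (200 + min (D.dur x) (D.n * 2 ^ k) * (D.n * 2 ^ k * (D.n * 200 + 100) + 100))) D.q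
      (200 + (D.n * 2 ^ k) * (D.n * 2 ^ k * (D.n * 200 + 100) + 100))
      (by simp [hP.q]) ⟨by simpa using h0, by simp [hp], by simp [ht], by simp⟩ (by
        intro b hb τ hF ⟨h1, h2, h3, h4⟩
        have hP' : Prep D τ := hP.frame' hF rfl rfl
        have hS' := hS.frame hF rfl rfl rfl rfl
        set t₀ := ∑ x ∈ Finset.range b, D.dur x with ht₀
        have hsum : ∑ x ∈ Finset.range (b + 1), D.dur x = t₀ + D.dur b := Finset.sum_range_succ _ _
        have hle : t₀ + D.dur b ≤ ∑ x ∈ Finset.range D.q, D.dur x := by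
          rw [← hsum]
          exact Finset.sum_le_sum_of_subset (Finset.range_mono (by omega))
        -- the state in which the loop over the time steps starts
        let τ' : St := (ifLt (var .len) (var .cnt) (asg .cnt (var .len)) skip).run
          ((asg .cnt (rd .I (var .p))).run ((τ.setv .b b).tick 3))
        have hF' : Frame (block [asg .b 0, asg .cnt (rd .I (var .p)),
            ifLt (var .len) (var .cnt) (asg .cnt (var .len)) skip]) τ τ' := by
          refine Frame.trans (τ := (τ.setv .b b).tick 3) ⟨fun y hy => ?_, fun _ _ => rfl,
            fun _ => rfl⟩ (Frame.trans (τ := (asg .cnt (rd .I (var .p))).run ((τ.setv .b b).tick 3))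
              ⟨fun y hy => ?_, fun _ _ => rfl, fun _ => rfl⟩ ⟨fun y hy => ?_, fun y hy => ?_,
                fun _ => ?_⟩)
          · have : y ≠ .b := by rintro rfl; simp [modv, block] at hy
            simp [this]
          · have : y ≠ .cnt := by rintro rfl; simp [modv, block] at hy
            simp [this]
          · have : y ≠ .cnt := by rintro rfl; simp [modv, block] at hy
            exact (run_frame (ifLt (var .len) (var .cnt) (asg .cnt (var .len)) skip) _).var y
              (by simp [modv, this])
          · exact (run_frame (ifLt (var .len) (var .cnt) (asg .cnt (var .len)) skip) _).arr y rfl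
          · exact (run_frame (ifLt (var .len) (var .cnt) (asg .cnt (var .len)) skip) _).out rfl
        have hcnt : τ'.var .cnt = min (D.dur b) (D.n * 2 ^ k) := by
          simp only [τ']
          rw [run_ifLt]
          simp only [eval, St.tick_var, St.setv_var, reduceCtorEq, if_true, if_false, St.tick_arr,
            St.setv_arr, run_asg, h2, hS'.len, hP'.dur b hb]
          split_ifs with c
          · simp [hS'.len]; omega
          · simp; omega
        have htm' : τ'.tm ≤ τ.tm + 60 := by
          simp only [τ']
          rw [run_ifLt]
          split_ifs <;> simp
        have hP'' : Prep D τ' := hP'.frame' hF' rfl rfl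
        have hS'' := hS'.frame hF' rfl rfl rfl rfl
        have p1 : τ'.var .p = 3 + b * (1 + D.n * D.n) := (hF'.var _ rfl).trans h2
        have p2 : τ'.var .t = t₀ := (hF'.var _ rfl).trans h3
        have hin := run_loop (x := .j) (e := var .cnt) (σ := τ')
          (c := block [asg .tt (var .t + var .j + 1), pass])
          (fun m υ => IsTable (Step D.n A T X) (X D.s + D.s) (D.n * 2 ^ k) D.inf
            (t₀ + m) (υ.arr .arr) (υ.arr .pre)) (min (D.dur b) (D.n * 2 ^ k))
          (D.n * 2 ^ k * (D.n * 200 + 100) + 100)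
          (by simp [hcnt])
          (by simp only [St.tick_arr, hF'.arr .arr rfl, hF'.arr .pre rfl, add_zero]; exact h1)
          (by
            intro m hm υ hG hI
            have hmd : m < D.dur b := by omega
            have hQ := run_frame (asg .tt (var .t + var .j + 1)) ((υ.setv .j m).tick 3)
            have hQ' : Frame (block [asg .j 0, asg .tt 0]) υ
                ((asg .tt (var .t + var .j + 1)).run ((υ.setv .j m).tick 3)) := by
              refine ⟨fun y hy => ?_, fun _ _ => rfl, fun _ => rfl⟩
              have a1 : y ≠ .j := by rintro rfl; simp [modv, block] at hy
              have a2 : y ≠ .tt := by rintro rfl; simp [modv, block] at hy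
              simp [a1, a2]
            have g1 : υ.var .t = t₀ := (hG.var _ rfl).trans p2
            have g2 : υ.var .p = 3 + b * (1 + D.n * D.n) := (hG.var _ rfl).trans p1
            obtain ⟨r1, r2⟩ := pass_spec (A := A) (t := t₀ + m)
              ((hP''.frame' hG rfl rfl).frame' hQ' rfl rfl)
              ((hS''.frame hG rfl rfl rfl rfl).frame hQ' rfl rfl rfl rfl) hb
              ((hQ'.var _ rfl).trans g2) (hA b hb m hmd) (by simp [g1]) (by omega)
              (by rw [hQ'.arr _ rfl]; exact hI.or_inf)
            rw [hQ'.arr .arr rfl, hQ'.arr .pre rfl] at r1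
            refine ⟨hI.succ r1 (by omega) ha hcl, ?_⟩
            simp only [run_block_cons, run_block_nil, St.tick_tm]
            refine (Nat.add_le_add_right r2 1).trans ?_
            simp
            omega)
        obtain ⟨i1, i2, i3⟩ := hin
        set υ := (loop .j (var .cnt) (block [asg .tt (var .t + var .j + 1), pass])).run τ' with hυ
        have e1 : υ.var .p = 3 + b * (1 + D.n * D.n) := (i3.var _ rfl).trans p1
        have e2 : υ.var .t = t₀ := (i3.var _ rfl).trans p2
        have e3 : υ.arr .I = τ.arr .I := (i3.arr _ rfl).trans (hF'.arr _ rfl)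
        have e4 : υ.var .nn = D.n * D.n := (i3.var _ rfl).trans hP''.nn
        have htm : υ.tm ≤ τ.tm + 100 + min (D.dur b) (D.n * 2 ^ k) *
            (D.n * 2 ^ k * (D.n * 200 + 100) + 100) := by
          simp only [cost] at i2
          omega
        have hrun : (block [
            asg .cnt (rd .I (var .p)),
            ifLt (var .len) (var .cnt) (asg .cnt (var .len)) skip,
            loop .j (var .cnt) (block [asg .tt (var .t + var .j + 1), pass]),
            asg .t (var .t + rd .I (var .p)),
            asg .p (var .p + 1 + var .nn)]).run ((τ.setv .b b).tick 3) =
          (block [asg .t (var .t + rd .I (var .p)), asg .p (var .p + 1 + var .nn)]).run υ := rfl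
        rw [hrun]
        have hfin : ((block [asg .t (var .t + rd .I (var .p)),
            asg .p (var .p + 1 + var .nn)]).run υ).tm ≤ υ.tm + 60 := by simp
        refine ⟨⟨?_, ?_, ?_, ?_⟩, ?_⟩
        · rw [hsum]
          refine IsTable.static i1 (by omega) ha hcl fun t htd => ?_
          funext i j
          have hn : 0 < D.n := lt_of_le_of_lt (Nat.zero_le _) hD.s
          have hm := Nat.mod_lt i hn
          have hz : 0 < D.dur b := by omega
          have hA0 := hA b hb 0 hz
          rw [add_zero] at hA0
          refine propext (exists_congr fun v => and_congr_right fun hv => ?_)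
          rw [hA b hb t htd _ hm v hv, hA0 _ hm v hv]
        · simp [e1, e4]; ring
        · simp [e1, e2, e3, hP'.dur b hb, hsum]
        · rw [Finset.sum_range_succ]
          omega
        · have : min (D.dur b) (D.n * 2 ^ k) * (D.n * 2 ^ k * (D.n * 200 + 100) + 100) ≤
              (D.n * 2 ^ k) * (D.n * 2 ^ k * (D.n * 200 + 100) + 100) :=
            Nat.mul_le_mul_right _ (min_le_right _ _)
          omega)
  exact ⟨key.1.1, key.1.2.2.2⟩

end

end Visit

namespace Visit
open Cmd Exp TVG

/-! ### Reading off the journeys -/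

variable {D : Inst} {σ : St}

/-- The pairs recorded in the first `l` cells of two arrays. -/
def record (f g : ℕ → ℕ) (l : ℕ) : List (ℕ × ℕ) := (List.range l).map fun i => (f i, g i)

theorem record_congr {f g f' g' : ℕ → ℕ} {l : ℕ} (h : ∀ i < l, f' i = f i ∧ g' i = g i) :
    record f' g' l = record f g l := by
  refine List.map_congr_left fun i hi => ?_
  rw [(h i (List.mem_range.1 hi)).1, (h i (List.mem_range.1 hi)).2]

theorem record_succ {f g : ℕ → ℕ} {l : ℕ} :
    record f g (l + 1) = record f g l ++ [(f l, g l)] := by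
  simp [record, List.range_succ]

/-- A journey as a list of pairs of numbers, backwards. -/
def reversed {n : ℕ} (J : List (Fin n × ℕ)) : List (ℕ × ℕ) :=
  (J.map fun x => ((x.1 : ℕ), x.2)).reverse

section
variable {N t : ℕ} {s : Fin D.n}

/-- The array `vis` marks the vertices visited by `J`, in addition to those marked in `vis₀`. -/
def Marks {n : ℕ} (vis₀ vis : ℕ → ℕ) (J : List (Fin n × ℕ)) : Prop :=
  ∀ v : Fin n, 0 < vis v ↔ 0 < vis₀ v ∨ ∃ τ : ℕ, (v, τ) ∈ J

/-- Following the table back records the journey backwards. The loop runs for `N` rounds, which is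
enough, and idles once it has arrived at the start. -/
theorem trace_spec {T : ℕ → ℕ → Prop} {X : ℕ → ℕ} (hS : HasTables D T X N σ)
    (hpre : ∀ j < N, 0 < σ.arr .arr j → σ.arr .arr j ≤ t →
      σ.arr .pre j < N ∧ σ.arr .arr (σ.arr .pre j) ≤ t)
    {e : ℕ} (he : e < N) (het : σ.arr .arr e ≤ t) {J : List (Fin D.n × ℕ)}
    (hJ : Walk D.n (σ.arr .arr) (σ.arr .pre) e J) (hlen : J.length ≤ N)
    (hcur : σ.var .cur = e) (hl : σ.var .l = 0) :
    (trace.run σ).var .l = J.length ∧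
    record ((trace.run σ).arr .WV) ((trace.run σ).arr .WT) J.length = reversed J ∧
    Marks (σ.arr .vis) ((trace.run σ).arr .vis) J ∧
    (trace.run σ).tm ≤ σ.tm + 4 + N * 150 := by
  have key : _ ∧ (trace.run σ).tm ≤ _ ∧ _ :=
    run_loop (fun m τ => ∃ J1 J2, J = J1 ++ J2 ∧
        Walk D.n (σ.arr .arr) (σ.arr .pre) (τ.var .cur) J1 ∧ τ.var .cur < N ∧
        σ.arr .arr (τ.var .cur) ≤ t ∧ τ.var .l = J2.length ∧ (J1 = [] ∨ J2.length = m) ∧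
        record (τ.arr .WV) (τ.arr .WT) J2.length = reversed J2 ∧
        Marks (σ.arr .vis) (τ.arr .vis) J2) N 150
      (by simp [hS.len])
      ⟨J, [], by simp, by simpa [hcur] using hJ, by simpa [hcur] using he,
        by simpa [hcur] using het, by simp [hl], Or.inr rfl, rfl, by simp [Marks]⟩ (by
        rintro m hm τ hF ⟨J1, J2, h1, h2, h3, h4, h5, h6, h7, h8⟩
        have hS' := hS.frame hF rfl rfl rfl rfl
        have e1 : τ.arr .arr = σ.arr .arr := hF.arr _ rfl
        have e2 : τ.arr .pre = σ.arr .pre := hF.arr _ rfl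
        rw [run_ifLt]
        simp only [eval, St.tick_var, St.setv_var, reduceCtorEq, if_true, if_false, St.tick_arr,
          St.setv_arr, e1]
        split_ifs with c
        · cases h2 with
          | start h0 => exact absurd h0 c.ne'
          | @step _ v J1 h0 hv hw =>
            have ev : τ.arr .vt (τ.var .cur) = v := (hS'.vt _ h3).trans hv
            obtain ⟨p1, p2⟩ := hpre _ h3 c h4
            refine ⟨⟨J1, (v, σ.arr .arr (τ.var .cur) - 1) :: J2, by simp [h1], ?_, ?_, ?_, ?_, ?_,
              ?_, ?_⟩, by simp⟩
            · simpa [e2] using hw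
            · simpa [e2] using p1
            · simpa [e2] using p2
            · simp [h5]
            · have : J2.length = m := by
                rcases h6 with h6 | h6
                · simp at h6
                · exact h6
              exact Or.inr (by simp [this])
            · rw [List.length_cons, record_succ]
              rw [record_congr (f := τ.arr .WV) (g := τ.arr .WT), h7]
              · simp [reversed, h5, ev, e1]
              · intro i hi
                have : i ≠ J2.length := by omega
                simp [h5, this]
            · intro w
              simp only [Marks] at h8
              simp only [run_block_cons, run_block_nil, run_asg, run_put, St.tick_arr, St.seta_arr,
                St.setv_arr, St.tick_var, St.setv_var, St.seta_var, eval, reduceCtorEq, if_true,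
                if_false, ev, false_and, true_and, eval_ofNat', Fin.val_inj]
              by_cases hwv : w = v
              · simp [hwv]
              · simp [hwv, h8 w]
        · refine ⟨⟨J1, J2, h1, by simpa using h2, by simpa using h3, by simpa using h4,
            by simpa using h5, ?_, by simpa using h7, by simpa using h8⟩, by simp⟩
          cases h2 with
          | start h0 => exact Or.inl rfl
          | step h0 hv hw => exact absurd h0 c)
  obtain ⟨⟨J1, J2, h1, h2, h3, h4, h5, h6, h7, h8⟩, h9, -⟩ := key
  have hJ1 : J1 = [] := by
    rcases h6 with h6 | h6
    · exact h6
    · rw [h1, List.length_append] at hlen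
      exact List.length_eq_zero_iff.1 (by omega)
  subst hJ1
  rw [List.nil_append] at h1
  subst h1
  exact ⟨h5, h7, h8, h9.trans (by simp)⟩

theorem tryState_spec (hP : Prep D σ) (hs : (s : ℕ) = D.s) {T : ℕ → ℕ → Prop} {X : ℕ → ℕ}
    (hS : HasTables D T X N σ)
    (hpre : ∀ j < N, 0 < σ.arr .arr j → σ.arr .arr j ≤ t →
      σ.arr .pre j < N ∧ σ.arr .arr (σ.arr .pre j) ≤ t)
    (he : σ.var .e < N) (het : σ.arr .arr (σ.var .e) ≤ t) {J : List (Fin D.n × ℕ)}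
    (hJ : Walk D.n (σ.arr .arr) (σ.arr .pre) (σ.var .e) J) (hlen : J.length ≤ N) :
    (tryState.run σ).var .l = J.length ∧
    record ((tryState.run σ).arr .WV) ((tryState.run σ).arr .WT) J.length = reversed J ∧
    (0 < (tryState.run σ).var .ok ↔ ∀ v, v ∈ visited s J) ∧
    (tryState.run σ).tm ≤ σ.tm + 100 + N * 150 + D.n * 100 := by
  obtain ⟨a1, a2, a3⟩ := run_loop (x := .v) (e := var .n) (c := put .vis (var .v) 0) (σ := σ)
    (fun m τ => ∀ v < m, τ.arr .vis v = 0) D.n 50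
    (by simp [hP.n]) (by simp) (by
      intro m hm τ hF h1
      refine ⟨fun j hj => ?_, by simp⟩
      by_cases hjm : j = m
      · simp [hjm]
      · simp [hjm, h1 j (by omega)])
  set σ1 := (loop .v (var .n) (put .vis (var .v) 0)).run σ with hσ1
  have f1 := a3
  set σ2 := (seq (put .vis (var .s) 1) (seq (asg .l 0) (asg .cur (var .e)))).run σ1 with hσ2
  have f2 : Frame (seq (put .vis (var .s) 1) (seq (asg .l 0) (asg .cur (var .e)))) σ1 σ2 :=
    run_frame _ σ1
  have e0 : σ1.var .e = σ.var .e := f1.var _ rfl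
  have e1 : σ2.arr .arr = σ.arr .arr := (f2.arr _ rfl).trans (f1.arr _ rfl)
  have e2 : σ2.arr .pre = σ.arr .pre := (f2.arr _ rfl).trans (f1.arr _ rfl)
  have e3 : σ2.var .cur = σ.var .e := by simp [hσ2, e0]
  have hS2 := (hS.frame f1 rfl rfl rfl rfl).frame f2 rfl rfl rfl rfl
  have hvis : ∀ v : Fin D.n, 0 < σ2.arr .vis v ↔ v = s := by
    intro v
    have e4 : σ1.var .s = D.s := (f1.var _ rfl).trans hP.s
    simp only [hσ2, run_seq, run_asg, run_put, St.tick_arr, St.seta_arr,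
      St.setv_arr, true_and, eval, e4, a1 v v.2, ← hs, Fin.val_inj, eval_ofNat']
    split_ifs with h <;> simp [h]
  obtain ⟨b1, b2, b3, b4⟩ := trace_spec (σ := σ2) (t := t) hS2 (by rw [e1, e2]; exact hpre) he
    (by rw [e1]; exact het) (by rw [e1, e2]; exact hJ) hlen e3 (by simp [hσ2])
  set σ3 := trace.run σ2 with hσ3
  have f3 : Frame trace σ2 σ3 := run_frame trace σ2
  have e5 : σ3.var .n = D.n := by rw [f3.var _ rfl, f2.var _ rfl, f1.var _ rfl, hP.n]
  set σ4 := (asg .ok 1).run σ3 with hσ4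
  obtain ⟨c1, c2, c3⟩ := run_loop (x := .v) (e := var .n)
    (c := ifLt (rd .vis (var .v)) 1 (asg .ok 0) skip) (σ := σ4)
    (fun m τ => 0 < τ.var .ok ↔ ∀ v < m, 0 < σ3.arr .vis v) D.n 50
    (by simp [hσ4, e5]) (by simp [hσ4]) (by
      intro m hm τ hF h1
      have g : τ.arr .vis = σ3.arr .vis := hF.arr _ rfl
      rw [run_ifLt]
      simp only [eval, St.tick_var, St.setv_var, reduceCtorEq, if_true, if_false, St.tick_arr,
        St.setv_arr, g, eval_ofNat', Nat.forall_lt_succ_right]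
      split_ifs with c
      · refine ⟨?_, by simp⟩
        simp
        omega
      · refine ⟨?_, by simp⟩
        simp [h1]
        omega)
  have hfin : tryState.run σ =
      ((loop .v (var .n) (ifLt (rd .vis (var .v)) 1 (asg .ok 0) skip)).run σ4).tick 1 := by
    simp only [tryState, run_block_cons, run_block_nil, hσ4, hσ3, hσ2, hσ1, run_seq]
  set σ5 := (loop .v (var .n) (ifLt (rd .vis (var .v)) 1 (asg .ok 0) skip)).run σ4 with hσ5
  have t2 : σ2.tm ≤ σ1.tm + 30 := by simp [hσ2]
  have t4 : σ4.tm = σ3.tm + 2 := rfl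
  simp only [cost] at a2 c2
  have w1 : σ5.arr .WV = σ3.arr .WV := c3.arr _ rfl
  have w2 : σ5.arr .WT = σ3.arr .WT := c3.arr _ rfl
  have w3 : σ5.var .l = σ3.var .l := by rw [c3.var _ rfl]; simp [hσ4]
  rw [hfin]
  refine ⟨by simp [w3, b1], by simp [w1, w2, b2], ?_, by simp; omega⟩
  rw [St.tick_var, c1]
  constructor
  · intro h v
    rcases (b3 v).1 (h v v.2) with h1 | h1
    · exact Or.inl ((hvis v).1 h1)
    · exact Or.inr h1
  · intro h v hv
    refine (b3 ⟨v, hv⟩).2 ?_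
    rcases h ⟨v, hv⟩ with h1 | h1
    · exact Or.inl ((hvis _).2 h1)
    · exact Or.inr h1

theorem save_spec :
    (save.run σ).var .best = σ.arr .arr (σ.var .e) ∧ (save.run σ).var .blen = σ.var .l ∧
    record ((save.run σ).arr .BV) ((save.run σ).arr .BT) (σ.var .l) =
      record (σ.arr .WV) (σ.arr .WT) (σ.var .l) ∧
    (save.run σ).tm ≤ σ.tm + 50 + σ.var .l * 60 := by
  set σ1 := (seq (asg .best (rd .arr (var .e))) (asg .blen (var .l))).run σ with hσ1
  obtain ⟨a1, a2, a3⟩ := run_loop (x := .i) (e := var .l) (σ := σ1)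
    (c := block [put .BV (var .i) (rd .WV (var .i)), put .BT (var .i) (rd .WT (var .i))])
    (fun m τ => ∀ i < m, τ.arr .BV i = σ.arr .WV i ∧ τ.arr .BT i = σ.arr .WT i) (σ.var .l) 60
    (by simp [hσ1]) (by simp) (by
      intro m hm τ hF h1
      have g1 : τ.arr .WV = σ.arr .WV := by rw [hF.arr _ rfl]; simp [hσ1]
      have g2 : τ.arr .WT = σ.arr .WT := by rw [hF.arr _ rfl]; simp [hσ1]
      refine ⟨fun j hj => ?_, by simp⟩
      by_cases hjm : j = m
      · simp [hjm, g1, g2]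
      · simp [hjm, h1 j (by omega)])
  set σ2 := (loop .i (var .l) (block [put .BV (var .i) (rd .WV (var .i)),
    put .BT (var .i) (rd .WT (var .i))])).run σ1 with hσ2
  have hfin : save.run σ = σ2.tick 1 := by
    simp only [save, run_block_cons, run_block_nil, hσ2, hσ1, run_seq]
  have e1 : σ2.var .best = σ1.var .best := a3.var _ rfl
  have e2 : σ2.var .blen = σ1.var .blen := a3.var _ rfl
  rw [hfin]
  refine ⟨by simp [e1, hσ1], by simp [e2, hσ1], record_congr a1, ?_⟩
  have : σ1.tm ≤ σ.tm + 20 := by simp [hσ1]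
  simp only [cost, St.tick_tm] at a2 ⊢
  omega

end

/-- The best solution found so far, if there is one, is stored backwards in `BV` and `BT`; it
consists of at most `ℓ` steps. -/
structure Best (D : Inst) (𝒢 : TVG (Fin D.n)) (s : Fin D.n) (ℓ : ℕ) (σ : St) : Prop where
  le : σ.var .best ≤ D.inf
  sol : σ.var .best < D.inf → ∃ J, 𝒢.IsSolution s J ∧ arrival 0 J = σ.var .best ∧
    σ.var .blen = J.length ∧ record (σ.arr .BV) (σ.arr .BT) J.length = reversed J ∧
    J.length ≤ ℓ

theorem Best.congr {𝒢 : TVG (Fin D.n)} {s : Fin D.n} {ℓ : ℕ} {τ : St} (h : Best D 𝒢 s ℓ σ)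
    (h1 : τ.var .best = σ.var .best) (h2 : τ.var .blen = σ.var .blen)
    (h3 : τ.arr .BV = σ.arr .BV) (h4 : τ.arr .BT = σ.arr .BT) : Best D 𝒢 s ℓ τ := by
  constructor
  · rw [h1]; exact h.le
  · rw [h1, h2, h3, h4]; exact h.sol

theorem Best.frame {𝒢 : TVG (Fin D.n)} {s : Fin D.n} {ℓ : ℕ} {τ : St} {c : Cmd} (h : Best D 𝒢 s ℓ σ)
    (hF : Frame c σ τ) (h1 : c.modv .best = false) (h2 : c.modv .blen = false)
    (h3 : c.moda .BV = false) (h4 : c.moda .BT = false) : Best D 𝒢 s ℓ τ :=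
  h.congr (hF.var _ h1) (hF.var _ h2) (hF.arr _ h3) (hF.arr _ h4)

/-- Trying the states `N - n, …, N - 1` keeps the stored solution the best one found, and it is at
least as good as each of these states whose walks cover all vertices. -/
theorem finish_spec {𝒢 : TVG (Fin D.n)} {s : Fin D.n} {ℓ N t : ℕ} (hP : Prep D σ)
    (hs : (s : ℕ) = D.s) {T : ℕ → ℕ → Prop} {X : ℕ → ℕ} (hS : HasTables D T X N σ) (hN : D.n ≤ N)
    (hℓ : N ≤ ℓ)
    (hpre : ∀ j < N, 0 < σ.arr .arr j → σ.arr .arr j ≤ t →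
      σ.arr .pre j < N ∧ σ.arr .arr (σ.arr .pre j) ≤ t)
    (hinf : ∀ j < N, σ.arr .arr j ≤ t ∨ σ.arr .arr j = D.inf)
    (hwalk : ∀ e < N, σ.arr .arr e ≤ t → ∃ J, Walk D.n (σ.arr .arr) (σ.arr .pre) e J ∧
      J.length ≤ N ∧ 𝒢.IsJourney s 0 J ∧ arrival 0 J = σ.arr .arr e)
    (hB : Best D 𝒢 s ℓ σ) :
    Best D 𝒢 s ℓ (finish.run σ) ∧ (finish.run σ).var .best ≤ σ.var .best ∧
    (∀ u < D.n, (σ.arr .arr (N - D.n + u) ≤ t →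
      ∀ J, Walk D.n (σ.arr .arr) (σ.arr .pre) (N - D.n + u) J → ∀ v, v ∈ visited s J) →
      (finish.run σ).var .best ≤ σ.arr .arr (N - D.n + u)) ∧
    (finish.run σ).tm ≤ σ.tm + 4 + D.n * (N * 400 + 400) := by
  have key : _ ∧ (finish.run σ).tm ≤ _ ∧ _ :=
    run_loop (fun m τ => Best D 𝒢 s ℓ τ ∧ τ.var .best ≤ σ.var .best ∧
      (∀ u < m, (σ.arr .arr (N - D.n + u) ≤ t →
        ∀ J, Walk D.n (σ.arr .arr) (σ.arr .pre) (N - D.n + u) J → ∀ v, v ∈ visited s J) →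
        τ.var .best ≤ σ.arr .arr (N - D.n + u))) D.n (N * 400 + 400)
      (by simp [hP.n]) ⟨hB.congr rfl rfl rfl rfl, by simp, by simp⟩ (by
        intro m hm τ hF ⟨h1, h2, h3⟩
        set τ1 := (asg .e (var .len - var .n + var .u)).run ((τ.setv .u m).tick 3) with hτ1
        have e1 : τ.var .len = N := (hF.var _ rfl).trans hS.len
        have e2 : τ.var .n = D.n := (hF.var _ rfl).trans hP.n
        have e3 : τ1.var .e = N - D.n + m := by simp [hτ1, e1, e2]
        have hF1 : Frame (block [asg .u 0, asg .e 0]) τ τ1 := by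
          refine ⟨fun y hy => ?_, fun _ _ => rfl, fun _ => rfl⟩
          have a1 : y ≠ .u := by rintro rfl; simp [modv, block] at hy
          have a2 : y ≠ .e := by rintro rfl; simp [modv, block] at hy
          simp [hτ1, a1, a2]
        have t1 : τ1.tm ≤ τ.tm + 20 := by simp [hτ1]
        have hB1 : Best D 𝒢 s ℓ τ1 := h1.frame hF1 rfl rfl rfl rfl
        have hb1 : τ1.var .best = τ.var .best := hF1.var _ rfl
        have ha1 : τ1.arr .arr = σ.arr .arr := (hF1.arr _ rfl).trans (hF.arr _ rfl)
        have hp1 : τ1.arr .pre = σ.arr .pre := (hF1.arr _ rfl).trans (hF.arr _ rfl)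
        have hrun : (block [asg .e (var .len - var .n + var .u),
            ifLt (rd .arr (var .e)) (var .best) (block [tryState, ifLt 0 (var .ok) save skip])
              skip]).run ((τ.setv .u m).tick 3) =
            ((ifLt (rd .arr (var .e)) (var .best) (block [tryState, ifLt 0 (var .ok) save skip])
              skip).run τ1).tick 1 := by
          simp only [run_block_cons, run_block_nil, hτ1]
        rw [hrun, run_ifLt]
        simp only [eval, e3, ha1, hb1]
        have heN : N - D.n + m < N := by omega
        split_ifs with c
        · have hle : σ.arr .arr (N - D.n + m) ≤ t := by
            rcases hinf _ heN with h | h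
            · exact h
            · have := h1.le
              omega
          obtain ⟨J, w1, w2, w3, w4⟩ := hwalk _ heN hle
          set τ2 := τ1.tick ((rd Arr.arr (var .e)).cost + (var .best).cost + 1) with hτ2
          have t2 : τ2.tm ≤ τ1.tm + 20 := by simp [hτ2]
          have hS2 : HasTables D T X N τ2 :=
            ((hS.frame hF rfl rfl rfl rfl).frame hF1 rfl rfl rfl rfl).frame
              (c := skip) ⟨fun _ _ => rfl, fun _ _ => rfl, fun _ => rfl⟩ rfl rfl rfl rfl
          have hP2 : Prep D τ2 := ((hP.frame' hF rfl rfl).frame' hF1 rfl rfl).frame'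
            (c := skip) ⟨fun _ _ => rfl, fun _ _ => rfl, fun _ => rfl⟩ rfl rfl
          have a2 : τ2.arr .arr = σ.arr .arr := ha1
          have p2 : τ2.arr .pre = σ.arr .pre := hp1
          have e4 : τ2.var .e = N - D.n + m := e3
          obtain ⟨b1, b2, b3, b4⟩ := tryState_spec (σ := τ2) (t := t) (J := J) hP2 hs hS2
            (by rw [a2, p2]; exact hpre) (by rw [e4]; exact heN) (by rw [a2, e4]; exact hle)
            (by rw [a2, p2, e4]; exact w1) w2
          set τ3 := tryState.run τ2 with hτ3
          have hF3 : Frame tryState τ2 τ3 := run_frame _ _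
          have hB3 : Best D 𝒢 s ℓ τ3 := (hB1.congr (τ := τ2) rfl rfl rfl rfl).frame hF3 rfl rfl rfl rfl
          have hb3 : τ3.var .best = τ.var .best := (hF3.var _ rfl).trans hb1
          by_cases c2 : 0 < τ3.var .ok
          · set τ4 := τ3.tick ((0 : Exp).cost + (var .ok).cost + 1) with hτ4
            have hrun2 : (block [tryState, ifLt 0 (var .ok) save skip]).run τ2 =
                (save.run τ4).tick 1 := by
              rw [run_block_cons, run_block_cons, run_block_nil, run_ifLt]
              exact congrArg (St.tick · 1) (if_pos c2)
            rw [hrun2]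
            have t4 : τ4.tm ≤ τ3.tm + 20 := by simp [hτ4]
            obtain ⟨s1, s2, s3, s4⟩ := save_spec (σ := τ4)
            have l4 : τ4.var .l = J.length := b1
            have v4 : τ4.arr .arr (τ4.var .e) = σ.arr .arr (N - D.n + m) := by
              change τ3.arr .arr (τ3.var .e) = _
              rw [hF3.arr _ rfl, hF3.var _ rfl, a2, e4]
            rw [l4] at s2 s3 s4
            rw [v4] at s1
            refine ⟨⟨⟨?_, fun _ => ⟨J, ⟨w3, b3.1 c2⟩, ?_, ?_, ?_, w2.trans hℓ⟩⟩, ?_, fun u hu hcov => ?_⟩, ?_⟩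
            · have := h1.le
              simp only [St.tick_var, s1]; omega
            · simp only [St.tick_var, s1, w4]
            · simp only [St.tick_var, s2]
            · simp only [St.tick_arr, s3]
              exact b2
            · simp only [St.tick_var, s1]; omega
            · simp only [St.tick_var, s1]
              rcases Nat.lt_succ_iff_lt_or_eq.1 hu with hu | rfl
              · have := h3 u hu hcov
                omega
              · exact le_rfl
            · simp only [St.tick_tm]
              omega
          · have hrun2 : (block [tryState, ifLt 0 (var .ok) save skip]).run τ2 =
                (skip.run (τ3.tick ((0 : Exp).cost + (var .ok).cost + 1))).tick 1 := by
              rw [run_block_cons, run_block_cons, run_block_nil, run_ifLt]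
              exact congrArg (St.tick · 1) (if_neg c2)
            rw [hrun2]
            refine ⟨⟨hB3.congr rfl rfl rfl rfl, ?_, fun u hu hcov => ?_⟩, ?_⟩
            · simp [hb3, h2]
            · simp only [St.tick_var, run_skip, hb3]
              rcases Nat.lt_succ_iff_lt_or_eq.1 hu with hu | rfl
              · exact h3 u hu hcov
              · exact absurd (b3.2 (hcov hle J w1)) c2
            · simp
              omega
        · refine ⟨⟨hB1.congr rfl rfl rfl rfl, ?_, fun u hu hcov => ?_⟩, ?_⟩
          · simp [hb1, h2]
          · simp only [St.tick_var, run_skip, hb1]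
            rcases Nat.lt_succ_iff_lt_or_eq.1 hu with hu | rfl
            · exact h3 u hu hcov
            · omega
          · simp
            omega)
  obtain ⟨⟨h1, h2, h3⟩, h4, -⟩ := key
  exact ⟨h1, h2, h3, h4.trans (by simp)⟩

end Visit

/-! ### One choice of the edges outside the tree -/

namespace Visit
open Cmd Exp TVG

variable {D : Inst} {σ : St}

/-- Adjacency at time `t`, as a relation on numbers. -/
def avail {n : ℕ} (𝒢 : TVG (Fin n)) (t u v : ℕ) : Prop :=
  ∃ (hu : u < n) (hv : v < n), (𝒢.snap t).Adj ⟨u, hu⟩ ⟨v, hv⟩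

/-- The total duration of the given graphs. -/
def Inst.total (D : Inst) : ℕ := ∑ x ∈ Finset.range D.q, D.dur x

/-- The instance describes the time-varying graph `𝒢` with starting vertex `s`, and `H` is the union
of the given graphs. -/
structure Models (D : Inst) (𝒢 : TVG (Fin D.n)) (H : SimpleGraph (Fin D.n)) (s : Fin D.n) :
    Prop where
  start : (s : ℕ) = D.s
  adj : ∀ b < D.q, ∀ t < D.dur b, ∀ u < D.n, ∀ v < D.n,
    avail 𝒢 ((∑ x ∈ Finset.range b, D.dur x) + t) u v ↔ D.adj b u v
  h : ∀ u v : Fin D.n, D.h u v ↔ H.Adj u v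
  le : ∀ t < D.total, 𝒢.snap t ≤ H
  inf : D.total < D.inf
  low : ∀ v ∈ lowVerts H, ∃ b < D.k0, D.low b = v
  edge : ∀ p ∈ edgePairs H, ∃ e < D.M, D.eu e = p.1 ∧ D.ev e = p.2
  loop : 0 < D.M ∧ D.eu 0 = s ∧ D.ev 0 = s

/-- The tuple `od` lists the edges outside the tree given by `par`; it may contain the edge
number `0` in addition. -/
structure Lists (D : Inst) (H : SimpleGraph (Fin D.n)) (s : Fin D.n) (c : ℕ) (od : ℕ → ℕ)
    (par : Fin D.n → Fin D.n) : Prop where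
  mem : ∀ j < c, od j = 0 ∨ ∃ p ∈ coTree H s par, D.eu (od j) = p.1 ∧ D.ev (od j) = p.2
  all : ∀ p ∈ coTree H s par, ∃ j < c, D.eu (od j) = p.1 ∧ D.ev (od j) = p.2

/-- The checkpoints are the vertices of low degree and the ends of the edges in `od`. -/
structure Checkpoints (D : Inst) (c : ℕ) (od P : ℕ → ℕ) : Prop where
  low : ∀ b < D.k0, P b = D.low b
  fst : ∀ j < c, P (D.k0 + 2 * j) = D.eu (od j)
  snd : ∀ j < c, P (D.k0 + 2 * j + 1) = D.ev (od j)

section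
variable {𝒢 : TVG (Fin D.n)} {H : SimpleGraph (Fin D.n)} {s : Fin D.n} {c ℓ : ℕ} {od P X : ℕ → ℕ}
  {arr pre : ℕ → ℕ} {par : Fin D.n → Fin D.n}

theorem Checkpoints.lt (h : Checkpoints D c od P) (hD : D.WF) (hod : ∀ j < c, od j < D.M) :
    ∀ b < D.k0 + 2 * c, P b < D.n := by
  intro b hb
  by_cases h0 : b < D.k0
  · rw [h.low b h0]; exact hD.low b h0
  · have hj : (b - D.k0) / 2 < c := by omega
    rcases Nat.mod_two_eq_zero_or_one (b - D.k0) with h1 | h1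
    · rw [show b = D.k0 + 2 * ((b - D.k0) / 2) by omega, h.fst _ hj]
      exact hD.eu _ (hod _ hj)
    · rw [show b = D.k0 + 2 * ((b - D.k0) / 2) + 1 by omega, h.snd _ hj]
      exact hD.ev _ (hod _ hj)

theorem coTree_of_not_treeEdge {u v : Fin D.n} (h : H.Adj u v) (ht : ¬ IsTreeEdge s par u v) :
    (u, v) ∈ coTree H s par ∨ (v, u) ∈ coTree H s par := by
  have ht' : ¬ IsTreeEdge s par v u := fun h => ht h.symm
  rcases lt_trichotomy u v with h1 | h1 | h1
  · exact Or.inr (mem_coTree.2 ⟨mem_edgePairs.2 ⟨h1, h.symm⟩, ht'⟩)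
  · exact absurd (h1 ▸ h) (H.loopless.irrefl _)
  · exact Or.inl (mem_coTree.2 ⟨mem_edgePairs.2 ⟨h1, h⟩, ht⟩)

theorem Models.tree_of_parent (hM : Models D 𝒢 H s) (hL : Lists D H s c od par) (u v : Fin D.n)
    (h : H.Adj u v) (hv : v ≠ s) (hp : par v = u) : D.tree c od u v := by
  refine ⟨(hM.h u v).2 h, fun j hj => ?_⟩
  rcases hL.mem j hj with h0 | ⟨p, hpc, e1, e2⟩
  · have h1 := hM.loop.2.1
    have h2 := hM.loop.2.2
    rw [h0, h1, h2]
    exact ⟨fun e => hv (Fin.ext e.2.symm), fun e => hv (Fin.ext e.1.symm)⟩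
  · have h3 := (mem_coTree.1 hpc).2
    rw [e1, e2]
    refine ⟨fun e => h3 (Or.inl ?_), fun e => h3 (Or.inr ?_)⟩
    · rw [Fin.ext e.1, Fin.ext e.2]; exact ⟨hv, hp⟩
    · rw [Fin.ext e.1, Fin.ext e.2]; exact ⟨hv, hp⟩

/-- A walk that ends with all checkpoints visited covers the graph: its permitted moves keep the
set of visited vertices closed under taking parents. -/
theorem Models.walk_covers {rank : Fin D.n → ℕ} (hM : Models D 𝒢 H s) (hL : Lists D H s c od par)
    (hC : Checkpoints D c od P) (hp : IsParent H s par rank)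
    (hX : IsMoveTable D.n (D.k0 + 2 * c) P X)
    (h : IsTable (Step D.n (avail 𝒢) (D.tree c od) X) (X s + s) (D.n * 2 ^ (D.k0 + 2 * c)) D.inf
      D.total arr pre) {u : ℕ} (hu : u < D.n)
    (ht : arr (D.n * 2 ^ (D.k0 + 2 * c) - D.n + u) ≤ D.total) {J : List (Fin D.n × ℕ)}
    (hJ : Walk D.n arr pre (D.n * 2 ^ (D.k0 + 2 * c) - D.n + u) J) (v : Fin D.n) :
    v ∈ visited s J := by
  have hN : D.n ≤ D.n * 2 ^ (D.k0 + 2 * c) := Nat.le_mul_of_pos_right _ (by positivity)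
  have hco : ∀ p ∈ coTree H s par, (∃ b < D.k0 + 2 * c, P b = p.1) ∧
      (∃ b < D.k0 + 2 * c, P b = p.2) := by
    intro p hpc
    obtain ⟨j, hj, e1, e2⟩ := hL.all p hpc
    exact ⟨⟨D.k0 + 2 * j, by omega, (hC.fst j hj).trans e1⟩,
      ⟨D.k0 + 2 * j + 1, by omega, (hC.snd j hj).trans e2⟩⟩
  obtain ⟨-, -, h3, h4⟩ := h.walk_spec (𝒢 := 𝒢)
    (C := fun W => s ∈ W ∧ ∀ v ∈ W, v ≠ s → par v ∈ W) hX
    (fun τ _ u v ⟨_, _, h⟩ => h) ⟨rfl, fun v hv hne => absurd hv hne⟩ (by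
      rintro τ hτ W u v ⟨hs, hW⟩ huW hadj hT
      have hadj := hM.le τ hτ hadj
      refine ⟨Set.mem_insert_of_mem _ hs, ?_⟩
      suffices v ∈ W ∨ (v ≠ s → par v ∈ W) by
        rintro w (rfl | hw) hne
        · rcases this with h | h
          · exact Set.mem_insert_of_mem _ (hW _ h hne)
          · exact Set.mem_insert_of_mem _ (h hne)
        · exact Set.mem_insert_of_mem _ (hW _ hw hne)
      by_cases hte : IsTreeEdge s par u v
      · rcases hte with ⟨h1, h2⟩ | ⟨h1, h2⟩
        · exact Or.inr fun _ => h2 ▸ huW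
        · exact Or.inl (h2 ▸ hW _ huW h1)
      · have hcot := coTree_of_not_treeEdge hadj hte
        rcases hT with hT | hT
        · -- a non-tree edge has been deleted from `T`
          rcases hcot with hcot | hcot
          · obtain ⟨j, hj, e⟩ := hL.all _ hcot
            exact absurd e (hT.2 j hj).1
          · obtain ⟨j, hj, e⟩ := hL.all _ hcot
            exact absurd e (hT.2 j hj).2
        · left
          rcases hcot with hcot | hcot
          · obtain ⟨b, hb, e⟩ := (hco _ hcot).2
            exact hT b hb e
          · obtain ⟨b, hb, e⟩ := (hco _ hcot).1
            exact hT b hb e)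
    hJ (by omega) ht
  have hcode : Codes (D.k0 + 2 * c) P
      (D.n * 2 ^ (D.k0 + 2 * c) - D.n + ((⟨u, hu⟩ : Fin D.n) : ℕ)) (visited s J) ⟨u, hu⟩ := by
    have e : dest s J = ⟨u, hu⟩ := by
      refine Fin.ext (h3.mod.symm.trans ?_)
      rw [show D.n * 2 ^ (D.k0 + 2 * c) - D.n = D.n * (2 ^ (D.k0 + 2 * c) - 1) by
        rw [Nat.mul_sub, Nat.mul_one], add_comm, Nat.add_mul_mod_self_left, Nat.mod_eq_of_lt hu]
    rw [e] at h3
    exact h3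
  have huniv := eq_univ_of_parent_closed hp h4.1 h4.2 (fun v hv => ?_) fun p hpc => ?_
  · rw [huniv]; trivial
  · obtain ⟨b, hb, e⟩ := hM.low v hv
    exact hcode.mem_of_last (by omega) ((hC.low b hb).trans e)
  · obtain ⟨⟨b, hb, e⟩, ⟨b', hb', e'⟩⟩ := hco p hpc
    exact ⟨hcode.mem_of_last hb e, hcode.mem_of_last hb' e'⟩

/-- A solution that follows the tree gives an upper bound on the arrival date of some state in which
all checkpoints have been visited. -/
theorem Models.exists_arr_le (hM : Models D 𝒢 H s) (hL : Lists D H s c od par)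
    (hP : ∀ b < D.k0 + 2 * c, P b < D.n)
    (hX : IsMoveTable D.n (D.k0 + 2 * c) P X)
    (h : IsTable (Step D.n (avail 𝒢) (D.tree c od) X) (X s + s) (D.n * 2 ^ (D.k0 + 2 * c)) D.inf
      D.total arr pre) {J : List (Fin D.n × ℕ)} (hJ : 𝒢.IsSolution s J)
    (hJt : arrival 0 J ≤ D.total) (hf : FirstVisits par s J) :
    ∃ u < D.n, arr (D.n * 2 ^ (D.k0 + 2 * c) - D.n + u) ≤ arrival 0 J := by
  obtain ⟨i, h1, h2⟩ := reach_of_firstVisits (A := avail 𝒢) (T := D.tree c od) hX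
    (fun τ _ u v h => ⟨u.2, v.2, h⟩) hM.le (hM.tree_of_parent hL) J hJ.1 hJt hf
  have huniv : visited s J = Set.univ := Set.eq_univ_of_forall hJ.2
  have hlt := h1.lt
  rw [huniv] at h1
  refine ⟨(dest s J : Fin D.n), (dest s J).2, ?_⟩
  have h3 := h1.eq_last hP
  rw [← h3]
  exact (h.reach i hlt _ hJt).2 h2

/-- A bound on the running time of `body`. -/
def Inst.bodyTime (D : Inst) (c : ℕ) : ℕ :=
  let N := D.n * 2 ^ (D.k0 + 2 * c)
  200 + D.n * D.n * 30 + c * 200 + D.n * 40 + (D.k0 + 2 * c) * (N * 200) + N * 30 +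
    (∑ x ∈ Finset.range D.q, (200 + min (D.dur x) N * (N * (D.n * 200 + 100) + 100))) +
    D.n * (N * 400 + 400)

/-- One round of the search: no solution whose first-visit tree is complementary to the edges in `od`
arrives before the solution that is stored afterwards. -/
theorem body_spec (hP : Prep D σ) (hD : D.WF) (hM : Models D 𝒢 H s)
    (hod : ∀ j < c, σ.arr .od j < D.M) (hℓ : D.n * 2 ^ (D.k0 + 2 * c) ≤ ℓ)
    (hB : Best D 𝒢 s ℓ σ) :
    Prep D ((body c).run σ) ∧ Best D 𝒢 s ℓ ((body c).run σ) ∧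
    ((body c).run σ).var .best ≤ σ.var .best ∧
    (∀ J par rank, 𝒢.IsSolution s J → arrival 0 J ≤ D.total → FirstVisits par s J →
      IsParent H s par rank → Lists D H s c (σ.arr .od) par →
      ((body c).run σ).var .best ≤ arrival 0 J) ∧
    ((body c).run σ).tm ≤ σ.tm + D.bodyTime c := by
  have hn : 0 < D.n := lt_of_le_of_lt (Nat.zero_le _) hD.s
  obtain ⟨N, hN⟩ : ∃ N, D.n * 2 ^ (D.k0 + 2 * c) = N := ⟨_, rfl⟩
  -- the matrix of the tree
  have f1 := run_frame copyTree σ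
  obtain ⟨a1, t1⟩ := copyTree_spec hP
  set σ1 := copyTree.run σ with h1
  have hP1 : Prep D σ1 := hP.frame' f1 rfl rfl
  have f2 := run_frame (asg .k (var .k0)) σ1
  set σ2 := (asg .k (var .k0)).run σ1 with h2
  have hP2 : Prep D σ2 := hP1.frame' f2 rfl rfl
  have t2 : σ2.tm = σ1.tm + 2 := rfl
  have o2 : σ2.arr .od = σ.arr .od := (f2.arr _ rfl).trans (f1.arr _ rfl)
  have f3 := run_frame (cut c) σ2
  obtain ⟨a3, b3, c3, d3, t3⟩ := cut_spec (c := c) hP2 hD (by rw [o2]; exact hod)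
    (by simp [h2, hP1.k0]) (fun j hj => by rw [f2.arr _ rfl, a1 j hj, f2.arr _ rfl, f1.arr _ rfl])
  set σ3 := (cut c).run σ2 with h3
  have hP3 : Prep D σ3 := hP2.frame f3 rfl b3
  rw [o2] at a3 c3
  have hC : Checkpoints D c (σ.arr .od) (σ3.arr .P) :=
    ⟨hP3.P, fun j hj => (c3 j hj).1, fun j hj => (c3 j hj).2⟩
  -- the move table
  have f4 := run_frame baseTable σ3
  obtain ⟨a4, b4, t4⟩ := baseTable_spec hP3
  set σ4 := baseTable.run σ3 with h4
  have hP4 : Prep D σ4 := hP3.frame' f4 rfl rfl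
  have f5 := run_frame (asg .len (var .n)) σ4
  set σ5 := (asg .len (var .n)).run σ4 with h5
  have hP5 : Prep D σ5 := hP4.frame' f5 rfl rfl
  have t5 : σ5.tm = σ4.tm + 2 := rfl
  have f6 := run_frame moveTable σ5
  obtain ⟨a6, b6, c6, t6⟩ := moveTable_spec (σ := σ5) (n := D.n) (k := D.k0 + 2 * c)
    (by rw [f5.var _ rfl, f4.var _ rfl]; exact d3) hn (by simp [h5, hP4.n])
    (fun j hj => a4 j hj) (fun j hj => b4 j hj)
  set σ6 := moveTable.run σ5 with h6
  have hP6 : Prep D σ6 := hP5.frame' f6 rfl rfl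
  have p5 : σ5.arr .P = σ3.arr .P := (f5.arr _ rfl).trans (f4.arr _ rfl)
  rw [p5] at a6
  rw [hN] at b6 c6 t6
  -- the table of the arrival dates
  have f7 := run_frame initTable σ6
  obtain ⟨a7, t7⟩ := initTable_spec hP6 c6
  set σ7 := initTable.run σ6 with h7
  have hP7 : Prep D σ7 := hP6.frame' f7 rfl rfl
  have f8 := run_frame (asg .t 0) σ7
  set σ8 := (asg .t 0).run σ7 with h8
  have hP8 : Prep D σ8 := hP7.frame' f8 rfl rfl
  have t8 : σ8.tm = σ7.tm + 2 := rfl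
  have f9 := run_frame (asg .p 3) σ8
  set σ9 := (asg .p 3).run σ8 with h9
  have hP9 : Prep D σ9 := hP8.frame' f9 rfl rfl
  have t9 : σ9.tm = σ8.tm + 2 := rfl
  have p9 : σ9.arr .P = σ3.arr .P := by
    rw [f9.arr _ rfl, f8.arr _ rfl, f7.arr _ rfl, f6.arr _ rfl, p5]
  have T9 : σ9.arr .T = σ3.arr .T := by
    rw [f9.arr _ rfl, f8.arr _ rfl, f7.arr _ rfl, f6.arr _ rfl, f5.arr _ rfl, f4.arr _ rfl]
  have hS9 : HasTables D (D.tree c (σ.arr .od)) (σ6.arr .X) N σ9 := by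
    refine ⟨fun j _ => ?_, fun j hj => ?_, ?_, ?_⟩
    · rw [f9.arr _ rfl, f8.arr _ rfl, f7.arr _ rfl]
    · rw [f9.arr _ rfl, f8.arr _ rfl, f7.arr _ rfl]; exact b6 j hj
    · rw [T9]; exact a3
    · rw [f9.var _ rfl, f8.var _ rfl, f7.var _ rfl]; exact c6
  have f10 := run_frame scan σ9
  have hS9' := hS9
  rw [← hN] at hS9'
  obtain ⟨a10, t10⟩ := scan_spec (A := avail 𝒢) hP9 hD (by rw [p9]; exact a6) hS9' rfl rfl
    hM.adj hM.inf (IsTable.init (by have := hM.inf; omega) (by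
      rw [f9.arr _ rfl, f8.arr _ rfl, hN]; exact a7))
  rw [hN] at t10
  set σ10 := scan.run σ9 with h10
  have hP10 : Prep D σ10 := hP9.frame' f10 rfl rfl
  have hS10 := hS9.frame f10 rfl rfl rfl rfl
  have hB10 : Best D 𝒢 s ℓ σ10 := by
    refine (((((((((hB.frame f1 ?_ ?_ ?_ ?_).frame f2 ?_ ?_ ?_ ?_).frame f3 ?_ ?_ ?_ ?_).frame f4
      ?_ ?_ ?_ ?_).frame f5 ?_ ?_ ?_ ?_).frame f6 ?_ ?_ ?_ ?_).frame f7 ?_ ?_ ?_ ?_).frame f8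
      ?_ ?_ ?_ ?_).frame f9 ?_ ?_ ?_ ?_).frame f10 ?_ ?_ ?_ ?_ <;> rfl
  have best10 : σ10.var .best = σ.var .best := by
    rw [f10.var _ rfl, f9.var _ rfl, f8.var _ rfl, f7.var _ rfl, f6.var _ rfl, f5.var _ rfl,
      f4.var _ rfl, f3.var _ rfl, f2.var _ rfl, f1.var _ rfl]
  have hX := a6
  have hs := hM.start
  rw [← hs] at a10
  change IsTable _ _ _ _ D.total _ _ at a10
  have hNn : D.n ≤ N := hN ▸ Nat.le_mul_of_pos_right _ (by positivity)
  -- the result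
  obtain ⟨a11, b11, c11, t11⟩ := finish_spec (𝒢 := 𝒢) (s := s) (t := D.total) hP10 hs hS10 hNn
    (hN ▸ hℓ)
    (by
      intro j hj h0 h1
      rw [← hN] at hj ⊢
      obtain ⟨r1, r2, -⟩ := a10.pre j hj h0 h1
      exact ⟨r1, by omega⟩)
    (by rw [← hN]; exact a10.or_inf)
    (by
      intro e he het
      rw [← hN] at he ⊢
      obtain ⟨J, hJ, hl⟩ := a10.exists_walk he het
      obtain ⟨r1, r2, -⟩ := a10.walk_spec (𝒢 := 𝒢) (C := fun _ => True) hX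
        (fun τ _ u v ⟨_, _, h⟩ => h) trivial (fun _ _ _ _ _ _ _ _ _ => trivial) hJ he het
      exact ⟨J, hJ, hl, r1, r2⟩) hB10
  have f11 := run_frame finish σ10
  have hrun : (body c).run σ = (finish.run σ10).tick 1 := rfl
  rw [hrun]
  refine ⟨(hP10.frame' f11 rfl rfl).frame' (c := skip) ⟨fun _ _ => rfl, fun _ _ => rfl,
    fun _ => rfl⟩ rfl rfl, a11.congr rfl rfl rfl rfl, by simpa [best10] using b11, ?_, ?_⟩
  · intro J par rank hJ hJt hf hp hL
    obtain ⟨u, hu, hle⟩ := hM.exists_arr_le hL (hC.lt hD hod) hX a10 hJ hJt hf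
    rw [hN] at hle
    refine (c11 u hu fun hle' J' hJ' v => ?_).trans hle
    rw [← hN] at hle' hJ'
    exact hM.walk_covers hL hC hp hX a10 hu hle' hJ' v
  · have : D.bodyTime c = 200 + D.n * D.n * 30 + c * 200 + D.n * 40 +
      (D.k0 + 2 * c) * (N * 200) + N * 30 +
      (∑ x ∈ Finset.range D.q, (200 + min (D.dur x) N * (N * (D.n * 200 + 100) + 100))) +
      D.n * (N * 400 + 400) := by rw [← hN]; rfl
    rw [this]
    simp only [St.tick_tm]
    omega

end

end Visit

/-! ### All choices of the edges outside the tree -/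

namespace Visit
open Cmd Exp TVG

variable {D : Inst} {σ : St} {𝒢 : TVG (Fin D.n)} {H : SimpleGraph (Fin D.n)} {s : Fin D.n} {c ℓ : ℕ}

/-- No solution whose first-visit tree is complementary to the edges in `od` arrives before `b`. -/
def Handles (D : Inst) (𝒢 : TVG (Fin D.n)) (H : SimpleGraph (Fin D.n)) (s : Fin D.n) (c : ℕ)
    (od : ℕ → ℕ) (b : ℕ) : Prop :=
  ∀ J par rank, 𝒢.IsSolution s J → arrival 0 J ≤ D.total → FirstVisits par s J →
    IsParent H s par rank → Lists D H s c od par → b ≤ arrival 0 J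

theorem Handles.mono {od : ℕ → ℕ} {b b' : ℕ} (h : Handles D 𝒢 H s c od b) (hb : b' ≤ b) :
    Handles D 𝒢 H s c od b' :=
  fun J par rank h1 h2 h3 h4 h5 => hb.trans (h J par rank h1 h2 h3 h4 h5)

theorem Handles.congr {od od' : ℕ → ℕ} {b : ℕ} (h : Handles D 𝒢 H s c od b)
    (he : ∀ j < c, od' j = od j) : Handles D 𝒢 H s c od' b := by
  intro J par rank h1 h2 h3 h4 h5
  refine h J par rank h1 h2 h3 h4 ⟨fun j hj => ?_, fun p hp => ?_⟩
  · have := h5.mem j hj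
    rwa [he j hj] at this
  · obtain ⟨j, hj, e⟩ := h5.all p hp
    rw [he j hj] at e
    exact ⟨j, hj, e⟩

/-- The loops over `od[0]`, …, `od[a - 1]`, the remaining entries of `od` being fixed. -/
theorem nest_spec (hD : D.WF) (hM : Models D 𝒢 H s) (hℓ : D.n * 2 ^ (D.k0 + 2 * c) ≤ ℓ) {a : ℕ} (hP : Prep D σ)
    (hod : ∀ j < c, a ≤ j → σ.arr .od j < D.M)
    (hB : Best D 𝒢 s ℓ σ) :
    Prep D ((nest (body c) a).run σ) ∧ Best D 𝒢 s ℓ ((nest (body c) a).run σ) ∧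
    ((nest (body c) a).run σ).var .best ≤ σ.var .best ∧
    (∀ j, a ≤ j → ((nest (body c) a).run σ).arr .od j = σ.arr .od j) ∧
    (∀ z : ℕ → ℕ, (∀ j < c, z j < D.M) → (∀ j < c, a ≤ j → z j = σ.arr .od j) →
      Handles D 𝒢 H s c z (((nest (body c) a).run σ).var .best)) ∧
    ((nest (body c) a).run σ).tm ≤ σ.tm + D.M ^ a * (D.bodyTime c + 20 * a) := by
  induction a generalizing σ with
  | zero =>
    obtain ⟨h1, h2, h3, h4, h5⟩ := body_spec (c := c) hP hD hM (fun j hj => hod j hj (Nat.zero_le _))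
      hℓ hB
    refine ⟨h1, h2, h3, fun j _ => ?_, fun z _ hz' => ?_, by simpa [nest] using h5⟩
    · have : (body c).moda .od = false := rfl
      exact congrFun ((run_frame (body c) σ).arr .od this) j
    · exact Handles.congr h4 fun j hj => hz' j hj (Nat.zero_le _)
  | succ a ih =>
    have hM0 := hM.loop.1
    have key : _ ∧ ((nest (body c) (a + 1)).run σ).tm ≤ _ ∧ _ :=
      run_loop (fun i τ => Prep D τ ∧ Best D 𝒢 s ℓ τ ∧ τ.var .best ≤ σ.var .best ∧
        (∀ j, a + 1 ≤ j → τ.arr .od j = σ.arr .od j) ∧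
        (∀ z : ℕ → ℕ, (∀ j < c, z j < D.M) → (∀ j < c, a + 1 ≤ j → z j = σ.arr .od j) → z a < i →
          Handles D 𝒢 H s c z (τ.var .best))) D.M (16 + D.M ^ a * (D.bodyTime c + 20 * a))
        (by simp [hP.M]) (by
          refine ⟨hP.frame' (c := skip) ⟨fun _ _ => rfl, fun _ _ => rfl, fun _ => rfl⟩ rfl rfl,
            hB.congr rfl rfl rfl rfl, le_rfl, fun _ _ => rfl, fun z _ _ h => absurd h (by omega)⟩) (by
          intro i hi τ hF ⟨h1, h2, h3, h4, h5⟩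
          set τ1 := (put .od (lit a) (var .g)).run ((τ.setv .g i).tick 3) with hτ1
          have f1 : Frame (seq (asg .g 0) (put .od (lit a) (var .g))) τ τ1 := by
            refine ⟨fun y hy => ?_, fun y hy => ?_, fun _ => rfl⟩
            · have : y ≠ .g := by rintro rfl; simp [modv] at hy
              simp [hτ1, this]
            · have : y ≠ .od := by rintro rfl; simp [moda] at hy
              funext j
              simp [hτ1, this]
          have hod1 : ∀ j, τ1.arr .od j = if j = a then i else τ.arr .od j := by
            intro j
            simp [hτ1]
          have t1 : τ1.tm = τ.tm + 14 := by simp [hτ1]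
          have b1 : τ1.var .best = τ.var .best := f1.var _ rfl
          obtain ⟨g1, g2, g3, g4, g5, g6⟩ := ih (σ := τ1) (h1.frame' f1 rfl rfl) (by
            intro j hj haj
            rw [hod1]
            split_ifs with hja
            · exact hi
            · rw [h4 j (by omega)]
              exact hod j hj (by omega)) (h2.frame f1 rfl rfl rfl rfl)
          have hrun : (block [put .od (lit a) (var .g), nest (body c) a]).run
            ((τ.setv .g i).tick 3) = ((nest (body c) a).run τ1).tick 1 := rfl
          rw [hrun]
          refine ⟨⟨g1.frame' (c := skip) ⟨fun _ _ => rfl, fun _ _ => rfl, fun _ => rfl⟩ rfl rfl,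
            g2.congr rfl rfl rfl rfl, ?_, fun j hj => ?_, fun z hz hz' hza => ?_⟩, ?_⟩
          · exact g3.trans (b1.le.trans h3)
          · simp only [St.tick_arr]
            rw [g4 j (by omega), hod1, if_neg (by omega), h4 j hj]
          · rcases Nat.lt_succ_iff_lt_or_eq.1 hza with hza | hza
            · exact (h5 z hz hz' hza).mono (g3.trans b1.le)
            · refine g5 z hz fun j hj haj => ?_
              rw [hod1]
              split_ifs with hja
              · rw [hja, hza]
              · rw [h4 j (by omega), hz' j hj (by omega)]
          · simp only [St.tick_tm]
            omega)
    obtain ⟨⟨h1, h2, h3, h4, h5⟩, h6, -⟩ := key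
    refine ⟨h1, h2, h3, h4, fun z hz hz' => ?_, h6.trans ?_⟩
    · by_cases hac : a < c
      · exact h5 z hz hz' (hz a hac)
      · -- the entry `a` of the tuple does not matter
        refine Handles.congr (h5 (fun j => if j = a then 0 else z j) (fun j hj => ?_)
          (fun j hj haj => ?_) (by simpa using hM0)) fun j hj => ?_
        · rw [if_neg (by omega)]; exact hz j hj
        · rw [if_neg (by omega)]; exact hz' j hj haj
        · rw [if_neg (by omega)]
    · have e1 : (var .M).cost = 1 := rfl
      rw [e1, pow_succ]
      have : D.M ^ a * D.M * (D.bodyTime c + 20 * (a + 1)) =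
        D.M * (D.M ^ a * (D.bodyTime c + 20 * a)) + 20 * (D.M ^ a * D.M) := by ring
      rw [this, Nat.mul_add]
      have : D.M ≤ D.M ^ a * D.M := Nat.le_mul_of_pos_left _ (by positivity)
      omega

end Visit

/-! ### The analysis of the input -/

namespace Visit
open Cmd Exp TVG

variable {σ : St}

theorem rows_spec {n : ℕ} (hn : σ.var .n = n) (h0 : σ.var .nn = 0) :
    (∀ u < n, (rows.run σ).arr .R u = u * n) ∧ (rows.run σ).var .nn = n * n ∧
    (rows.run σ).tm ≤ σ.tm + 4 + n * 30 := by
  have key : _ ∧ (rows.run σ).tm ≤ _ ∧ _ :=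
    run_loop (fun i τ => (∀ u < i, τ.arr .R u = u * n) ∧ τ.var .nn = i * n) n 30
      (by simp [hn]) (by simp [h0]) (by
        intro i hi τ hF ⟨h1, h2⟩
        have hn' : τ.var .n = n := (hF.var _ rfl).trans hn
        refine ⟨⟨fun u hu => ?_, ?_⟩, by simp⟩
        · by_cases hui : u = i
          · simp [hui, h2]
          · simp [hui, h1 u (by omega)]
        · simp [h2, hn', Nat.add_mul])
  obtain ⟨⟨h1, h2⟩, h3, -⟩ := key
  exact ⟨h1, h2, h3.trans (by simp)⟩

theorem union_spec {q N : ℕ} (hq : σ.var .q = q) (hN : σ.var .nn = N) (hp : σ.var .p = 3)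
    (hD : σ.var .D = 0) (hH : ∀ j < N, σ.arr .H j = 0) :
    (∀ j < N, 0 < (union.run σ).arr .H j ↔ ∃ b < q, 0 < σ.arr .I (3 + b * (1 + N) + 1 + j)) ∧
    (union.run σ).var .D = ∑ b ∈ Finset.range q, σ.arr .I (3 + b * (1 + N)) ∧
    (union.run σ).tm ≤ σ.tm + 4 + q * (N * 60 + 100) := by
  have key : _ ∧ (union.run σ).tm ≤ _ ∧ _ :=
    run_loop (fun i τ => (∀ j < N, 0 < τ.arr .H j ↔
        ∃ b < i, 0 < σ.arr .I (3 + b * (1 + N) + 1 + j)) ∧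
      τ.var .D = ∑ b ∈ Finset.range i, σ.arr .I (3 + b * (1 + N)) ∧
      τ.var .p = 3 + i * (1 + N)) q (N * 60 + 100)
      (by simp [hq]) (by
        refine ⟨fun j hj => by simp [hH j hj], by simp [hD], by simp [hp]⟩) (by
        intro i hi τ hF ⟨h1, h2, h3⟩
        have hI : τ.arr .I = σ.arr .I := hF.arr _ rfl
        have hN' : τ.var .nn = N := (hF.var _ rfl).trans hN
        set τ1 := (asg .p (var .p + 1)).run ((asg .D (var .D + rd .I (var .p))).run
          ((τ.setv .b i).tick 3)) with hτ1
        have i1 : τ1.arr = τ.arr := by simp [hτ1]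
        have n1 : τ1.var .nn = N := by simp [hτ1, hN']
        have p1 : τ1.var .p = 3 + i * (1 + N) + 1 := by simp [hτ1, h3]
        have d1 : τ1.var .D = ∑ b ∈ Finset.range (i + 1), σ.arr .I (3 + b * (1 + N)) := by
          simp [hτ1, h3, h2, hI, Finset.sum_range_succ]
        have t1 : τ1.tm ≤ τ.tm + 30 := by simp [hτ1]
        have inner : _ ∧ ((loop .j (var .nn) (ifLt 0 (rd .I (var .p + var .j))
            (put .H (var .j) 1) skip)).run τ1).tm ≤ _ ∧ _ :=
          run_loop (fun j υ => ∀ x < N, 0 < υ.arr .H x ↔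
              ((∃ b < i, 0 < σ.arr .I (3 + b * (1 + N) + 1 + x)) ∨
                (x < j ∧ 0 < σ.arr .I (3 + i * (1 + N) + 1 + x)))) N 60
            (by simp [n1]) (by
              intro x hx
              simp only [St.tick_arr, i1, h1 x hx]
              simp) (by
              intro j hj υ hG hυ
              have hI' : υ.arr .I = σ.arr .I := (hG.arr _ rfl).trans (by rw [i1, hI])
              have hp' : υ.var .p = 3 + i * (1 + N) + 1 := (hG.var _ rfl).trans p1
              rw [run_ifLt]
              simp only [eval, Exp.eval_add', Exp.eval_ofNat', St.tick_arr, St.setv_arr,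
                St.tick_var, St.setv_var, hI', hp']
              by_cases hpos : 0 < σ.arr .I (3 + i * (1 + N) + 1 + j)
              · have hc : 0 < σ.arr Arr.I (3 + i * (1 + N) + 1 + j) := hpos
                simp [hc]
                intro x hx
                by_cases hxj : x = j
                · subst hxj; simp [hc]
                · rw [if_neg hxj, hυ x hx]
                  have : x ≤ j ↔ x < j := by omega
                  rw [this]
              · have hc : ¬ 0 < σ.arr Arr.I (3 + i * (1 + N) + 1 + j) := hpos
                simp [hc]
                intro x hx
                rw [hυ x hx]
                refine or_congr_right ⟨fun h => ⟨by omega, h.2⟩, fun h => ⟨?_, h.2⟩⟩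
                refine Nat.lt_of_le_of_ne (by omega) ?_
                rintro rfl
                exact hpos h.2)
        obtain ⟨g1, g2, g3⟩ := inner
        set τ2 := (loop .j (var .nn) (ifLt 0 (rd .I (var .p + var .j))
            (put .H (var .j) 1) skip)).run τ1 with hτ2
        have hrun : (block [
            asg .D (var .D + rd .I (var .p)),
            asg .p (var .p + 1),
            loop .j (var .nn) (ifLt 0 (rd .I (var .p + var .j)) (put .H (var .j) 1) skip),
            asg .p (var .p + var .nn)]).run ((τ.setv .b i).tick 3) =
          ((asg .p (var .p + var .nn)).run τ2).tick 1 := rfl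
        rw [hrun]
        have e1 : τ2.var .D = τ1.var .D := g3.var _ rfl
        have e2 : τ2.var .p = τ1.var .p := g3.var _ rfl
        have e3 : τ2.var .nn = τ1.var .nn := g3.var _ rfl
        refine ⟨⟨fun x hx => ?_, ?_, ?_⟩, ?_⟩
        · simp only [St.tick_arr, run_asg, St.setv_arr]
          rw [g1 x hx]
          constructor
          · rintro (⟨b, hb, h⟩ | ⟨-, h⟩)
            · exact ⟨b, by omega, h⟩
            · exact ⟨i, by omega, h⟩
          · rintro ⟨b, hb, h⟩
            rcases Nat.lt_succ_iff_lt_or_eq.1 hb with hb | rfl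
            · exact Or.inl ⟨b, hb, h⟩
            · exact Or.inr ⟨hx, h⟩
        · simp [e1, d1]
        · simp [e2, e3, p1, n1]; ring
        · simp at g2 ⊢; omega)
  obtain ⟨⟨h1, h2, -⟩, h3, -⟩ := key
  exact ⟨h1, h2, h3.trans (by simp)⟩

section
open Classical
variable {n : ℕ} {G : SimpleGraph (Fin n)} {s : ℕ}

/-- The arrays `EU` and `EV` list the pairs in `S` from the index `1` on, preceded by the loop
at `s`. -/
structure ListsPairs (s : ℕ) (S : Finset (Fin n × Fin n)) (M : ℕ) (EU EV : ℕ → ℕ) : Prop where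
  card : M = S.card + 1
  zero : EU 0 = s ∧ EV 0 = s
  lt : ∀ e < M, EU e < n ∧ EV e < n
  all : ∀ p ∈ S, ∃ e < M, EU e = p.1 ∧ EV e = p.2

/-- The array `P` lists the vertices in `S`. -/
structure ListsVerts (S : Finset (Fin n)) (k : ℕ) (P : ℕ → ℕ) : Prop where
  card : k = S.card
  lt : ∀ b < k, P b < n
  all : ∀ v ∈ S, ∃ b < k, P b = v

theorem ListsPairs.insert {S : Finset (Fin n × Fin n)} {M : ℕ} {EU EV EU' EV' : ℕ → ℕ}
    (h : ListsPairs s S M EU EV) {p : Fin n × Fin n} (hp : p ∉ S)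
    (h1 : ∀ e, EU' e = if e = M then (p.1 : ℕ) else EU e)
    (h2 : ∀ e, EV' e = if e = M then (p.2 : ℕ) else EV e) :
    ListsPairs s (insert p S) (M + 1) EU' EV' := by
  refine ⟨by rw [Finset.card_insert_of_notMem hp, h.card], ?_, fun e he => ?_, fun x hx => ?_⟩
  · have := h.card
    rw [h1, h2, if_neg (by omega), if_neg (by omega)]
    exact h.zero
  · rw [h1, h2]
    split_ifs with h3
    · exact ⟨p.1.2, p.2.2⟩
    · exact h.lt e (by omega)
  · rcases Finset.mem_insert.1 hx with rfl | hx
    · exact ⟨M, by omega, by simp [h1], by simp [h2]⟩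
    · obtain ⟨e, he, e1, e2⟩ := h.all x hx
      exact ⟨e, by omega, by rw [h1, if_neg (by omega), e1], by rw [h2, if_neg (by omega), e2]⟩

theorem ListsVerts.insert {S : Finset (Fin n)} {k : ℕ} {P P' : ℕ → ℕ}
    (h : ListsVerts S k P) {v : Fin n} (hv : v ∉ S)
    (h1 : ∀ b, P' b = if b = k then (v : ℕ) else P b) : ListsVerts (insert v S) (k + 1) P' := by
  refine ⟨by rw [Finset.card_insert_of_notMem hv, h.card], fun b hb => ?_, fun x hx => ?_⟩
  · rw [h1]
    split_ifs with h3
    · exact v.2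
    · exact h.lt b (by omega)
  · rcases Finset.mem_insert.1 hx with rfl | hx
    · exact ⟨k, by omega, by simp [h1]⟩
    · obtain ⟨b, hb, e1⟩ := h.all x hx
      exact ⟨b, by omega, by rw [h1, if_neg (by omega), e1]⟩

/-- The edges that `edges` has listed when it has treated the vertices below `u` and, for `u`, the
neighbours below `j`. -/
noncomputable def edgesBefore (G : SimpleGraph (Fin n)) (u j : ℕ) : Finset (Fin n × Fin n) :=
  (edgePairs G).filter fun p => (p.1 : ℕ) < u ∨ ((p.1 : ℕ) = u ∧ (p.2 : ℕ) < j)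

/-- One row of the adjacency matrix yields the degree of `u` and the edges to smaller vertices. -/
theorem row_spec (hn : σ.var .n = n) (hR : ∀ u < n, σ.arr .R u = u * n)
    (hH : ∀ u v : Fin n, 0 < σ.arr .H (u * n + v) ↔ G.Adj u v) {u : Fin n} (hu : σ.var .u = u)
    (hd : σ.var .d = 0)
    (hL : ListsPairs s (edgesBefore G u 0) (σ.var .M) (σ.arr .EU) (σ.arr .EV)) :
    ListsPairs s (edgesBefore G (u + 1) 0) ((row.run σ).var .M) ((row.run σ).arr .EU)
      ((row.run σ).arr .EV) ∧
    (row.run σ).var .d = (Finset.univ.filter fun w => G.Adj u w).card ∧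
    (row.run σ).tm ≤ σ.tm + 4 + n * 120 := by
  have key : _ ∧ (row.run σ).tm ≤ _ ∧ _ :=
    run_loop (fun j τ => ListsPairs s (edgesBefore G u j) (τ.var .M) (τ.arr .EU) (τ.arr .EV) ∧
      τ.var .d = (Finset.univ.filter fun w : Fin n => (w : ℕ) < j ∧ G.Adj u w).card) n 120
      (by simp [hn]) ⟨hL, by simp [hd]⟩ (by
        intro j hj τ hF ⟨h1, h2⟩
        have hR' : τ.arr .R (u : ℕ) = u * n := by rw [hF.arr _ rfl]; exact hR u u.2
        have hu' : τ.var .u = u := (hF.var _ rfl).trans hu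
        have hH' : 0 < τ.arr .H (u * n + j) ↔ G.Adj u ⟨j, hj⟩ := by
          rw [hF.arr _ rfl]; exact hH u ⟨j, hj⟩
        have hcond : (rd Arr.H (rd .R (var .u) + var .v)).eval ((τ.setv .v j).tick 3) =
            τ.arr .H (u * n + j) := by simp [hu', hR']
        have h0 : (0 : Exp).eval ((τ.setv .v j).tick 3) = 0 := rfl
        rw [run_ifLt, hcond, h0]
        by_cases hadj : G.Adj u ⟨j, hj⟩
        · rw [if_pos (hH'.2 hadj)]
          have hdeg : (Finset.univ.filter fun w : Fin n => (w : ℕ) < j + 1 ∧ G.Adj u w).card =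
              (Finset.univ.filter fun w : Fin n => (w : ℕ) < j ∧ G.Adj u w).card + 1 := by
            rw [← Finset.card_insert_of_notMem (a := (⟨j, hj⟩ : Fin n)) (by simp)]
            congr 1
            ext w
            simp only [Finset.mem_filter, Finset.mem_univ, true_and, Finset.mem_insert, Fin.ext_iff]
            constructor
            · rintro ⟨h3, h4⟩
              by_cases h5 : (w : ℕ) = j
              · exact Or.inl h5
              · exact Or.inr ⟨by omega, h4⟩
            · rintro (h3 | h3)
              · obtain rfl : w = ⟨j, hj⟩ := Fin.ext h3
                exact ⟨by simp, hadj⟩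
              · exact ⟨by omega, h3.2⟩
          have hlt : (var Var.v).eval ((asg .d (var .d + 1)).run (((τ.setv .v j).tick 3).tick
              ((0 : Exp).cost + (rd Arr.H (rd .R (var .u) + var .v)).cost + 1))) = j := by simp
          have hlu : (var Var.u).eval ((asg .d (var .d + 1)).run (((τ.setv .v j).tick 3).tick
              ((0 : Exp).cost + (rd Arr.H (rd .R (var .u) + var .v)).cost + 1))) = u := by
            simp [hu']
          rw [run_block_cons, run_block_cons, run_block_nil, run_ifLt, hlt, hlu]
          by_cases hju : j < (u : ℕ)
          · rw [if_pos hju]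
            refine ⟨⟨?_, ?_⟩, ?_⟩
            · have hset : edgesBefore G u (j + 1) = insert (u, ⟨j, hj⟩) (edgesBefore G u j) := by
                ext p
                simp only [edgesBefore, Finset.mem_filter, Finset.mem_insert, mem_edgePairs,
                  Prod.ext_iff, Fin.ext_iff]
                constructor
                · rintro ⟨h3, h4⟩
                  by_cases h5 : (p.1 : ℕ) = u ∧ (p.2 : ℕ) = j
                  · exact Or.inl h5
                  · exact Or.inr ⟨h3, by omega⟩
                · rintro (h3 | h3)
                  · have e1 : p.1 = u := Fin.ext h3.1
                    have e2 : p.2 = ⟨j, hj⟩ := Fin.ext h3.2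
                    rw [e1, e2]
                    exact ⟨⟨hju, hadj⟩, Or.inr ⟨rfl, by simp⟩⟩
                  · exact ⟨h3.1, by omega⟩
              rw [hset]
              have := h1.insert (p := (u, ⟨j, hj⟩)) (by simp [edgesBefore])
                (fun e => rfl) (fun e => rfl)
              convert this using 1
              · simp
              · funext e; simp [hu']
              · funext e; simp
            · rw [hdeg]; simp [h2]
            · simp
          · rw [if_neg hju]
            refine ⟨⟨?_, ?_⟩, ?_⟩
            · have hset : edgesBefore G u (j + 1) = edgesBefore G u j := by
                ext p
                simp only [edgesBefore, Finset.mem_filter, mem_edgePairs, Fin.lt_def]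
                refine and_congr_right fun h3 => ?_
                omega
              rw [hset]
              simpa using h1
            · rw [hdeg]; simp [h2]
            · simp
        · rw [if_neg (fun h => hadj (hH'.1 h))]
          refine ⟨⟨?_, ?_⟩, ?_⟩
          · have hset : edgesBefore G u (j + 1) = edgesBefore G u j := by
              ext p
              simp only [edgesBefore, Finset.mem_filter, mem_edgePairs]
              refine and_congr_right fun h3 => ?_
              have : ¬ ((p.1 : ℕ) = u ∧ (p.2 : ℕ) = j) := by
                rintro ⟨e1, e2⟩
                have e1 : p.1 = u := Fin.ext e1
                have e2 : p.2 = ⟨j, hj⟩ := Fin.ext e2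
                rw [e1, e2] at h3
                exact hadj h3.2
              omega
            rw [hset]
            simpa using h1
          · have hdeg : (Finset.univ.filter fun w : Fin n => (w : ℕ) < j + 1 ∧ G.Adj u w) =
              (Finset.univ.filter fun w : Fin n => (w : ℕ) < j ∧ G.Adj u w) := by
              ext w
              simp only [Finset.mem_filter, Finset.mem_univ, true_and]
              refine and_congr_left fun h3 => ?_
              have : (w : ℕ) ≠ j := by
                rintro e
                obtain rfl : w = ⟨j, hj⟩ := Fin.ext e
                exact hadj h3
              omega
            rw [hdeg]
            simpa using h2
          · simp)
  obtain ⟨⟨h1, h2⟩, h3, -⟩ := key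
  refine ⟨?_, ?_, h3.trans (by simp)⟩
  · have : edgesBefore G (u + 1) 0 = edgesBefore G u n := by
      ext p
      simp only [edgesBefore, Finset.mem_filter]
      have := p.2.2
      refine and_congr_right fun _ => ?_
      omega
    rw [this]
    exact h1
  · refine h2.trans ?_
    congr 1
    ext w
    simp

theorem edges_spec (hn : σ.var .n = n) (hR : ∀ u < n, σ.arr .R u = u * n)
    (hH : ∀ u v : Fin n, 0 < σ.arr .H (u * n + v) ↔ G.Adj u v) (hk : σ.var .k0 = 0)
    (hM : σ.var .M = 1) (hs : s < n) (hU : σ.arr .EU 0 = s) (hV : σ.arr .EV 0 = s) :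
    ListsPairs s (edgePairs G) ((edges.run σ).var .M) ((edges.run σ).arr .EU)
      ((edges.run σ).arr .EV) ∧
    ListsVerts (lowVerts G) ((edges.run σ).var .k0) ((edges.run σ).arr .P) ∧
    (edges.run σ).tm ≤ σ.tm + 4 + n * (n * 120 + 100) := by
  have key : _ ∧ (edges.run σ).tm ≤ _ ∧ _ :=
    run_loop (fun i τ =>
        ListsPairs s (edgesBefore G i 0) (τ.var .M) (τ.arr .EU) (τ.arr .EV) ∧
        ListsVerts ((lowVerts G).filter fun v => (v : ℕ) < i) (τ.var .k0) (τ.arr .P))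
      n (n * 120 + 100) (by simp [hn]) (by
        refine ⟨⟨by simp [hM, edgesBefore], ⟨hU, hV⟩, fun e he => ?_, fun p hp => ?_⟩,
          ⟨by simp [hk], fun b hb => ?_, fun v hv => ?_⟩⟩
        · obtain rfl : e = 0 := by simp [hM] at he; exact he
          exact ⟨by simp [hU, hs], by simp [hV, hs]⟩
        · simp [edgesBefore] at hp
        · simp [hk] at hb
        · simp at hv) (by
        intro i hi τ hF ⟨h1, h2⟩
        set τ1 := (asg .d 0).run ((τ.setv .u i).tick 3) with hτ1
        have hR1 : ∀ u < n, τ1.arr .R u = u * n := by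
          intro u hu
          simp [hτ1, hF.arr .R rfl, hR u hu]
        have hH1 : ∀ u v : Fin n, 0 < τ1.arr .H (u * n + v) ↔ G.Adj u v := by
          intro u v
          simp only [hτ1, run_asg, St.tick_arr, St.setv_arr, hF.arr .H rfl, hH]
        have t1 : τ1.tm = τ.tm + 5 := by simp [hτ1]
        obtain ⟨g1, g2, g3⟩ := row_spec (σ := τ1) (G := G) (s := s) (u := ⟨i, hi⟩)
          (by simp [hτ1, hF.var .n rfl, hn]) hR1 hH1 (by simp [hτ1]) (by simp [hτ1])
          (by simpa [hτ1] using h1)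
        have f1 := run_frame row τ1
        set τ2 := row.run τ1 with hτ2
        have hk2 : τ2.var .k0 = τ.var .k0 := by rw [f1.var _ rfl]; simp [hτ1]
        have hP2 : τ2.arr .P = τ.arr .P := by rw [f1.arr _ rfl]; simp [hτ1]
        have hu2 : τ2.var .u = i := by rw [f1.var _ rfl]; simp [hτ1]
        have hlow : (⟨i, hi⟩ : Fin n) ∈ lowVerts G ↔ τ2.var .d < 2 := by
          rw [g2, lowVerts, Finset.mem_filter]
          simp
        have hrun : (block [asg .d 0, row,
            ifLt (var .d) 2 (block [put .P (var .k0) (var .u), asg .k0 (var .k0 + 1)]) skip]).run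
            ((τ.setv .u i).tick 3) =
          ((ifLt (var .d) 2 (block [put .P (var .k0) (var .u), asg .k0 (var .k0 + 1)]) skip).run
            τ2).tick 1 := rfl
        rw [hrun, run_ifLt]
        have hc1 : (var Var.d).eval τ2 = τ2.var .d := rfl
        have hc2 : (2 : Exp).eval τ2 = 2 := rfl
        rw [hc1, hc2]
        by_cases hd : τ2.var .d < 2
        · rw [if_pos hd]
          refine ⟨⟨?_, ?_⟩, ?_⟩
          · convert g1 using 1
            · simp
            · funext e; simp
            · funext e; simp
          · have hset : ((lowVerts G).filter fun v : Fin n => (v : ℕ) < i + 1) =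
                insert ⟨i, hi⟩ ((lowVerts G).filter fun v : Fin n => (v : ℕ) < i) := by
              ext v
              simp only [Finset.mem_filter, Finset.mem_insert, Fin.ext_iff]
              constructor
              · rintro ⟨h3, h4⟩
                by_cases h5 : (v : ℕ) = i
                · exact Or.inl h5
                · exact Or.inr ⟨h3, by omega⟩
              · rintro (h3 | h3)
                · obtain rfl : v = ⟨i, hi⟩ := Fin.ext h3
                  exact ⟨hlow.2 hd, by simp⟩
                · exact ⟨h3.1, by omega⟩
            rw [hset]
            have := h2.insert (v := ⟨i, hi⟩) (by simp) (fun e => rfl)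
            convert this using 1
            · simp [hk2]
            · funext e; simp [hk2, hP2, hu2]
          · simp; omega
        · rw [if_neg hd]
          refine ⟨⟨?_, ?_⟩, ?_⟩
          · simpa using g1
          · have hset : ((lowVerts G).filter fun v : Fin n => (v : ℕ) < i + 1) =
                ((lowVerts G).filter fun v : Fin n => (v : ℕ) < i) := by
              ext v
              simp only [Finset.mem_filter]
              refine and_congr_right fun h3 => ?_
              have : (v : ℕ) ≠ i := by
                rintro e
                obtain rfl : v = ⟨i, hi⟩ := Fin.ext e
                exact hd (hlow.1 h3)
              omega
            rw [hset]
            simpa [hk2, hP2] using h2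
          · simp; omega)
  obtain ⟨⟨h1, h2⟩, h3, -⟩ := key
  refine ⟨?_, ?_, h3.trans (by simp)⟩
  · have : edgesBefore G n 0 = edgePairs G := by
      refine Finset.filter_true_of_mem fun p _ => Or.inl p.1.2
    rwa [this] at h1
  · have : ((lowVerts G).filter fun v : Fin n => (v : ℕ) < n) = lowVerts G :=
      Finset.filter_true_of_mem fun v _ => v.2
    rwa [this] at h2

end

end Visit

/-! ### The encoding of the input -/

namespace DMVP

theorem length_flatMap_of_length {α : Type} {f : α → List ℕ} {m : ℕ} {l : List α}
    (h : ∀ x ∈ l, (f x).length = m) : (l.flatMap f).length = l.length * m := by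
  induction l with
  | nil => simp
  | cons x l ih =>
    rw [List.flatMap_cons, List.length_append, ih fun y hy => h y (List.mem_cons_of_mem _ hy),
      h x List.mem_cons_self, List.length_cons, Nat.add_mul]
    omega

theorem getD_flatMap {α : Type} {f : α → List ℕ} {m : ℕ} {l : List α}
    (h : ∀ x ∈ l, (f x).length = m) {i j : ℕ} (hi : i < l.length) (hj : j < m) :
    (l.flatMap f).getD (i * m + j) 0 = (f l[i]).getD j 0 := by
  induction l generalizing i with
  | nil => simp at hi
  | cons x l ih =>
    have hx := h x List.mem_cons_self
    rw [List.flatMap_cons]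
    cases i with
    | zero => rw [List.getD_append _ _ _ _ (by omega)]; simp
    | succ i =>
      have e : (i + 1) * m = i * m + m := by ring
      rw [List.getD_append_right _ _ _ _ (by omega), hx,
        show (i + 1) * m + j - m = i * m + j by omega,
        ih (fun y hy => h y (List.mem_cons_of_mem _ hy)) (by simpa using hi)]
      simp

variable {n : ℕ}

theorem length_encodeGraph (G : SimpleGraph (Fin n)) : (encodeGraph G).length = n * n := by
  rw [encodeGraph, length_flatMap_of_length (m := n) (by simp), List.length_finRange]

open Classical in
theorem getD_encodeGraph (G : SimpleGraph (Fin n)) (u v : Fin n) :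
    (encodeGraph G).getD (u * n + v) 0 = if G.Adj u v then 1 else 0 := by
  rw [encodeGraph, getD_flatMap (m := n) (by simp) (by simp) v.2]
  simp

theorem length_encodeInput (L : Snapshots n) (s : Fin n) :
    (encodeInput L s).length = 3 + L.length * (1 + n * n) := by
  simp only [encodeInput, List.length_cons]
  rw [length_flatMap_of_length (m := 1 + n * n)]
  · omega
  · intro x _
    rw [List.length_cons, length_encodeGraph]
    omega

theorem getD_encodeInput (L : Snapshots n) (s : Fin n) {b j : ℕ} (hb : b < L.length)
    (hj : j < 1 + n * n) :
    (encodeInput L s).getD (3 + b * (1 + n * n) + j) 0 =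
      (L[b].2 :: encodeGraph L[b].1).getD j 0 := by
  have h := getD_flatMap (f := fun x : SimpleGraph (Fin n) × ℕ => x.2 :: encodeGraph x.1)
    (m := 1 + n * n) (l := L) (by
      intro x _
      rw [List.length_cons, length_encodeGraph]
      omega) hb hj
  rw [← h, show 3 + b * (1 + n * n) + j = b * (1 + n * n) + j + 1 + 1 + 1 by omega]
  simp only [encodeInput, List.getD_cons_succ]

theorem getD_encodeInput_dur (L : Snapshots n) (s : Fin n) {b : ℕ} (hb : b < L.length) :
    (encodeInput L s).getD (3 + b * (1 + n * n)) 0 = L[b].2 := by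
  have h := getD_encodeInput L s hb (j := 0) (by omega)
  rwa [add_zero, List.getD_cons_zero] at h

theorem getD_encodeInput_adj (L : Snapshots n) (s : Fin n) {b : ℕ} (hb : b < L.length)
    (u v : Fin n) :
    0 < (encodeInput L s).getD (3 + b * (1 + n * n) + 1 + (u * n + v)) 0 ↔ L[b].1.Adj u v := by
  have h := getD_encodeInput L s hb (j := 1 + (u * n + v))
    (by have := Visit.mul_add_lt u.2 v.2; omega)
  rw [← add_assoc, Nat.add_comm 1 (u * n + v), List.getD_cons_succ, getD_encodeGraph] at h
  rw [h]
  split_ifs with h1 <;> simp [h1]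

/-- The duration of the static graph number `b`. -/
def dur (L : Snapshots n) (b : ℕ) : ℕ := (L.map Prod.snd).getD b 0

theorem dur_eq (L : Snapshots n) {b : ℕ} (hb : b < L.length) : dur L b = L[b].2 := by
  simp [dur, hb]

theorem sum_range_getD (f : ℕ → ℕ) (l : List ℕ) :
    ∑ b ∈ Finset.range l.length, f (l.getD b 0) = (l.map f).sum := by
  induction l with
  | nil => simp
  | cons x l ih => rw [List.length_cons, Finset.sum_range_succ']; simp [← ih, add_comm]

theorem sum_dur (f : ℕ → ℕ) (L : Snapshots n) :
    ∑ b ∈ Finset.range L.length, f (dur L b) = (L.map fun x => f x.2).sum := by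
  have := sum_range_getD f (L.map Prod.snd)
  rw [List.length_map, List.map_map] at this
  exact this

theorem sum_dur_eq_duration (L : Snapshots n) :
    ∑ b ∈ Finset.range L.length, dur L b = duration L := sum_dur id L

theorem snapAt_eq (L : Snapshots n) {b t : ℕ} (hb : b < L.length) (ht : t < dur L b) :
    snapAt L ((∑ x ∈ Finset.range b, dur L x) + t) = L[b].1 := by
  induction L generalizing b with
  | nil => simp at hb
  | cons x L ih =>
    obtain ⟨G, d⟩ := x
    have h0 : dur ((G, d) :: L) 0 = d := rfl
    have hs : ∀ b, dur ((G, d) :: L) (b + 1) = dur L b := fun b => rfl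
    cases b with
    | zero =>
      rw [h0] at ht
      simp [snapAt, ht]
    | succ b =>
      rw [Finset.sum_range_succ', h0]
      simp only [hs] at ht ⊢
      rw [snapAt, if_neg (by omega),
        show ∑ x ∈ Finset.range b, dur L x + d + t - d = ∑ x ∈ Finset.range b, dur L x + t by omega]
      exact ih (by simpa using hb) ht

theorem sum_dur_add_lt (L : Snapshots n) {b t : ℕ} (hb : b < L.length) (ht : t < dur L b) :
    (∑ x ∈ Finset.range b, dur L x) + t < duration L := by
  have h1 : ∑ x ∈ Finset.range (b + 1), dur L x ≤ ∑ x ∈ Finset.range L.length, dur L x :=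
    Finset.sum_le_sum_of_subset (Finset.range_subset_range.2 hb)
  rw [sum_dur_eq_duration, Finset.sum_range_succ] at h1
  omega

/-- The union of the given static graphs. -/
def unionGraph (L : Snapshots n) : SimpleGraph (Fin n) where
  Adj u v := ∃ b, ∃ hb : b < L.length, L[b].1.Adj u v
  symm := ⟨fun _ _ ⟨b, hb, h⟩ => ⟨b, hb, h.symm⟩⟩
  loopless := ⟨fun _ ⟨_, _, h⟩ => h.ne rfl⟩

theorem exists_snapAt_eq (L : Snapshots n) {t : ℕ} (ht : t < duration L) :
    ∃ b, ∃ hb : b < L.length, snapAt L t = L[b].1 := by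
  induction L generalizing t with
  | nil => simp [duration] at ht
  | cons x L ih =>
    obtain ⟨G, d⟩ := x
    rw [snapAt]
    split_ifs with h
    · exact ⟨0, by simp, rfl⟩
    · have hd : duration ((G, d) :: L) = d + duration L := by simp [duration]
      obtain ⟨b, hb, e⟩ := ih (t := t - d) (by omega)
      exact ⟨b + 1, by simpa using hb, by simpa using e⟩

theorem Describes.snap_le {L : Snapshots n} {𝒢 : TVG (Fin n)} (h : Describes L 𝒢) {t : ℕ}
    (ht : t < duration L) : 𝒢.snap t ≤ unionGraph L := by
  rw [h.2.2 t ht]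
  obtain ⟨b, hb, e⟩ := exists_snapAt_eq L ht
  rw [e]
  exact fun u v huv => ⟨b, hb, huv⟩

theorem Describes.unionGraph_le {L : Snapshots n} {𝒢 : TVG (Fin n)} (h : Describes L 𝒢) :
    unionGraph L ≤ 𝒢.graph := by
  rintro u v ⟨b, hb, huv⟩
  have h1 : 0 < dur L b := by
    rw [dur_eq L hb]
    exact h.2.1 _ (List.getElem_mem hb)
  have h2 := sum_dur_add_lt L hb h1
  have h3 := h.2.2 _ h2
  rw [snapAt_eq L hb h1] at h3
  exact 𝒢.snap_le _ (h3 ▸ huv)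

end DMVP

/-! ### The output -/

namespace Visit
open Cmd Exp TVG

variable {σ : St}

theorem output_spec_none (h : ¬ σ.var .best < σ.var .inf) :
    (output.run σ).out = σ.out ++ [0] ∧ (output.run σ).tm ≤ σ.tm + 10 := by
  have hrun : output.run σ =
      (write 0).run (σ.tick ((var .best).cost + (var .inf).cost + 1)) := if_neg h
  rw [hrun]
  exact ⟨rfl, by simp⟩

/-- Reading a recorded journey from its end restores the order of the journey. -/
theorem reversed_eq {n : ℕ} {J : List (Fin n × ℕ)} {f g : ℕ → ℕ}
    (h : record f g J.length = reversed J) :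
    J.map (fun x => ((x.1 : ℕ), x.2)) =
      (List.range J.length).map fun i => (f (J.length - 1 - i), g (J.length - 1 - i)) := by
  have h1 := congrArg List.reverse h
  rw [reversed, List.reverse_reverse] at h1
  rw [← h1, record, ← List.map_reverse, List.range_eq_range', List.reverse_range', List.map_map,
    List.range_eq_range']
  refine List.map_congr_left fun i _ => ?_
  simp

theorem output_spec (h : σ.var .best < σ.var .inf) {n : ℕ}
    {J : List (Fin n × ℕ)} (hl : σ.var .blen = J.length)
    (hJ : record (σ.arr .BV) (σ.arr .BT) J.length = reversed J) :
    (output.run σ).out = σ.out ++ DMVP.encodeJourney J ∧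
    (output.run σ).tm ≤ σ.tm + 30 + J.length * 60 := by
  set σ1 := (write (var .blen)).run ((write 1).run
    (σ.tick ((var .best).cost + (var .inf).cost + 1))) with h1
  have key : _ ∧ ((loop .i (var .blen) (block [
        write (rd .BV (var .blen - 1 - var .i)), write (rd .BT (var .blen - 1 - var .i))])).run
          σ1).tm ≤ _ ∧ _ :=
    run_loop (fun i τ => τ.out = σ.out ++ 1 :: J.length :: (List.range i).flatMap fun i =>
        [σ.arr .BV (J.length - 1 - i), σ.arr .BT (J.length - 1 - i)]) J.length 60
      (by simp [h1, hl]) (by simp [h1, hl]) (by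
        intro i hi τ hF hI
        have e1 : τ.var .blen = J.length := (hF.var _ rfl).trans (by simp [h1, hl])
        have e2 : τ.arr .BV = σ.arr .BV := (hF.arr _ rfl).trans rfl
        have e3 : τ.arr .BT = σ.arr .BT := (hF.arr _ rfl).trans rfl
        refine ⟨?_, by simp⟩
        simp [e1, e2, e3, hI, List.range_succ])
  obtain ⟨g1, g2, -⟩ := key
  set σ2 := (loop .i (var .blen) (block [
        write (rd .BV (var .blen - 1 - var .i)), write (rd .BT (var .blen - 1 - var .i))])).run σ1
  have hrun : output.run σ = σ2.tick 1 := if_pos h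
  rw [hrun]
  refine ⟨?_, ?_⟩
  · have e : J.flatMap (fun x => [(x.1 : ℕ), x.2]) =
        (J.map fun x => ((x.1 : ℕ), x.2)).flatMap fun x => [x.1, x.2] := by
      rw [List.flatMap_map]
    rw [St.tick_out, g1, DMVP.encodeJourney, e, reversed_eq hJ, List.flatMap_map]
  · have t1 : σ1.tm ≤ σ.tm + 10 := by simp [h1]
    have e1 : (var Var.blen).cost = 1 := rfl
    rw [e1] at g2
    simp only [St.tick_tm]
    omega

end Visit

/-! ### Correctness of the program -/

namespace Visit
open Cmd Exp TVG DMVP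

/-- Every set of at most `c` edges outside the tree is listed by some tuple. -/
theorem Models.exists_lists {D : Inst} {𝒢 : TVG (Fin D.n)} {H : SimpleGraph (Fin D.n)}
    {s : Fin D.n} (hM : Models D 𝒢 H s) {c : ℕ} {par : Fin D.n → Fin D.n}
    (hc : (coTree H s par).card ≤ c) :
    ∃ z : ℕ → ℕ, (∀ j < c, z j < D.M) ∧ Lists D H s c z par := by
  have h : ∀ p : Fin D.n × Fin D.n, ∃ e < D.M, p ∈ coTree H s par → D.eu e = p.1 ∧ D.ev e = p.2 := by
    intro p
    by_cases hp : p ∈ coTree H s par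
    · obtain ⟨e, he, h⟩ := hM.edge p (mem_coTree.1 hp).1
      exact ⟨e, he, fun _ => h⟩
    · exact ⟨0, hM.loop.1, fun h => absurd h hp⟩
  choose e he hee using h
  have hmem : ∀ (j : ℕ) (hj : j < (coTree H s par).toList.length),
      (coTree H s par).toList[j] ∈ coTree H s par :=
    fun j hj => Finset.mem_toList.1 (List.getElem_mem hj)
  refine ⟨fun j => if hj : j < (coTree H s par).toList.length then
    e (coTree H s par).toList[j] else 0, fun j _ => ?_, ⟨fun j _ => ?_, fun p hp => ?_⟩⟩
  · dsimp only
    split_ifs with hj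
    · exact he _
    · exact hM.loop.1
  · split_ifs with hj
    · exact Or.inr ⟨_, hmem j hj, hee _ (hmem j hj)⟩
    · exact Or.inl rfl
  · obtain ⟨j, hj, rfl⟩ := List.getElem_of_mem (Finset.mem_toList.2 hp)
    rw [Finset.length_toList] at hj
    refine ⟨j, by omega, ?_⟩
    simp only [Finset.length_toList, hj, dif_pos]
    exact hee _ hp

/-- The first-visit tree of a solution spans the graph. -/
theorem exists_isParent {n : ℕ} {𝒢 : TVG (Fin n)} {H : SimpleGraph (Fin n)} {s : Fin n} {t : ℕ}
    (hH : ∀ τ < t, 𝒢.snap τ ≤ H) {J : List (Fin n × ℕ)} (hJ : 𝒢.IsSolution s J)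
    (hJt : arrival 0 J ≤ t) :
    ∃ par rank, FirstVisits par s J ∧ IsParent H s par rank := by
  obtain ⟨par, rank, h1, h2⟩ := exists_firstVisits hH J hJ.1 hJt
  exact ⟨par, rank, h1, fun v hv => ((h2 v (hJ.2 v)).2 hv).2.1,
    fun v hv => ((h2 v (hJ.2 v)).2 hv).2.2⟩

/-- After the search, `best` is the optimum, or `inf` if no solution arrives in time. -/
theorem Models.best_le {D : Inst} {𝒢 : TVG (Fin D.n)} {H : SimpleGraph (Fin D.n)}
    {s : Fin D.n} (hM : Models D 𝒢 H s) {c b : ℕ} (hc : (edgePairs H).card + 1 ≤ D.n + c)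
    (h : ∀ z : ℕ → ℕ, (∀ j < c, z j < D.M) → Handles D 𝒢 H s c z b) {J : List (Fin D.n × ℕ)}
    (hJ : 𝒢.IsSolution s J) (hJt : arrival 0 J ≤ D.total) : b ≤ arrival 0 J := by
  obtain ⟨par, rank, h1, h2⟩ := exists_isParent hM.le hJ hJt
  have := card_coTree h2
  obtain ⟨z, hz, hL⟩ := hM.exists_lists (c := c) (par := par) (by omega)
  exact h z hz J par rank hJ hJt h1 h2 hL

variable {n : ℕ}

/-- The instance given by the input, with the lists computed by `prepare`. -/
def inst (L : Snapshots n) (s : Fin n) (τ : St) : Inst where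
  n := n
  s := s
  q := L.length
  M := τ.var .M
  k0 := τ.var .k0
  inf := duration L + 1
  dur := dur L
  adj b u v := ∃ (hb : b < L.length) (hu : u < n) (hv : v < n), L[b].1.Adj ⟨u, hu⟩ ⟨v, hv⟩
  h u v := ∃ (hu : u < n) (hv : v < n), (unionGraph L).Adj ⟨u, hu⟩ ⟨v, hv⟩
  eu := τ.arr .EU
  ev := τ.arr .EV
  low := τ.arr .P

/-- After the preparation the lists are complete, and any state that differs at most in `inf` and `best`
holds the data of the instance. -/
theorem prepare_spec (L : Snapshots n) (s : Fin n) {τ : St}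
    (hτ : prepare.run (St.start (encodeInput L s)) = τ) :
    ListsPairs s (edgePairs (unionGraph L)) (τ.var .M) (τ.arr .EU) (τ.arr .EV) ∧
    ListsVerts (lowVerts (unionGraph L)) (τ.var .k0) (τ.arr .P) ∧
    (∀ υ : St, (∀ x, x ≠ .inf → x ≠ .best → υ.var x = τ.var x) → υ.arr = τ.arr →
      υ.var .inf = duration L + 1 → Prep (inst L s τ) υ) ∧
    τ.var .n = n ∧ τ.var .D = duration L ∧ τ.out = [] ∧
    τ.tm ≤ 200 + n * 30 + L.length * (n * n * 60 + 100) + n * (n * 120 + 100) := by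
  set σ := St.start (encodeInput L s) with hσ
  have hI : ∀ i, σ.arr .I i = (encodeInput L s).getD i 0 := fun i => rfl
  have h0 : ∀ a, a ≠ Arr.I → ∀ i, σ.arr a i = 0 := by
    intro a ha i
    simp [hσ, St.start, ha]
  set σ1 := (asg .q (rd .I 2)).run ((asg .s (rd .I 1)).run ((asg .n (rd .I 0)).run σ)) with h1
  have n1 : σ1.var .n = n := by simp [h1, hI, encodeInput]
  have s1 : σ1.var .s = s := by simp [h1, hI, encodeInput]
  have q1 : σ1.var .q = L.length := by simp [h1, hI, encodeInput]
  have v1 : ∀ x, x ≠ .n → x ≠ .s → x ≠ .q → σ1.var x = 0 := by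
    intro x hx1 hx2 hx3
    simp [h1, hx1, hx2, hx3, hσ, St.start]
  have a1 : σ1.arr = σ.arr := rfl
  have t1 : σ1.tm ≤ 50 := by simp [h1, hσ, St.start]
  have f2 := run_frame rows σ1
  obtain ⟨r2, nn2, t2⟩ := rows_spec n1 (v1 _ (by simp) (by simp) (by simp))
  set σ2 := rows.run σ1 with h2
  set σ3 := (asg .p 3).run σ2 with h3
  have f3 := run_frame (asg .p 3) σ2
  rw [← h3] at f3
  have t3 : σ3.tm = σ2.tm + 2 := rfl
  have I3 : ∀ i, σ3.arr .I i = (encodeInput L s).getD i 0 := by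
    intro i
    rw [f3.arr _ rfl, f2.arr _ rfl, a1, hI]
  have f4 := run_frame union σ3
  obtain ⟨H4, D4, t4⟩ := union_spec (σ := σ3) (q := L.length) (N := n * n)
    (by rw [f3.var _ rfl, f2.var _ rfl, q1]) (by rw [f3.var _ rfl, nn2]) rfl
    (by rw [f3.var _ rfl, f2.var _ rfl]; exact v1 _ (by simp) (by simp) (by simp))
    (fun j _ => by rw [f3.arr _ rfl, f2.arr _ rfl, a1]; exact h0 _ (by simp) j)
  set σ4 := union.run σ3 with h4
  have D4' : σ4.var .D = duration L := by
    rw [D4, ← sum_dur_eq_duration]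
    refine Finset.sum_congr rfl fun b hb => ?_
    rw [I3, getD_encodeInput_dur L s (Finset.mem_range.1 hb), dur_eq L (Finset.mem_range.1 hb)]
  set σ5 := (put .EV 0 (var .s)).run ((put .EU 0 (var .s)).run ((asg .M 1).run σ4)) with h5
  have f5 : Frame (seq (asg .M 1) (seq (put .EU 0 (var .s)) (put .EV 0 (var .s)))) σ4 σ5 :=
    run_frame (seq (asg .M 1) (seq (put .EU 0 (var .s)) (put .EV 0 (var .s)))) σ4
  have t5 : σ5.tm ≤ σ4.tm + 40 := by simp [h5]
  have s4 : σ4.var .s = s := by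
    rw [(run_frame union σ3).var _ rfl, f3.var _ rfl, f2.var _ rfl, s1]
  have R5 : ∀ u < n, σ5.arr .R u = u * n := by
    rw [f5.arr _ rfl, f4.arr _ rfl, f3.arr _ rfl]
    exact r2
  have H5 : ∀ u v : Fin n, 0 < σ5.arr .H (u * n + v) ↔ (unionGraph L).Adj u v := by
    intro u v
    rw [f5.arr _ rfl, H4 _ (mul_add_lt u.2 v.2)]
    constructor
    · rintro ⟨b, hb, h⟩
      rw [I3, getD_encodeInput_adj L s hb] at h
      exact ⟨b, hb, h⟩
    · rintro ⟨b, hb, h⟩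
      exact ⟨b, hb, by rwa [I3, getD_encodeInput_adj L s hb]⟩
  have f6 := run_frame edges σ5
  obtain ⟨E6, P6, t6⟩ := edges_spec (σ := σ5) (G := unionGraph L) (s := s) (n := n)
    (by rw [f5.var _ rfl, f4.var _ rfl, f3.var _ rfl, f2.var _ rfl, n1]) R5 H5
    (by rw [f5.var _ rfl, f4.var _ rfl, f3.var _ rfl, f2.var _ rfl]
        exact v1 _ (by simp) (by simp) (by simp))
    (by simp [h5]) s.2 (by simp [h5, s4]) (by simp [h5, s4])
  set σ6 := edges.run σ5 with h6
  have hrun : τ = σ6.tick 1 := by rw [← hτ]; rfl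
  have Mx : τ.var = σ6.var := by rw [hrun]; rfl
  have Ma : τ.arr = σ6.arr := by rw [hrun]; rfl
  have n6 : σ6.var .n = n := by
    rw [f6.var _ rfl, f5.var _ rfl, f4.var _ rfl, f3.var _ rfl, f2.var _ rfl, n1]
  have I6 : ∀ i, σ6.arr .I i = (encodeInput L s).getD i 0 := by
    intro i
    rw [f6.arr _ rfl, f5.arr _ rfl, f4.arr _ rfl, I3]
  refine ⟨by rw [Mx, Ma]; exact E6, by rw [Mx, Ma]; exact P6, ?_, by rw [Mx, n6], ?_, ?_, ?_⟩
  · intro υ hv ha hinf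
    refine ⟨?_, ?_, ?_, ?_, hv _ (by simp) (by simp), hv _ (by simp) (by simp), hinf, ?_, ?_, ?_, ?_,
      fun e _ => by rw [ha]; rfl, fun e _ => by rw [ha]; rfl, fun b _ => by rw [ha]; rfl⟩
    · rw [hv _ (by simp) (by simp), Mx, n6]; rfl
    · rw [hv _ (by simp) (by simp), Mx, f6.var _ rfl, f5.var _ rfl, s4]; rfl
    · rw [hv _ (by simp) (by simp), Mx, f6.var _ rfl, f5.var _ rfl, f4.var _ rfl, f3.var _ rfl,
        f2.var _ rfl, q1]; rfl
    · rw [hv _ (by simp) (by simp), Mx, f6.var _ rfl, f5.var _ rfl, f4.var _ rfl, f3.var _ rfl,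
        nn2]; rfl
    · rw [ha, Ma, f6.arr _ rfl]; exact R5
    · intro b hb
      rw [ha, Ma, I6]
      exact (getD_encodeInput_dur L s hb).trans (dur_eq L hb).symm
    · intro b hb u hu v hv
      rw [ha, Ma, I6]
      have := getD_encodeInput_adj L s hb ⟨u, hu⟩ ⟨v, hv⟩
      rw [← add_assoc] at this
      exact this.trans ⟨fun h => ⟨hb, hu, hv, h⟩, fun ⟨_, _, _, h⟩ => h⟩
    · intro u hu v hv
      rw [ha, Ma, f6.arr _ rfl]
      exact (H5 ⟨u, hu⟩ ⟨v, hv⟩).trans ⟨fun h => ⟨hu, hv, h⟩, fun ⟨_, _, h⟩ => h⟩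
  · rw [Mx, f6.var _ rfl, f5.var _ rfl, D4']
  · rw [hrun]
    change σ6.out = []
    rw [f6.out rfl, f5.out rfl, f4.out rfl, f3.out rfl, f2.out rfl]
    rfl
  · rw [hrun, St.tick_tm]
    omega

/-- A bound on the running time of the program, in terms of the numbers `M` and `k0` that `prepare`
computes. -/
def mainTime (c : ℕ) (L : Snapshots n) (D : Inst) : ℕ :=
  400 + n * 30 + L.length * (n * n * 60 + 100) + n * (n * 120 + 100) +
    D.M ^ c * (D.bodyTime c + 20 * c) + n * 2 ^ (D.k0 + 2 * c) * 60

/-- The output is correct, and the time is bounded in terms of the numbers of edges and of vertices of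
low degree of the union. -/
theorem main_spec (c : ℕ) {𝒢 : TVG (Fin n)} {L : Snapshots n} (s : Fin n) (hL : Describes L 𝒢)
    (hc : (edgePairs (unionGraph L)).card + 1 ≤ n + c) :
    ∃ D : Inst, D.n = n ∧ D.q = L.length ∧ D.dur = dur L ∧
      D.M = (edgePairs (unionGraph L)).card + 1 ∧ D.k0 = (lowVerts (unionGraph L)).card ∧
      IsCorrectOutput 𝒢 L s ((main c).run (St.start (encodeInput L s))).out ∧
      ((D.M < n ∧ ((main c).run (St.start (encodeInput L s))).tm ≤
          400 + n * 30 + L.length * (n * n * 60 + 100) + n * (n * 120 + 100)) ∨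
        (n ≤ D.M ∧ ((main c).run (St.start (encodeInput L s))).tm ≤ mainTime c L D)) := by
  obtain ⟨τ, hτ⟩ : ∃ τ, prepare.run (St.start (encodeInput L s)) = τ := ⟨_, rfl⟩
  obtain ⟨hE, hV, hPrep, hn, hD, ho, ht⟩ := prepare_spec L s hτ
  refine ⟨inst L s τ, rfl, rfl, rfl, hE.card, hV.card, ?_⟩
  have hMn : (inst L s τ).M = τ.var .M := rfl
  rw [hMn]
  by_cases hlt : τ.var .M < τ.var .n
  · have hrun : (main c).run (St.start (encodeInput L s)) =
        ((write 0).run (τ.tick 3)).tick 1 := by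
      rw [main, run_block_cons, hτ]
      exact congrArg (St.tick · 1) (if_pos hlt)
    rw [hrun]
    refine ⟨Or.inr ⟨fun J hJ => ?_, by simp [ho]⟩, Or.inl ⟨by omega, by simp; omega⟩⟩
    by_contra hcon
    obtain ⟨par, rank, -, h2⟩ := exists_isParent (fun t ht => hL.snap_le ht) hJ (not_lt.1 hcon)
    have h3 := card_coTree h2
    have h4 := hE.card
    omega
  · set τ1 := (asg .best (var .inf)).run ((asg .inf (var .D + 1)).run (τ.tick 3)) with h1
    obtain ⟨τ2, h2⟩ : ∃ τ2, (nest (body c) c).run τ1 = τ2 := ⟨_, rfl⟩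
    have hrun : (main c).run (St.start (encodeInput L s)) = ((output.run τ2).tick 1).tick 1 := by
      rw [main, run_block_cons, hτ, ← h2]
      exact congrArg (St.tick · 1) (if_neg hlt)
    have hinf1 : τ1.var .inf = duration L + 1 := by simp [h1, hD]
    have hbest1 : τ1.var .best = duration L + 1 := by simp [h1, hD]
    have hP1 : Prep (inst L s τ) τ1 := by
      refine hPrep τ1 (fun x hx hx' => ?_) rfl hinf1
      simp [h1, hx, hx']
    have ho1 : τ1.out = [] := ho
    have ht1 : τ1.tm ≤ τ.tm + 20 := by simp [h1]
    have hwf : (inst L s τ).WF :=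
      ⟨s.2, fun e he => (hE.lt e he).1, fun e he => (hE.lt e he).2, hV.lt⟩
    have htot : (inst L s τ).total = duration L := sum_dur_eq_duration L
    have hM : Models (inst L s τ) 𝒢 (unionGraph L) s := by
      refine ⟨rfl, fun b hb t ht u hu v hv => ?_, fun u v => ?_, fun t ht => ?_, ?_, hV.all, hE.all,
        ?_, hE.zero⟩
      · have ht : t < dur L b := ht
        have h3 := hL.2.2 _ (sum_dur_add_lt L hb ht)
        rw [snapAt_eq L hb ht] at h3
        change (∃ hu hv, (𝒢.snap (∑ x ∈ Finset.range b, dur L x + t)).Adj _ _) ↔ _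
        rw [h3]
        exact ⟨fun ⟨hu, hv, h⟩ => ⟨hb, hu, hv, h⟩, fun ⟨hb, hu, hv, h⟩ => ⟨hu, hv, h⟩⟩
      · exact ⟨fun ⟨_, _, h⟩ => h, fun h => ⟨u.2, v.2, h⟩⟩
      · exact hL.snap_le (htot ▸ ht)
      · rw [htot]; exact Nat.lt_succ_self _
      · have := hE.card
        rw [hMn]
        omega
    obtain ⟨g1, g2, g3, -, g5, g6⟩ := nest_spec (c := c) (a := c)
      (ℓ := n * 2 ^ ((inst L s τ).k0 + 2 * c)) hwf hM le_rfl hP1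
      (fun j hj hj' => absurd hj (by omega))
      ⟨by rw [hbest1]; exact le_rfl, fun h => absurd h (by rw [hbest1]; exact lt_irrefl _)⟩
    rw [h2] at g1 g2 g3 g5 g6
    have hinf2 : τ2.var .inf = duration L + 1 := g1.inf
    have hbest : ∀ J, 𝒢.IsSolution s J → arrival 0 J ≤ duration L →
        τ2.var .best ≤ arrival 0 J := fun J hJ hJt =>
      hM.best_le hc (fun z hz => g5 z hz fun j hj hj' => absurd hj (by omega)) hJ (htot ▸ hJt)
    have ho2 : τ2.out = [] := by
      rw [← h2]
      refine Eq.trans ((run_frame _ _).out ?_) ho1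
      have : ∀ a, (nest (body c) a).writes = false := by
        intro a
        induction a with
        | zero => rfl
        | succ a ih => simp [nest, writes, block, ih]
      exact this c
    rw [hrun]
    by_cases hb : τ2.var .best < τ2.var .inf
    · obtain ⟨J, r1, r2, r3, r4, r5⟩ : ∃ J : List (Fin n × ℕ), 𝒢.IsSolution s J ∧
          arrival 0 J = τ2.var .best ∧ τ2.var .blen = J.length ∧
          record (τ2.arr .BV) (τ2.arr .BT) J.length = reversed J ∧
          J.length ≤ n * 2 ^ ((inst L s τ).k0 + 2 * c) := g2.sol (by rw [hinf2] at hb; exact hb)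
      obtain ⟨o1, o2⟩ := output_spec hb r3 r4
      refine ⟨Or.inl ⟨J, ⟨r1, fun J' hJ' => ?_⟩, by omega, ?_⟩, Or.inr ⟨by omega, ?_⟩⟩
      · by_cases hJt : arrival 0 J' ≤ duration L
        · exact r2.le.trans (hbest J' hJ' hJt)
        · omega
      · simp only [St.tick_out]
        rw [o1, ho2, List.nil_append]
      · simp only [St.tick_tm, mainTime]
        have : J.length * 60 ≤ n * 2 ^ ((inst L s τ).k0 + 2 * c) * 60 := Nat.mul_le_mul_right _ r5
        omega
    · obtain ⟨o1, o2⟩ := output_spec_none hb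
      refine ⟨Or.inr ⟨fun J hJ => ?_, ?_⟩, Or.inr ⟨by omega, ?_⟩⟩
      · by_contra hcon
        have := hbest J hJ (not_lt.1 hcon)
        omega
      · simp only [St.tick_out]
        rw [o1, ho2, List.nil_append]
      · simp only [St.tick_tm, mainTime]
        omega

end Visit

/-! ### The running time -/

namespace Visit
open DMVP

/-- The truncation to `n * K` steps is, up to the factor `2 * K`, the one to `max 1 (2n - 3)`. -/
theorem min_mul_le {n K d : ℕ} (hK : 1 ≤ K) :
    min d (n * K) ≤ 2 * K * min d (max 1 (2 * n - 3)) := by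
  have h1 : n ≤ 2 * max 1 (2 * n - 3) := by omega
  rcases le_total d (max 1 (2 * n - 3)) with h | h
  · rw [min_eq_left h]
    exact (min_le_left _ _).trans (Nat.le_mul_of_pos_left _ (by omega))
  · rw [min_eq_right h]
    calc min d (n * K) ≤ n * K := min_le_right _ _
      _ ≤ 2 * max 1 (2 * n - 3) * K := Nat.mul_le_mul_right _ h1
      _ = 2 * K * max 1 (2 * n - 3) := by ring

/-- Up to a constant factor, the time of one round of the search is the number of scans times the time of
a scan, `(K * T) * (n * (n * K))`, where `2 ^ k ≤ K`. -/
theorem bodyTime_le {D : Inst} {c K : ℕ} (hn : 1 ≤ D.n) (hq : 1 ≤ D.q)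
    (hd : ∀ b < D.q, 1 ≤ D.dur b) (hK : 2 ^ (D.k0 + 2 * c) ≤ K) :
    D.bodyTime c + 20 * c ≤ (2300 + 220 * c) * (K ^ 2 *
      ((∑ x ∈ Finset.range D.q, min (D.dur x) (max 1 (2 * D.n - 3))) * D.n ^ 2)) := by
  set n := D.n with hn'
  set T := ∑ x ∈ Finset.range D.q, min (D.dur x) (max 1 (2 * n - 3)) with hT
  have hK1 : 1 ≤ K := le_trans Nat.one_le_two_pow hK
  have hKK : K ≤ K ^ 2 := Nat.le_self_pow (by norm_num) K
  have hK2 : 1 ≤ K ^ 2 := hK1.trans hKK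
  have hnn : n ≤ n ^ 2 := Nat.le_self_pow (by norm_num) n
  have hqT : D.q ≤ T := by
    have : ∑ x ∈ Finset.range D.q, 1 ≤ T := Finset.sum_le_sum fun b hb =>
      le_min (hd b (Finset.mem_range.1 hb)) (le_max_left _ _)
    simpa using this
  have hT1 : 1 ≤ T := hq.trans hqT
  set a := K ^ 2 * (T * n ^ 2) with ha
  have hKn : ∀ x, x ≤ K ^ 2 * n ^ 2 → x ≤ a := fun x hx => hx.trans
    (Nat.mul_le_mul_left _ (Nat.le_mul_of_pos_left _ hT1))
  have a1 : n ^ 2 ≤ a := hKn _ (Nat.le_mul_of_pos_left _ hK2)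
  have a2 : n ≤ a := hnn.trans a1
  have a3 : 1 ≤ a := hn.trans a2
  obtain ⟨N, hN⟩ : ∃ N, n * 2 ^ (D.k0 + 2 * c) = N := ⟨_, rfl⟩
  have hNK : N ≤ n * K := hN ▸ Nat.mul_le_mul_left _ hK
  have a4 : n * N ≤ a := hKn _ <| by
    calc n * N ≤ n * (n * K) := Nat.mul_le_mul_left _ hNK
      _ = K * n ^ 2 := by ring
      _ ≤ _ := Nat.mul_le_mul_right _ hKK
  have a5 : N ≤ a := (Nat.le_mul_of_pos_left _ hn).trans a4
  have a6 : (D.k0 + 2 * c) * N ≤ a := hKn _ <| by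
    calc (D.k0 + 2 * c) * N ≤ K * (n * K) :=
          Nat.mul_le_mul (Nat.lt_two_pow_self.le.trans hK) hNK
      _ = K ^ 2 * n := by ring
      _ ≤ _ := Nat.mul_le_mul_left _ hnn
  have a7 : ∑ x ∈ Finset.range D.q, (200 + min (D.dur x) N * (N * (n * 200 + 100) + 100)) ≤
      1000 * a := by
    have e : 1000 * a = ∑ x ∈ Finset.range D.q,
        min (D.dur x) (max 1 (2 * n - 3)) * (1000 * (K ^ 2 * n ^ 2)) := by
      rw [← Finset.sum_mul, ← hT, ha]
      ring
    rw [e]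
    refine Finset.sum_le_sum fun b hb => ?_
    set x := min (D.dur b) (max 1 (2 * n - 3)) with hx
    have hx1 : 1 ≤ x := le_min (hd b (Finset.mem_range.1 hb)) (le_max_left _ _)
    have h1 : min (D.dur b) N ≤ 2 * K * x :=
      (min_le_min_left _ hNK).trans (min_mul_le hK1)
    have h2 : N * (n * 200 + 100) + 100 ≤ 400 * (K * n ^ 2) := by
      have h3 : N * (n * 200 + 100) ≤ n * K * (n * 300) := Nat.mul_le_mul hNK (by omega)
      have h4 : n * K * (n * 300) = 300 * (K * n ^ 2) := by ring
      have h5 : 1 ≤ K * n ^ 2 := Nat.mul_pos hK1 (by positivity)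
      linarith
    have h6 := Nat.mul_le_mul h1 h2
    have h7 : 2 * K * x * (400 * (K * n ^ 2)) = 800 * (x * (K ^ 2 * n ^ 2)) := by ring
    have h8 : 1 ≤ x * (K ^ 2 * n ^ 2) := Nat.mul_pos hx1 (by positivity)
    have h9 : x * (1000 * (K ^ 2 * n ^ 2)) = 1000 * (x * (K ^ 2 * n ^ 2)) := by ring
    omega
  have hb : D.bodyTime c = 200 + n * n * 30 + c * 200 + n * 40 + (D.k0 + 2 * c) * (N * 200) +
      N * 30 + (∑ x ∈ Finset.range D.q, (200 + min (D.dur x) N * (N * (n * 200 + 100) + 100))) +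
      n * (N * 400 + 400) := by rw [← hN]; rfl
  have e1 : n * n = n ^ 2 := by ring
  have e2 : (D.k0 + 2 * c) * (N * 200) = 200 * ((D.k0 + 2 * c) * N) := by ring
  have e3 : n * (N * 400 + 400) = 400 * (n * N) + 400 * n := by ring
  have e4 : (2300 + 220 * c) * a = 2300 * a + 220 * (c * a) := by ring
  have a8 : c ≤ c * a := Nat.le_mul_of_pos_right _ a3
  rw [hb, e1, e2, e3, e4]
  omega

/-- The bound on the number of checkpoints. -/
theorem card_lowVerts_unionGraph_le {n c m : ℕ} {𝒢 : TVG (Fin n)} {L : Snapshots n}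
    (hG : IsAlmostTree c 𝒢.graph) (hm : numLeaves 𝒢.graph = m) (hL : Describes L 𝒢)
    (hn : n ≤ (edgePairs (unionGraph L)).card + 1) :
    (lowVerts (unionGraph L)).card ≤ m + 1 + 2 * c := by
  have h1 := card_lowVerts_le hL.unionGraph_le
  have h2 := card_lowVerts_le_numLeaves hG.1
  have h3 := hG.2
  rw [← card_edgePairs, Nat.card_eq_fintype_card, Fintype.card_fin] at h3
  omega

theorem card_edgePairs_unionGraph_le {n c : ℕ} {𝒢 : TVG (Fin n)} {L : Snapshots n}
    (hG : IsAlmostTree c 𝒢.graph) (hL : Describes L 𝒢) :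
    (edgePairs (unionGraph L)).card + 1 ≤ n + c := by
  have h3 := hG.2
  rw [← card_edgePairs, Nat.card_eq_fintype_card, Fintype.card_fin] at h3
  have : edgePairs (unionGraph L) ⊆ edgePairs 𝒢.graph := by
    intro p hp
    rw [mem_edgePairs] at hp ⊢
    exact ⟨hp.1, hL.unionGraph_le hp.2⟩
  have := Finset.card_le_card this
  omega

/-- The factor in the time bound that depends on the parameter. -/
def timeFactor (c m : ℕ) : ℕ :=
  ((1 + c) ^ c * (2300 + 220 * c) + 1500) * (2 ^ (m + (1 + 4 * c)) * 2 ^ (m + (1 + 4 * c)))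

theorem computable_timeFactor (c : ℕ) : Computable (timeFactor c) := by
  have h1 : Primrec fun m : ℕ => 2 ^ m := by
    refine (Primrec.nat_rec₁ (f := fun _ x => 2 * x) 1
      (Primrec.nat_mul.comp (Primrec.const 2) Primrec.snd)).of_eq fun m => ?_
    induction m with
    | zero => rfl
    | succ m ih => rw [pow_succ, mul_comm, ← ih]
  have h2 : Primrec fun m : ℕ => 2 ^ (m + (1 + 4 * c)) :=
    h1.comp (Primrec.nat_add.comp Primrec.id (Primrec.const _))
  exact (Primrec.nat_mul.comp (Primrec.const _) (Primrec.nat_mul.comp h2 h2)).to_comp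

/-- The time for reading the input is within the bound. -/
theorem readTime_le {n q T : ℕ} (hn : 1 ≤ n) (hq : 1 ≤ q) (hT : q ≤ T) :
    416 + 33 * n + 3 * q + 5 * (3 + q * (1 + n * n)) + q * (n * n * 60 + 100) +
      n * (n * 120 + 100) ≤ 1000 * (T * n ^ 2) := by
  have hnn : n ≤ n ^ 2 := Nat.le_self_pow (by norm_num) n
  have h1 : n ^ 2 ≤ T * n ^ 2 := Nat.le_mul_of_pos_left _ (hq.trans hT)
  have h2 : q * n ^ 2 ≤ T * n ^ 2 := Nat.mul_le_mul_right _ hT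
  have h3 : q ≤ q * n ^ 2 := Nat.le_mul_of_pos_right _ (by positivity)
  have e1 : q * (1 + n * n) = q + q * n ^ 2 := by ring
  have e2 : q * (n * n * 60 + 100) = 60 * (q * n ^ 2) + 100 * q := by ring
  have e3 : n * (n * 120 + 100) = 120 * n ^ 2 + 100 * n := by ring
  rw [e1, e2, e3]
  omega

/-- The factor `n ^ c` for the number of tuples comes on top of `bodyTime_le`. -/
theorem totalTime_le {n c m : ℕ} {L : Snapshots n} {D : Inst} (hn : 1 ≤ n) (hDn : D.n = n)
    (hDq : D.q = L.length) (hDd : D.dur = dur L) (hL : L ≠ []) (hd : ∀ x ∈ L, 1 ≤ x.2)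
    (hM : D.M ≤ n + c) (hk : D.k0 ≤ m + 1 + 2 * c) :
    16 + 3 * n + 3 * L.length + 5 * (3 + L.length * (1 + n * n)) + mainTime c L D ≤
      timeFactor c m * (truncDuration L * n ^ (3 + c)) := by
  set K := 2 ^ (m + (1 + 4 * c)) with hKdef
  have hK : 2 ^ (D.k0 + 2 * c) ≤ K := Nat.pow_le_pow_right (by norm_num) (by omega)
  have hK1 : 1 ≤ K := Nat.one_le_two_pow
  have hKK : K ≤ K ^ 2 := Nat.le_self_pow (by norm_num) K
  have hq : 1 ≤ L.length := List.length_pos_iff.2 hL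
  have hdur : ∀ b < D.q, 1 ≤ D.dur b := by
    intro b hb
    rw [hDq] at hb
    rw [hDd, dur_eq L hb]
    exact hd _ (List.getElem_mem hb)
  have hT : ∑ x ∈ Finset.range D.q, min (D.dur x) (max 1 (2 * D.n - 3)) = truncDuration L := by
    rw [hDn, hDq, hDd, sum_dur fun y => min y (max 1 (2 * n - 3))]
    rfl
  have hqT : L.length ≤ truncDuration L := by
    rw [← hT, hDq]
    have : ∑ x ∈ Finset.range L.length, 1 ≤
        ∑ x ∈ Finset.range L.length, min (D.dur x) (max 1 (2 * D.n - 3)) :=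
      Finset.sum_le_sum fun b hb =>
        le_min (hdur b (by rw [hDq]; exact Finset.mem_range.1 hb)) (le_max_left _ _)
    simpa using this
  have h1 := bodyTime_le (D := D) (c := c) (K := K) (by omega) (by omega) hdur hK
  rw [hT, hDn] at h1
  have h2 := readTime_le hn hq hqT
  set T := truncDuration L
  have h3 : D.M ^ c ≤ (1 + c) ^ c * n ^ c := by
    rw [← mul_pow]
    refine Nat.pow_le_pow_left (hM.trans ?_) c
    have : c ≤ c * n := Nat.le_mul_of_pos_right _ hn
    rw [Nat.add_mul]
    omega
  have hpow : n ^ (2 + c) ≤ n ^ (3 + c) := Nat.pow_le_pow_right hn (by omega)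
  have hpow2 : n ^ 2 ≤ n ^ (3 + c) := Nat.pow_le_pow_right hn (by omega)
  set a := K ^ 2 * (T * n ^ (3 + c)) with ha
  have h4 : D.M ^ c * (D.bodyTime c + 20 * c) ≤ (1 + c) ^ c * (2300 + 220 * c) * a := by
    calc D.M ^ c * (D.bodyTime c + 20 * c)
        ≤ (1 + c) ^ c * n ^ c * ((2300 + 220 * c) * (K ^ 2 * (T * n ^ 2))) := Nat.mul_le_mul h3 h1
      _ = (1 + c) ^ c * (2300 + 220 * c) * (K ^ 2 * (T * n ^ (2 + c))) := by ring
      _ ≤ _ := Nat.mul_le_mul_left _ (Nat.mul_le_mul_left _ (Nat.mul_le_mul_left _ hpow))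
  have h5 : T * n ^ 2 ≤ a := (Nat.mul_le_mul_left _ hpow2).trans
    (Nat.le_mul_of_pos_left _ (hK1.trans hKK))
  have h6 : n * 2 ^ (D.k0 + 2 * c) ≤ a := by
    calc n * 2 ^ (D.k0 + 2 * c) ≤ n ^ (3 + c) * K ^ 2 :=
          Nat.mul_le_mul (Nat.le_self_pow (by omega) n) (hK.trans hKK)
      _ = K ^ 2 * (1 * n ^ (3 + c)) := by ring
      _ ≤ _ := Nat.mul_le_mul_left _ (Nat.mul_le_mul_right _ (hq.trans hqT))
  have e : timeFactor c m * (T * n ^ (3 + c)) =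
      (1 + c) ^ c * (2300 + 220 * c) * a + 1500 * a := by
    rw [timeFactor, ← hKdef, ha]
    ring
  rw [e, mainTime]
  omega

end Visit

theorem theorem10 (c : ℕ) :
    ∃ (p : RAM.Prog) (f : ℕ → ℕ), Computable f ∧
      ∀ (n m : ℕ) (𝒢 : TVG (Fin n)) (L : DMVP.Snapshots n) (s : Fin n),
        𝒢.Recurrent → IsAlmostTree c 𝒢.graph → numLeaves 𝒢.graph = m → DMVP.Describes L 𝒢 →
        ∃ (output : List ℕ) (t : ℕ),
          RAM.Computes p (DMVP.encodeInput L s) output t ∧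
          DMVP.IsCorrectOutput 𝒢 L s output ∧
          t ≤ f m * (DMVP.truncDuration L * n ^ (3 + c)) := by
  refine ⟨.seq copyInput ((Visit.main c).comp 0), Visit.timeFactor c,
    Visit.computable_timeFactor c, fun n m 𝒢 L s _ hG hm hL => ?_⟩
  have hn : 1 ≤ n := s.pos
  have hlen := DMVP.length_encodeInput L s
  obtain ⟨γ, t1, x1, hs1, ht1⟩ := exec_copyInput (DMVP.encodeInput L s) n L.length rfl rfl hlen
  obtain ⟨γ', t2, x2, hs2, ht2, -⟩ := (Visit.main c).exec_comp 0 _ γ hs1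
  obtain ⟨D, hDn, hDq, hDd, hDM, hDk, hcorrect, htime⟩ :=
    Visit.main_spec c s hL (Visit.card_edgePairs_unionGraph_le hG hL)
  refine ⟨_, t1 + t2, ⟨γ', RAM.Exec.seq x1 x2, hs2.out⟩, hcorrect, ?_⟩
  have h0 : (St.start (DMVP.encodeInput L s)).tm = 0 := rfl
  rw [hlen] at ht1
  rcases htime with ⟨-, htime⟩ | ⟨hle, htime⟩
  · -- no search: the time for reading the input suffices
    have hqT : L.length ≤ DMVP.truncDuration L := by
      have h : (L.map fun _ => 1).sum ≤ DMVP.truncDuration L :=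
        List.sum_le_sum fun x hx => le_min (hL.2.1 x hx) (le_max_left _ _)
      simpa using h
    have h1 := Visit.readTime_le hn (List.length_pos_iff.2 hL.1) hqT
    have h2 : DMVP.truncDuration L * n ^ 2 ≤ DMVP.truncDuration L * n ^ (3 + c) :=
      Nat.mul_le_mul_left _ (Nat.pow_le_pow_right hn (by omega))
    have h3 : 1000 * (DMVP.truncDuration L * n ^ (3 + c)) ≤
        Visit.timeFactor c m * (DMVP.truncDuration L * n ^ (3 + c)) := by
      refine Nat.mul_le_mul_right _ ?_
      have : 1 ≤ 2 ^ (m + (1 + 4 * c)) * 2 ^ (m + (1 + 4 * c)) :=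
        Nat.mul_pos (by positivity) (by positivity)
      exact le_trans (by norm_num) (Nat.mul_le_mul (Nat.le_add_left 1500 _) this)
    omega
  · have h1 := Visit.totalTime_le (D := D) (m := m) hn hDn hDq hDd hL.1 hL.2.1
      (hDM.trans_le (Visit.card_edgePairs_unionGraph_le hG hL))
      (hDk.trans_le (Visit.card_lowVerts_unionGraph_le hG hm hL (hDM ▸ hle)))
    omega
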